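/- Let $k$ be an algebraically closed field. Let $\nu_n:\mathbb P^1\to\mathbb P^n$, $[x:y]\mapsto[x^n:x^{n-1}y:\cdots:y^n]$, be the Veronese embedding, and let $\mathbb G(n-2,n)$ be the Grassmannian of $(n-2)$-dimensional linear subspaces of $\mathbb P^n$, with its Zariski topology. A subspace $W\in\mathbb G(n-2,n)$ with $W\cap\nu_n(\mathbb P^1)=\varnothing$ is called a Galois subspace if the morphism $\pi=\pi_W\circ\nu_n:\mathbb P^1\to\mathbb P^1$, where $\pi_W:\mathbb P^n\dashrightarrow\mathbb P^1$ is the linear projection with center $W$, induces a Galois extension $\pi^*k(\mathbb P^1)\subseteq k(\mathbb P^1)$; the Galois group of $W$ is the Galois group of this extension. For $a,b,c,d,\alpha\in k$ put $$L_{a,c}=\sum_{i=0}^n\binom ni(-1)^ia^ic^{n-i}x_i,$$ and, if $n=2m$, put $$A_{a,b,c,d}=\sum_{i+j+l=m}\binom m{i,j,l}(-1)^i(ad+bc)^i(ab)^j(cd)^l\,x_{i+2l},\qquad B^\alpha_{a,b,c,d}=\sum_{i=0}^{n}\binom ni(-1)^i\left(\alpha^ma^{n-i}c^i+b^{n-i}d^i\right)x_i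 .$$ Let $$\mathcal C_n=\{\{L_{a,c}=L_{b,d}=0\}: ad-bc\neq0\}\subseteq\mathbb G(n-2,n),$$ $$\mathcal D_m=\{\{A_{a,b,c,d}=B^\alpha_{a,b,c,d}=0\}:\alpha\ne0,\ ad-bc\neq0\}\subseteq\mathbb G(2m-2,2m),$$ and let $\mathcal K\subseteq\mathbb G(2,4)$, $\mathcal A_4\subseteq\mathbb G(10,12)$, $\mathcal S_4\subseteq\mathbb G(22,24)$ and $\mathcal A_5\subseteq\mathbb G(58,60)$ be the sets of all Galois subspaces disjoint from $\nu_n(\mathbb P^1)$ (with $n=4,12,24,60$, respectively) whose Galois group is isomorphic to the Klein four group $K_4$, to $A_4$, to $S_4$ and to $A_5$, respectively. Then: 1. for every $n\ge3$ such that $\operatorname{char}k\nmid n$, the family $\mathcal C_n$ is a locally closed subset of $\mathbb G(n-2,n)$ of dimension $2$; 2. for every $m\ge3$ such that $\operatorname{char}k\nmid 2m$, the family $\mathcal D_m$ is a locally closed subset of $\mathbb G(2m-2,2m)$ of dimension $3$; 3. if $\operatorname{char}k$ does not divide $4$ (resp. $12$, $24$, $60$), the family $\mathcal K$ (resp. $\mathcal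 A_4$, $\mathcal S_4$, $\mathcal A_5$) is a locally closed subset of dimension $3$ of $\mathbb G(2,4)$ (resp. $\mathbb G(10,12)$, $\mathbb G(22,24)$, $\mathbb G(58,60)$). Here $\operatorname{char}k\nmid n$ means that $n\neq 0$ in $k$; in characteristic $0$ it always holds. Dimension is Krull dimension for the Zariski topology. -/

import Mathlib

open Finset

noncomputable section

namespace RationalNormal

/-- The rational normal curve `ν_n : ℙ¹ → ℙⁿ`, `[x : y] ↦ [xⁿ : xⁿ⁻¹y : ⋯ : yⁿ]`, on homogeneous
coordinates. -/
def veronese {k : Type*} [Field k] (n : ℕ) (x y : k) : Fin (n + 1) → k :=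
  fun i => x ^ (n - (i : ℕ)) * y ^ (i : ℕ)

/-- The linear subspace `{L = M = 0}` of `k ^ (n + 1)`, where a linear form `∑ cᵢ xᵢ` is given by
its vector of coefficients. -/
def zeroSpace {k : Type*} [Field k] {n : ℕ} (L M : Fin (n + 1) → k) :
    Submodule k (Fin (n + 1) → k) where
  carrier := {x | L ⬝ᵥ x = 0 ∧ M ⬝ᵥ x = 0}
  add_mem' := by
    rintro x y ⟨h1, h2⟩ ⟨h3, h4⟩
    exact ⟨by rw [dotProduct_add, h1, h3, add_zero], by rw [dotProduct_add, h2, h4, add_zero]⟩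
  zero_mem' := ⟨dotProduct_zero L, dotProduct_zero M⟩
  smul_mem' := by
    rintro r x ⟨h1, h2⟩
    exact ⟨by rw [dotProduct_smul, h1, smul_zero], by rw [dotProduct_smul, h2, smul_zero]⟩

/-- The (closed points of the) Grassmannian `𝔾(n - 2, n)` of `(n - 2)`-dimensional linear subspaces
of `ℙⁿ`, that is, of linear subspaces of `k ^ (n + 1)` of dimension `n - 1`. -/
def Grass (k : Type*) [Field k] (n : ℕ) : Type _ :=
  {W : Submodule k (Fin (n + 1) → k) // Module.finrank k W + 2 = n + 1}

/-- The Plücker coordinates `p_{ij} = Lᵢ Mⱼ - Lⱼ Mᵢ` of the subspace `{L = M = 0}`. All ordered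
pairs `(i, j)` are used as indices. -/
def plucker {k : Type*} [Field k] {n : ℕ} (L M : Fin (n + 1) → k) :
    Fin (n + 1) × Fin (n + 1) → k :=
  fun p => L p.1 * M p.2 - L p.2 * M p.1

/-- The Zariski topology of `𝔾(n - 2, n)`, induced by the Plücker embedding: it is generated by the
loci where a homogeneous polynomial in the Plücker coordinates does not vanish. Such a condition
does not depend on the two equations chosen for `W`, which change the coordinates by a nonzero
common factor. -/
instance (k : Type*) [Field k] (n : ℕ) : TopologicalSpace (Grass k n) :=
  TopologicalSpace.generateFrom
    {U | ∃ (F : MvPolynomial (Fin (n + 1) × Fin (n + 1)) k) (e : ℕ), F.IsHomogeneous e ∧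
      U = {W | ∃ L M : Fin (n + 1) → k,
        W.1 = zeroSpace L M ∧ MvPolynomial.eval (plucker L M) F ≠ 0}}

/-- The coefficients of `L_{a,c} = ∑ᵢ (n choose i) (-1)ⁱ aⁱ cⁿ⁻ⁱ xᵢ`. -/
def formL {k : Type*} [Field k] (n : ℕ) (a c : k) : Fin (n + 1) → k :=
  fun i => (n.choose i : k) * (-1) ^ (i : ℕ) * a ^ (i : ℕ) * c ^ (n - (i : ℕ))

/-- The coefficients of
`A_{a,b,c,d} = ∑_{i+j+l=m} (m choose i,j,l) (-1)ⁱ (ad+bc)ⁱ (ab)ʲ (cd)ˡ x_{i+2l}`;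
here `(i, j, l) = (s 0, s 1, s 2)`. -/
def formA {k : Type*} [Field k] (m : ℕ) (a b c d : k) : Fin (2 * m + 1) → k :=
  fun r => ∑ s ∈ (Finset.piAntidiag (Finset.univ : Finset (Fin 3)) m) with s 0 + 2 * s 2 = (r : ℕ),
    (Nat.multinomial Finset.univ s : k) * (-1) ^ s 0 *
      (a * d + b * c) ^ s 0 * (a * b) ^ s 1 * (c * d) ^ s 2

/-- The coefficients of
`B^α_{a,b,c,d} = ∑ᵢ (n choose i) (-1)ⁱ (αᵐ aⁿ⁻ⁱ cⁱ + bⁿ⁻ⁱ dⁱ) xᵢ`, where `n = 2m`. -/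
def formB {k : Type*} [Field k] (m : ℕ) (α a b c d : k) : Fin (2 * m + 1) → k :=
  fun i => ((2 * m).choose i : k) * (-1) ^ (i : ℕ) *
    (α ^ m * a ^ (2 * m - (i : ℕ)) * c ^ (i : ℕ) + b ^ (2 * m - (i : ℕ)) * d ^ (i : ℕ))

/-- The family `𝒞_n` of the subspaces `{L_{a,c} = L_{b,d} = 0}`, where `[a : c] ≠ [b : d]`. -/
def familyC (k : Type*) [Field k] (n : ℕ) : Set (Grass k n) :=
  {W | ∃ a b c d : k, a * d - b * c ≠ 0 ∧ W.1 = zeroSpace (formL n a c) (formL n b d)}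

/-- The family `𝒟_m` of the subspaces `{A_{a,b,c,d} = B^α_{a,b,c,d} = 0}`, where `ad - bc ≠ 0` and
`α ≠ 0`. (Over an algebraically closed field every nonzero `α` yields the same subspaces.) -/
def familyD (k : Type*) [Field k] (m : ℕ) : Set (Grass k (2 * m)) :=
  {W | ∃ α a b c d : k, α ≠ 0 ∧ a * d - b * c ≠ 0 ∧
    W.1 = zeroSpace (formA m a b c d) (formB m α a b c d)}

/-- The restriction to the rational normal curve of the linear form with coefficients `L`, divided
by `yⁿ`, as an element of the function field `k(ℙ¹) = k(t)`, where `t = x / y`. -/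
def restrictForm {k : Type*} [Field k] {n : ℕ} (L : Fin (n + 1) → k) : RatFunc k :=
  ∑ i : Fin (n + 1), RatFunc.C (L i) * RatFunc.X ^ (n - (i : ℕ))

/-- The subfield `π^* k(ℙ¹)` of `k(ℙ¹) = k(t)`, where `π : ℙ¹ → ℙ¹` is the composite of `ν_n` with
the linear projection with center `W`: it is generated over `k` by the quotients of the
restrictions of the linear forms that vanish on `W`. -/
def projField {k : Type*} [Field k] {n : ℕ} (W : Grass k n) : IntermediateField k (RatFunc k) :=
  IntermediateField.adjoin k
    {f | ∃ L M : Fin (n + 1) → k, (∀ w ∈ W.1, L ⬝ᵥ w = 0) ∧ (∀ w ∈ W.1, M ⬝ᵥ w = 0) ∧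
      restrictForm M ≠ 0 ∧ f = restrictForm L / restrictForm M}

/-- The family of all Galois subspaces `W` in `𝔾(n - 2, n)`, disjoint from `ν_n(ℙ¹)`, whose Galois
group is isomorphic to `G`. -/
def galoisFamily (k : Type*) [Field k] (n : ℕ) (G : Type*) [Group G] : Set (Grass k n) :=
  {W | (∀ x y : k, (x, y) ≠ 0 → veronese n x y ∉ W.1) ∧
    IsGalois (projField W) (RatFunc k) ∧
    Nonempty ((RatFunc k ≃ₐ[projField W] RatFunc k) ≃* G)}

/-- `S` is a locally closed subset of dimension `d`. -/
def IsLocallyClosedOfDim {X : Type*} [TopologicalSpace X] (S : Set X) (d : ℕ) : Prop :=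
  IsLocallyClosed S ∧ topologicalKrullDim S = d

end RationalNormal

end

/-! A point of the Grassmannian is treated as its pencil of linear forms, that is, as a
two-dimensional space of binary forms of degree `n` after restriction to the curve; invertible 2 × 2
matrices act on pencils by substitution. Each family is a finite union of images of a space of
matrices, and the images lie in the open locus of base point free pencils. If these maps are closed
onto their images inside that locus and have fibres that are finite modulo scalars, then the union
is locally closed and has the dimension of the source (`isLocallyClosedOfDim_iUnion_range`). The
sources `GLCone` and `ProjCone` carry the topology defined by homogeneous polynomials. Proportional
matrices are then inseparable, and the dimensions are those of PGL₂, namely 3, and of the space of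
rank one projections, namely 2.

Closedness comes from elimination theory. A base point free pencil `W'` lies in the orbit of `W` if
and only if some nonzero matrix carries the forms of `W'` into the pencil of `W`, provided that
singular matrices can be excluded. A singular matrix has rank one and turns a form that does not
vanish on its image into a multiple of the `n`-th power of a linear form. So the condition `NoPower
W` suffices, and for the same reason the stabilizer of `W` is finite modulo scalars. This gives
`isLocallyClosedOfDim_orbits`; the family 𝒟 is a single orbit of this kind.

The pencils of 𝒞 are spanned by two `n`-th powers, so this argument does not apply to them. Such a
pencil is described by a projection whose two left eigenvectors are the linear forms, and it is
recovered as the set of forms that a "rotation" of order `n` with these eigenvectors multiplies by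
one fixed factor. The only ambiguity is the exchange of kernel and image.

For |G| = n, a subspace is Galois with group G if and only if it is base point free and invariant
under some injective homomorphism from G to PGL₂ (`mem_galoisFamily_iff`), and each such
homomorphism has exactly one invariant base point free pencil (`exists_invariant`,
`eq_of_invariant`). All four groups contain a Klein four group, which can be conjugated to a
standard one when 2 ≠ 0. After this normalization every matrix of the representation is determined
by four traces, each a sum l + l⁻¹ with l a root of unity of bounded order. Hence there are finitely
many normalized pencils, so finitely many orbits. At least one exists because the groups embed in
PGL₂: the Klein group by explicit matrices, and A₄, S₄, A₅ as symmetries of a regular simplex in the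
space of 2 × 2 matrices with the determinant as quadratic form. -/

noncomputable section

/-! ### Binary forms as functions on the plane -/

namespace RationalNormal

variable {k : Type*} [Field k] {n : ℕ}

/-- The value at `u` of the binary form `∑ Lᵢ xⁿ⁻ⁱ yⁱ`. -/
def evalForm (n : ℕ) : (Fin (n + 1) → k) →ₗ[k] ((Fin 2 → k) → k) where
  toFun L u := L ⬝ᵥ veronese n (u 0) (u 1)
  map_add' L M := by ext u; simp [add_dotProduct]
  map_smul' c L := by ext u; simp [smul_dotProduct]

theorem evalForm_apply (L : Fin (n + 1) → k) (u : Fin 2 → k) :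
    evalForm n L u = ∑ i : Fin (n + 1), L i * (u 0 ^ (n - (i : ℕ)) * u 1 ^ (i : ℕ)) := rfl

theorem evalForm_smul (L : Fin (n + 1) → k) (c : k) (u : Fin 2 → k) :
    evalForm n L (c • u) = c ^ n * evalForm n L u := by
  rw [evalForm_apply, evalForm_apply, Finset.mul_sum]
  refine Finset.sum_congr rfl fun i _ => ?_
  have hi : c ^ n = c ^ (n - (i : ℕ)) * c ^ (i : ℕ) := by
    rw [← pow_add, Nat.sub_add_cancel (by omega)]
  simp only [Pi.smul_apply, smul_eq_mul, mul_pow, hi]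
  ring

theorem evalForm_one_right (L : Fin (n + 1) → k) (t : k) :
    evalForm n L ![1, t] = ∑ i : Fin (n + 1), L i * t ^ (i : ℕ) := by
  simp [evalForm_apply]

/-- The coefficients of a binary form are fixed combinations of its values. -/
theorem exists_interpolation (k : Type*) [Field k] [Infinite k] (n : ℕ) :
    ∃ (t : Fin (n + 1) → k) (c : Fin (n + 1) → Fin (n + 1) → k),
      ∀ (L : Fin (n + 1) → k) i, L i = ∑ a, c i a * evalForm n L ![1, t a] := by
  obtain ⟨t, ht⟩ : ∃ t : Fin (n + 1) → k, Function.Injective t :=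
    ⟨fun i => Infinite.natEmbedding k i, fun i j h => by
      exact Fin.ext ((Infinite.natEmbedding k).injective h)⟩
  have hdet : IsUnit (Matrix.vandermonde t).det :=
    isUnit_iff_ne_zero.2 (Matrix.det_vandermonde_ne_zero_iff.2 ht)
  refine ⟨t, fun i a => (Matrix.vandermonde t)⁻¹ i a, fun L i => ?_⟩
  have h : (Matrix.vandermonde t).mulVec L = fun a => evalForm n L ![1, t a] := by
    ext a
    rw [evalForm_one_right]
    simp [Matrix.mulVec, dotProduct, Matrix.vandermonde_apply, mul_comm]
  have h2 : (Matrix.vandermonde t)⁻¹.mulVec ((Matrix.vandermonde t).mulVec L) = L := by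
    rw [Matrix.mulVec_mulVec, Matrix.nonsing_inv_mul _ hdet, Matrix.one_mulVec]
  conv_lhs => rw [← h2, h]
  rfl

theorem evalForm_injective [Infinite k] :
    Function.Injective (evalForm (k := k) n) := by
  obtain ⟨t, c, h⟩ := exists_interpolation k n
  intro L M hLM
  ext i
  rw [h L i, h M i, hLM]

theorem evalForm_eq_zero [Infinite k] {L : Fin (n + 1) → k} (h : ∀ u, evalForm n L u = 0) :
    L = 0 :=
  evalForm_injective (by rw [map_zero]; exact funext h)

/-- The functions on `k²` given by binary forms of degree `n`. -/
def IsForm (n : ℕ) (φ : (Fin 2 → k) → k) : Prop := φ ∈ LinearMap.range (evalForm (k := k) n)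

theorem range_evalForm (n : ℕ) : LinearMap.range (evalForm (k := k) n) =
    Submodule.span k (Set.range fun i : Fin (n + 1) =>
      fun u : Fin 2 → k => u 0 ^ (n - (i : ℕ)) * u 1 ^ (i : ℕ)) := by
  apply le_antisymm
  · rintro _ ⟨L, rfl⟩
    have : evalForm n L = ∑ i : Fin (n + 1),
        L i • fun u : Fin 2 → k => u 0 ^ (n - (i : ℕ)) * u 1 ^ (i : ℕ) := by
      ext u; simp [evalForm_apply]
    rw [this]
    exact Submodule.sum_mem _ fun i _ => Submodule.smul_mem _ _ (Submodule.subset_span ⟨i, rfl⟩)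
  · rw [Submodule.span_le]
    rintro _ ⟨i, rfl⟩
    refine ⟨Pi.single i 1, ?_⟩
    ext u
    simp [evalForm_apply, Pi.single_apply]

theorem IsForm.add {φ ψ : (Fin 2 → k) → k} (h : IsForm n φ) (h' : IsForm n ψ) :
    IsForm n (φ + ψ) := Submodule.add_mem _ h h'

theorem IsForm.smul {φ : (Fin 2 → k) → k} (c : k) (h : IsForm n φ) : IsForm n (c • φ) :=
  Submodule.smul_mem _ c h

theorem IsForm.mul {m : ℕ} {φ ψ : (Fin 2 → k) → k} (h : IsForm n φ) (h' : IsForm m ψ) :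
    IsForm (n + m) (φ * ψ) := by
  have key : LinearMap.range (evalForm (k := k) n) * LinearMap.range (evalForm (k := k) m) ≤
      LinearMap.range (evalForm (k := k) (n + m)) := by
    rw [range_evalForm, range_evalForm, range_evalForm, Submodule.span_mul_span, Submodule.span_le]
    rintro _ ⟨_, ⟨i, rfl⟩, _, ⟨j, rfl⟩, rfl⟩
    refine Submodule.subset_span ⟨⟨i + j, by omega⟩, ?_⟩
    ext u
    have h1 : n + m - ((i : ℕ) + j) = (n - i) + (m - j) := by omega
    simp only [Pi.mul_apply, h1, pow_add]
    ring
  exact key (Submodule.mul_mem_mul h h')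

theorem isForm_const (c : k) : IsForm 0 (fun _ : Fin 2 → k => c) :=
  ⟨fun _ => c, by ext u; simp [evalForm_apply]⟩

theorem IsForm.pow {φ : (Fin 2 → k) → k} (h : IsForm n φ) (m : ℕ) : IsForm (n * m) (φ ^ m) := by
  induction m with
  | zero => rw [mul_zero, pow_zero]; exact isForm_const (1 : k)
  | succ m ih => rw [pow_succ, mul_add, mul_one]; exact ih.mul h

theorem isForm_linear (a b : k) : IsForm 1 (fun u : Fin 2 → k => a * u 0 + b * u 1) :=
  ⟨![a, b], by ext u; simp [evalForm_apply, Fin.sum_univ_two]⟩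

theorem isForm_linear_pow (a b : k) (n : ℕ) :
    IsForm n (fun u : Fin 2 → k => (a * u 0 + b * u 1) ^ n) := by
  have := (isForm_linear a b).pow n
  rwa [one_mul] at this

theorem IsForm.prod {ι : Type*} (s : Finset ι) (φ : ι → (Fin 2 → k) → k)
    (h : ∀ i ∈ s, IsForm 1 (φ i)) : IsForm s.card (∏ i ∈ s, φ i) := by
  classical
  induction s using Finset.induction_on with
  | empty => exact isForm_const 1
  | insert i s hi ih =>
    rw [Finset.prod_insert hi, Finset.card_insert_of_notMem hi, add_comm]
    exact (h i (by simp)).mul (ih fun j hj => h j (by simp [hj]))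

theorem IsForm.comp {φ : (Fin 2 → k) → k} (h : IsForm n φ) (M : Matrix (Fin 2) (Fin 2) k) :
    IsForm n (fun u => φ (M.mulVec u)) := by
  obtain ⟨L, rfl⟩ := h
  have : (fun u => evalForm n L (M.mulVec u)) = ∑ i : Fin (n + 1), L i •
      ((fun u : Fin 2 → k => (M 0 0 * u 0 + M 0 1 * u 1) ^ (n - (i : ℕ))) *
        fun u : Fin 2 → k => (M 1 0 * u 0 + M 1 1 * u 1) ^ (i : ℕ)) := by
    ext u
    simp [evalForm_apply, Matrix.mulVec_eq_sum, Fin.sum_univ_two, mul_comm]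
  rw [this]
  refine Submodule.sum_mem _ fun i _ => Submodule.smul_mem _ _ ?_
  have := (isForm_linear_pow (M 0 0) (M 0 1) (n - (i : ℕ))).mul
    (isForm_linear_pow (M 1 0) (M 1 1) (i : ℕ))
  rwa [Nat.sub_add_cancel (by omega)] at this

/-- The form `f ∘ M`. -/
def compForm (M : Matrix (Fin 2) (Fin 2) k) (L : Fin (n + 1) → k) : Fin (n + 1) → k :=
  (IsForm.comp (⟨L, rfl⟩ : IsForm n (evalForm n L)) M).choose

@[simp] theorem evalForm_compForm (M : Matrix (Fin 2) (Fin 2) k) (L : Fin (n + 1) → k)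
    (u : Fin 2 → k) : evalForm n (compForm M L) u = evalForm n L (M.mulVec u) :=
  congrFun (IsForm.comp (⟨L, rfl⟩ : IsForm n (evalForm n L)) M).choose_spec u

/-- The determinant `[u, v]` of two vectors of the plane. -/
def bracket (u v : Fin 2 → k) : k := u 0 * v 1 - u 1 * v 0

theorem bracket_eq_zero_iff {u v : Fin 2 → k} (hu : u ≠ 0) :
    bracket u v = 0 ↔ ∃ c : k, v = c • u := by
  constructor
  · intro h
    unfold bracket at h
    by_cases h0 : u 0 = 0
    · have h1 : u 1 ≠ 0 := fun h1 => hu (by ext i; fin_cases i <;> simp [h0, h1])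
      refine ⟨v 1 / u 1, ?_⟩
      have : v 0 = 0 := by simpa [h0, h1] using h
      ext i; fin_cases i <;> simp [h0, h1, this]
    · refine ⟨v 0 / u 0, ?_⟩
      ext i; fin_cases i
      · simp [h0]
      · simp; field_simp; linear_combination h
  · rintro ⟨c, rfl⟩
    simp [bracket]; ring

theorem bracket_mulVec (M : Matrix (Fin 2) (Fin 2) k) (u v : Fin 2 → k) :
    bracket (M.mulVec u) (M.mulVec v) = M.det * bracket u v := by
  simp [bracket, Matrix.mulVec, dotProduct, Fin.sum_univ_two, Matrix.det_fin_two]; ring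

theorem isForm_bracket (w : Fin 2 → k) : IsForm 1 (bracket w) := by
  convert isForm_linear (-w 1) (w 0) using 1
  ext u; simp [bracket]; ring

/-- A form of degree `n` with more than `n` zeros on the projective line vanishes. -/
theorem eq_zero_of_card_zeros {L : Fin (n + 1) → k} {ι : Type*} (s : Finset ι)
    (u : ι → Fin 2 → k) (hu : ∀ i ∈ s, u i ≠ 0)
    (hs : ∀ i ∈ s, ∀ j ∈ s, i ≠ j → bracket (u i) (u j) ≠ 0) (hcard : n < s.card)
    (h0 : ∀ i ∈ s, evalForm n L (u i) = 0) : L = 0 := by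
  classical
  -- Dehomogenize with t = u 1 / u 0. At most one of the points has u 0 = 0. If there is one, the
  -- leading coefficient `L (Fin.last n)` vanishes, so the degree drops by one and the remaining
  -- points still outnumber it.
  set q : Polynomial k := ∑ i : Fin (n + 1), Polynomial.C (L i) * Polynomial.X ^ (i : ℕ) with hq
  have hqc : ∀ i : Fin (n + 1), q.coeff i = L i := by
    intro i
    simp only [hq, Polynomial.finsetSum_coeff, Polynomial.coeff_C_mul, Polynomial.coeff_X_pow]
    rw [Finset.sum_eq_single i] <;> simp +contextual [Fin.ext_iff, eq_comm]
  have hroot : ∀ i ∈ s, u i 0 ≠ 0 → q.eval (u i 1 / u i 0) = 0 := by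
    intro i hi h
    have h1 : u i = u i 0 • ![1, u i 1 / u i 0] := by
      ext j; fin_cases j
      · simp
      · simp; field_simp
    have h2 := h0 i hi
    rw [h1, evalForm_smul, evalForm_one_right] at h2
    have h3 := (mul_eq_zero.1 h2).resolve_left (pow_ne_zero _ h)
    rw [hq, Polynomial.eval_finsetSum, ← h3]
    simp
  have hinj : ∀ i ∈ s, ∀ j ∈ s, u i 0 ≠ 0 → u j 0 ≠ 0 → u i 1 / u i 0 = u j 1 / u j 0 → i = j := by
    intro i hi j hj h h' he
    by_contra hne
    apply hs i hi j hj hne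
    rw [div_eq_div_iff h h'] at he
    simp only [bracket]; linear_combination -he
  have hq0 : q = 0 := by
    set s' := s.filter fun i => u i 0 ≠ 0 with hs'
    have hcs : s'.card = (s'.image fun i => u i 1 / u i 0).card := by
      rw [Finset.card_image_of_injOn]
      intro i hi j hj he
      simp only [hs', Finset.coe_filter, Set.mem_ofPred_eq] at hi hj
      exact hinj i hi.1 j hj.1 hi.2 hj.2 he
    by_contra hne
    have hle : s'.card ≤ q.natDegree := by
      rw [hcs]
      refine le_trans (Finset.card_le_card ?_) (le_trans (Multiset.toFinset_card_le _)
        (Polynomial.card_roots' q))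
      intro t ht
      obtain ⟨i, hi, rfl⟩ := Finset.mem_image.1 ht
      rw [hs', Finset.mem_filter] at hi
      rw [Multiset.mem_toFinset, Polynomial.mem_roots hne]
      exact hroot i hi.1 hi.2
    have hdeg : q.natDegree ≤ n := by
      refine Polynomial.natDegree_sum_le_of_forall_le _ _ fun i _ => ?_
      exact (Polynomial.natDegree_C_mul_X_pow_le _ _).trans (by omega)
    by_cases hex : ∃ i ∈ s, u i 0 = 0
    · obtain ⟨i, hi, hi0⟩ := hex
      have hLn : L (Fin.last n) = 0 := by
        have h2 := h0 i hi
        have h1 : u i 1 ≠ 0 := fun h1 => hu i hi (by ext j; fin_cases j <;> simp [hi0, h1])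
        rw [evalForm_apply, Finset.sum_eq_single (Fin.last n)] at h2
        · simpa [h1] using h2
        · intro j _ hj
          have : n - (j : ℕ) ≠ 0 := by
            have := j.2
            have : (j : ℕ) ≠ n := fun h => hj (Fin.ext h)
            omega
          simp [hi0, this]
        · simp
      have hlt : q.natDegree < n := by
        refine lt_of_le_of_ne hdeg fun he => hne ?_
        rw [← Polynomial.leadingCoeff_eq_zero, Polynomial.leadingCoeff, he]
        exact (hqc (Fin.last n)).trans hLn
      have : s.card ≤ s'.card + 1 := by
        have hsub : s.erase i ⊆ s' := by
          intro j hj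
          rw [Finset.mem_erase] at hj
          rw [hs', Finset.mem_filter]
          refine ⟨hj.2, fun hj0 => hs i hi j hj.2 hj.1.symm ?_⟩
          simp [bracket, hi0, hj0]
        have := Finset.card_le_card hsub
        rw [Finset.card_erase_of_mem hi] at this
        omega
      omega
    · push Not at hex
      have : s' = s := by rw [hs', Finset.filter_eq_self]; exact hex
      rw [this] at hle
      omega
  ext i
  rw [← hqc i, hq0]; simp

end RationalNormal

end

/-! ### Pencils of forms and Plücker coordinates -/

noncomputable section

namespace RationalNormal

variable {k : Type*} [Field k] {n : ℕ}

/-- The linear forms that vanish on a subspace. -/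
def pencil (W : Submodule k (Fin (n + 1) → k)) : Submodule k (Fin (n + 1) → k) :=
  W.dualAnnihilator.comap (dotProductEquiv k (Fin (n + 1))).toLinearMap

theorem mem_pencil {W : Submodule k (Fin (n + 1) → k)} {L : Fin (n + 1) → k} :
    L ∈ pencil W ↔ ∀ w ∈ W, L ⬝ᵥ w = 0 := by
  simp [pencil, Submodule.mem_dualAnnihilator]

theorem pencil_zeroSpace (L M : Fin (n + 1) → k) :
    pencil (zeroSpace L M) = Submodule.span k {L, M} := by
  apply le_antisymm
  · intro N hN
    rw [mem_pencil] at hN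
    have h := mem_span_of_iInf_ker_le_ker (𝕜 := k)
      (L := fun i : Fin 2 => dotProductEquiv k (Fin (n + 1)) (![L, M] i))
      (K := dotProductEquiv k (Fin (n + 1)) N) (by
        intro x hx
        rw [Submodule.mem_iInf] at hx
        exact hN x ⟨by simpa using hx 0, by simpa using hx 1⟩)
    have h2 : Set.range (fun i : Fin 2 => dotProductEquiv k (Fin (n + 1)) (![L, M] i)) =
        (dotProductEquiv k (Fin (n + 1))).toLinearMap '' {L, M} := by
      ext x
      simp [Set.image_pair, eq_comm]
    rw [h2, ← Submodule.map_span] at h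
    obtain ⟨y, hy, hyN⟩ := h
    rwa [← (dotProductEquiv k (Fin (n + 1))).injective hyN]
  · rw [Submodule.span_le]
    rintro N (rfl | rfl)
    · exact mem_pencil.2 fun w hw => hw.1
    · exact mem_pencil.2 fun w hw => hw.2

theorem finrank_add_finrank_pencil (W : Submodule k (Fin (n + 1) → k)) :
    Module.finrank k W + Module.finrank k (pencil W) = n + 1 := by
  have h1 := Subspace.finrank_add_finrank_dualAnnihilator_eq W
  have h2 : Module.finrank k (pencil W) = Module.finrank k W.dualAnnihilator := by
    refine LinearEquiv.finrank_eq
      ((dotProductEquiv k (Fin (n + 1))).submoduleMap _ |>.trans (LinearEquiv.ofEq _ _ ?_))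
    exact Submodule.map_comap_eq_of_surjective (dotProductEquiv k (Fin (n + 1))).surjective _
  rw [h2, h1]
  simp

theorem finrank_zeroSpace_add (L M : Fin (n + 1) → k) :
    Module.finrank k (zeroSpace L M) + Module.finrank k (Submodule.span k {L, M}) = n + 1 := by
  rw [← pencil_zeroSpace, finrank_add_finrank_pencil]

theorem finrank_span_pair_eq_two_iff {L M : Fin (n + 1) → k} :
    Module.finrank k (Submodule.span k {L, M}) = 2 ↔ LinearIndependent k ![L, M] := by
  rw [linearIndependent_iff_card_eq_finrank_span, Set.finrank, Matrix.range_cons,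
    Matrix.range_cons, Matrix.range_empty, Set.union_empty, Set.singleton_union]
  simp [eq_comm]

/-- The point of the Grassmannian given by two independent linear forms. -/
def Grass.mk (L M : Fin (n + 1) → k) (h : LinearIndependent k ![L, M]) : Grass k n :=
  ⟨zeroSpace L M, by
    have := finrank_zeroSpace_add L M
    rwa [finrank_span_pair_eq_two_iff.2 h] at this⟩

theorem linearIndependent_of_eq_zeroSpace {W : Grass k n} {L M : Fin (n + 1) → k}
    (h : W.1 = zeroSpace L M) : LinearIndependent k ![L, M] := by
  rw [← finrank_span_pair_eq_two_iff]
  have h1 := finrank_zeroSpace_add L M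
  have h2 := W.2
  rw [h] at h2
  omega

theorem finrank_pencil (W : Grass k n) : Module.finrank k (pencil W.1) = 2 := by
  have h1 := finrank_add_finrank_pencil W.1
  have h2 := W.2
  omega

theorem exists_linearIndependent_pair {V : Type*} [AddCommGroup V] [Module k V]
    {S : Submodule k V} (h : Module.finrank k S = 2) :
    ∃ x ∈ S, ∃ y ∈ S, LinearIndependent k ![x, y] := by
  have : Module.Finite k S := Module.finite_of_finrank_pos (by omega)
  obtain ⟨b⟩ : Nonempty (Module.Basis (Fin 2) k S) := ⟨Module.finBasisOfFinrankEq k S h⟩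
  refine ⟨b 0, (b 0).2, b 1, (b 1).2, ?_⟩
  have h5 : LinearIndependent k (S.subtype ∘ b) :=
    b.linearIndependent.map' S.subtype S.ker_subtype
  have h6 : (S.subtype ∘ b) = ![(b 0 : V), (b 1 : V)] := by
    ext i; fin_cases i <;> rfl
  rwa [h6] at h5

theorem Grass.exists_rep (W : Grass k n) : ∃ L M, W.1 = zeroSpace L M := by
  obtain ⟨L, hL, M, hM, hli⟩ := exists_linearIndependent_pair (finrank_pencil W)
  have hle : W.1 ≤ zeroSpace L M := fun w hw => ⟨mem_pencil.1 hL w hw, mem_pencil.1 hM w hw⟩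
  refine ⟨L, M, Submodule.eq_of_le_of_finrank_eq hle ?_⟩
  have h1 := finrank_zeroSpace_add L M
  rw [finrank_span_pair_eq_two_iff.2 hli] at h1
  have h2 := W.2
  omega

theorem zeroSpace_eq_of_span_eq {L M L' M' : Fin (n + 1) → k}
    (h : Submodule.span k {L, M} = Submodule.span k {L', M'}) :
    zeroSpace L M = zeroSpace L' M' := by
  have key : ∀ {L M L' M' : Fin (n + 1) → k},
      Submodule.span k {L, M} ≤ Submodule.span k {L', M'} → zeroSpace L' M' ≤ zeroSpace L M := by
    intro L M L' M' h x hx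
    have h1 : ∀ N ∈ Submodule.span k {L', M'}, N ⬝ᵥ x = 0 := fun N hN =>
      mem_pencil.1 (by rwa [pencil_zeroSpace]) x hx
    exact ⟨h1 _ (h (Submodule.subset_span (by simp))), h1 _ (h (Submodule.subset_span (by simp)))⟩
  exact le_antisymm (key h.ge) (key h.le)

theorem Grass.ext_pencil {W W' : Grass k n} (h : pencil W.1 = pencil W'.1) : W = W' := by
  obtain ⟨L, M, hW⟩ := W.exists_rep
  obtain ⟨L', M', hW'⟩ := W'.exists_rep
  apply Subtype.ext
  rw [hW, hW'] at h ⊢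
  rw [pencil_zeroSpace, pencil_zeroSpace] at h
  exact zeroSpace_eq_of_span_eq h

theorem Grass.eq_of_pencil_le {W W' : Grass k n} (h : pencil W.1 ≤ pencil W'.1) : W = W' :=
  Grass.ext_pencil (Submodule.eq_of_le_of_finrank_eq h (by simp [finrank_pencil]))

theorem plucker_eq_of_mem_span {L M L' M' : Fin (n + 1) → k}
    (hL : L' ∈ Submodule.span k {L, M}) (hM : M' ∈ Submodule.span k {L, M}) :
    ∃ c : k, plucker L' M' = c • plucker L M := by
  rw [Submodule.mem_span_pair] at hL hM
  obtain ⟨a, b, rfl⟩ := hL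
  obtain ⟨c, d, rfl⟩ := hM
  refine ⟨a * d - b * c, ?_⟩
  ext p
  simp [plucker]; ring

theorem plucker_ne_zero {L M : Fin (n + 1) → k} (h : LinearIndependent k ![L, M]) :
    plucker L M ≠ 0 := by
  intro h0
  rw [LinearIndependent.pair_iff] at h
  have h1 : ∀ i, L i = 0 := by
    intro i
    have := h (M i) (-L i) (by
      ext j
      have := congrFun h0 (i, j)
      simp only [plucker, Pi.zero_apply] at this
      simp only [Pi.add_apply, Pi.smul_apply, smul_eq_mul, Pi.zero_apply]
      linear_combination -this)
    simpa using this.2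
  have := h 1 0 (by ext j; simp [h1])
  simp at this

theorem eval_smul_of_isHomogeneous {σ : Type*} {F : MvPolynomial σ k} {e : ℕ}
    (hF : F.IsHomogeneous e) (c : k) (x : σ → k) :
    MvPolynomial.eval (c • x) F = c ^ e * MvPolynomial.eval x F := by
  rw [MvPolynomial.eval_eq, MvPolynomial.eval_eq, Finset.mul_sum]
  refine Finset.sum_congr rfl fun d hd => ?_
  have h1 : ∑ i ∈ d.support, d i = e := by
    rw [← hF.degree_eq_sum_deg_support hd]
  simp only [Pi.smul_apply, smul_eq_mul, mul_pow, Finset.prod_mul_distrib,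
    Finset.prod_pow_eq_pow_sum, h1]
  ring

theorem eval_plucker_eq_zero {W : Grass k n} {L M L' M' : Fin (n + 1) → k}
    (h : W.1 = zeroSpace L M) (h' : W.1 = zeroSpace L' M')
    {F : MvPolynomial (Fin (n + 1) × Fin (n + 1)) k} {e : ℕ} (hF : F.IsHomogeneous e)
    (h0 : MvPolynomial.eval (plucker L M) F = 0) : MvPolynomial.eval (plucker L' M') F = 0 := by
  have hs : Submodule.span k {L, M} = Submodule.span k {L', M'} := by
    rw [← pencil_zeroSpace, ← pencil_zeroSpace, ← h, ← h']
  obtain ⟨c, hc⟩ := plucker_eq_of_mem_span (L := L) (M := M) (L' := L') (M' := M')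
    (hs ▸ Submodule.subset_span (by simp)) (hs ▸ Submodule.subset_span (by simp))
  rw [hc, eval_smul_of_isHomogeneous hF, h0, mul_zero]

theorem Grass.isClosed_setOf_eval_eq_zero {F : MvPolynomial (Fin (n + 1) × Fin (n + 1)) k} {e : ℕ}
    (hF : F.IsHomogeneous e) : IsClosed {W : Grass k n | ∀ L M, W.1 = zeroSpace L M →
      MvPolynomial.eval (plucker L M) F = 0} := by
  rw [← isOpen_compl_iff]
  refine TopologicalSpace.isOpen_generateFrom_of_mem ⟨F, e, hF, ?_⟩
  ext W
  simp

/-- Each row of the antisymmetric Plücker matrix is a combination of `L` and `M`, and two rows with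
a nonzero common entry give both back. Conditions that are linear in the forms of the pencil thereby
become linear in the Plücker coordinates, as elimination requires. -/
theorem span_plucker {L M : Fin (n + 1) → k} (h : LinearIndependent k ![L, M]) :
    Submodule.span k (Set.range fun i => fun j => plucker L M (i, j)) =
      Submodule.span k {L, M} := by
  have hrow : ∀ i, (fun j => plucker L M (i, j)) = L i • M - M i • L := by
    intro i; ext j; simp [plucker]; ring
  apply le_antisymm
  · rw [Submodule.span_le]
    rintro _ ⟨i, rfl⟩
    change (fun j => plucker L M (i, j)) ∈ _
    rw [hrow i]
    exact Submodule.sub_mem _ (Submodule.smul_mem _ _ (Submodule.subset_span (by simp)))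
      (Submodule.smul_mem _ _ (Submodule.subset_span (by simp)))
  · obtain ⟨⟨i, j⟩, hij⟩ := Function.ne_iff.1 (plucker_ne_zero h)
    set S := Submodule.span k (Set.range fun i => fun j => plucker L M (i, j))
    have hi : L i • M - M i • L ∈ S := by
      rw [← hrow i]; exact Submodule.subset_span ⟨i, rfl⟩
    have hj : L j • M - M j • L ∈ S := by
      rw [← hrow j]; exact Submodule.subset_span ⟨j, rfl⟩
    simp only [plucker, Pi.zero_apply] at hij
    have h1 : (L i * M j - L j * M i) • M ∈ S := by
      have := S.sub_mem (S.smul_mem (M j) hi) (S.smul_mem (M i) hj)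
      convert this using 1
      ext l; simp; ring
    have h2 : (L i * M j - L j * M i) • L ∈ S := by
      have := S.sub_mem (S.smul_mem (L j) hi) (S.smul_mem (L i) hj)
      convert this using 1
      ext l; simp; ring
    rw [Submodule.span_le]
    rintro N (rfl | rfl)
    · exact (S.smul_mem_iff hij).1 h2
    · exact (S.smul_mem_iff hij).1 h1

/-- The base point free subspaces: those that do not meet the rational normal curve. -/
def baseFree (k : Type*) [Field k] (n : ℕ) : Set (Grass k n) :=
  {W | ∀ u : Fin 2 → k, u ≠ 0 → ∃ f ∈ pencil W.1, evalForm n f u ≠ 0}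

theorem mem_iff_pencil (W : Grass k n) (x : Fin (n + 1) → k) :
    x ∈ W.1 ↔ ∀ f ∈ pencil W.1, f ⬝ᵥ x = 0 := by
  refine ⟨fun hx f hf => mem_pencil.1 hf x hx, fun h => ?_⟩
  obtain ⟨L, M, hW⟩ := W.exists_rep
  rw [hW, pencil_zeroSpace] at h
  rw [hW]
  exact ⟨h L (Submodule.subset_span (by simp)), h M (Submodule.subset_span (by simp))⟩

theorem mem_baseFree_iff (W : Grass k n) :
    W ∈ baseFree k n ↔ ∀ x y : k, (x, y) ≠ 0 → veronese n x y ∉ W.1 := by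
  constructor
  · intro h x y hxy hmem
    obtain ⟨f, hf, hne⟩ := h ![x, y] (by
      intro h0
      exact hxy (Prod.ext (congrFun h0 0) (congrFun h0 1)))
    exact hne (mem_pencil.1 hf _ hmem)
  · intro h u hu
    by_contra! hcon
    refine h (u 0) (u 1) (fun h0 => hu ?_) ((mem_iff_pencil W _).2 fun f hf => hcon f hf)
    ext i; fin_cases i
    · exact congrArg Prod.fst h0
    · exact congrArg Prod.snd h0

end RationalNormal

end

/-! ### Elimination theory -/

noncomputable section

namespace RationalNormal

open MvPolynomial

variable {k : Type*} [Field k] {n : ℕ}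

/-- Projective Nullstellensatz: an ideal without nontrivial zeros contains all monomials of large
degree. -/
theorem exists_degree_monomial_mem [IsAlgClosed k] {ι : Type*} [Fintype ι]
    (I : Ideal (MvPolynomial ι k)) (h : ∀ v : ι → k, (∀ F ∈ I, eval v F = 0) → v = 0) :
    ∃ D : ℕ, ∀ α : ι →₀ ℕ, D ≤ α.degree → monomial α (1 : k) ∈ I := by
  have hX : ∀ i, ∃ N : ℕ, (X i : MvPolynomial ι k) ^ N ∈ I := by
    intro i
    have : (X i : MvPolynomial ι k) ∈ I.radical := by
      rw [← vanishingIdeal_zeroLocus_eq_radical (K := k), mem_vanishingIdeal_iff]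
      intro v hv
      have := h v fun F hF => by
        have := (mem_zeroLocus_iff.1 hv) F hF
        rwa [aeval_eq_eval] at this
      simp [this]
    exact this
  choose N hN using hX
  -- Pigeonhole: a monomial of this degree has some exponent at least `N i`, and is therefore a
  -- multiple of `X i ^ N i`.
  refine ⟨∑ i, N i + 1, fun α hα => ?_⟩
  have : ∃ i, N i ≤ α i := by
    by_contra! hcon
    have h1 : α.degree = ∑ i, α i := Finsupp.degree_eq_sum α
    have h2 : ∑ i, α i ≤ ∑ i, N i := Finset.sum_le_sum fun i _ => (hcon i).le
    omega
  obtain ⟨i, hi⟩ := this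
  have h1 : monomial α (1 : k) = X i ^ N i * monomial (α - Finsupp.single i (N i)) 1 := by
    rw [X_pow_eq_monomial, monomial_mul, one_mul, add_tsub_cancel_of_le]
    exact Finsupp.single_le_iff.2 hi
  rw [h1]
  exact I.mul_mem_right _ (hN i)

/-- The degree `D` part of a homogeneous ideal is spanned by the monomial multiples of its
generators that have degree `D`. When the ideal contains all monomials of that degree, the
coefficient vectors of these multiples span everything; they are the rows of a Macaulay matrix. -/
theorem span_coeff_eq_top {ι S : Type*} [Fintype ι] (G : S → MvPolynomial ι k) (d : S → ℕ)
    (hG : ∀ s, (G s).IsHomogeneous (d s)) {D : ℕ}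
    (hD : ∀ α : ι →₀ ℕ, α.degree = D → monomial α (1 : k) ∈ Ideal.span (Set.range G))
    (A : Finset (ι →₀ ℕ)) (hA : ∀ α ∈ A, α.degree = D) :
    Submodule.span k (Set.range fun p : {p : (ι →₀ ℕ) × S // p.1.degree + d p.2 = D} =>
      fun α : A => coeff α.1 (monomial p.1.1 1 * G p.1.2)) = ⊤ := by
  classical
  set T := Submodule.span k (Set.range fun p : {p : (ι →₀ ℕ) × S // p.1.degree + d p.2 = D} =>
      fun α : A => coeff α.1 (monomial p.1.1 1 * G p.1.2)) with hT
  have h1 : ∀ (q : MvPolynomial ι k) (s : S), (fun α : A => coeff α.1 (q * G s)) ∈ T := by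
    intro q s
    induction q using MvPolynomial.induction_on' with
    | monomial β c =>
      by_cases hβ : β.degree + d s = D
      · have : (fun α : A => coeff α.1 (monomial β c * G s)) =
            c • fun α : A => coeff α.1 (monomial β 1 * G s) := by
          ext α
          rw [Pi.smul_apply, ← coeff_smul, ← smul_mul_assoc, smul_monomial, smul_eq_mul, mul_one]
        rw [this]
        exact T.smul_mem _ (Submodule.subset_span ⟨⟨(β, s), hβ⟩, rfl⟩)
      · have : (fun α : A => coeff α.1 (monomial β c * G s)) = 0 := by
          ext α
          refine ((isHomogeneous_monomial c rfl).mul (hG s)).coeff_eq_zero ?_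
          rw [hA α.1 α.2]; exact fun h => hβ h.symm
        rw [this]; exact T.zero_mem
    | add p q hp hq =>
      have : (fun α : A => coeff α.1 ((p + q) * G s)) =
          (fun α : A => coeff α.1 (p * G s)) + fun α : A => coeff α.1 (q * G s) := by
        ext α; simp [add_mul]
      rw [this]; exact T.add_mem hp hq
  have h2 : ∀ F ∈ Ideal.span (Set.range G), ∀ q : MvPolynomial ι k,
      (fun α : A => coeff α.1 (q * F)) ∈ T := by
    intro F hF
    induction hF using Submodule.span_induction with
    | mem x hx => obtain ⟨s, rfl⟩ := hx; exact fun q => h1 q s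
    | zero => intro q; convert T.zero_mem using 1; ext α; simp
    | add x y _ _ hx hy =>
      intro q
      convert T.add_mem (hx q) (hy q) using 1; ext α; simp [mul_add]
    | smul a x _ hx =>
      intro q
      convert hx (q * a) using 3; rw [smul_eq_mul, mul_assoc]
  rw [eq_top_iff, ← (Pi.basisFun k A).span_eq, Submodule.span_le]
  rintro _ ⟨α, rfl⟩
  have := h2 _ (hD α.1 (hA α.1 α.2)) 1
  have h3 : Pi.basisFun k A α = fun β : A => coeff β.1 (1 * monomial α.1 (1 : k)) := by
    ext β
    rw [one_mul, coeff_monomial, Pi.basisFun_apply, Pi.single_apply]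
    simp only [Subtype.ext_iff, eq_comm]
  rw [h3]
  exact this

/-- Elimination theory: the locus of parameters for which a system of homogeneous equations has
no nontrivial solution is a union of loci where a homogeneous polynomial does not vanish. -/
theorem exists_eliminant [IsAlgClosed k] {ι τ S : Type*} [Fintype ι]
    (G : S → MvPolynomial ι (MvPolynomial τ k)) (d e : S → ℕ)
    (hG : ∀ s, (G s).IsHomogeneous (d s)) (hc : ∀ s α, ((G s).coeff α).IsHomogeneous (e s))
    (y : τ → k) (hy : ∀ v : ι → k, v ≠ 0 → ∃ s, eval v (map (eval y) (G s)) ≠ 0) :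
    ∃ (F : MvPolynomial τ k) (e' : ℕ), F.IsHomogeneous e' ∧ eval y F ≠ 0 ∧
      ∀ y' : τ → k, (∃ v : ι → k, v ≠ 0 ∧ ∀ s, eval v (map (eval y') (G s)) = 0) →
        eval y' F = 0 := by
  classical
  have hGy : ∀ y s, (map (eval y) (G s)).IsHomogeneous (d s) := fun y s => (hG s).map _
  obtain ⟨D, hD⟩ := exists_degree_monomial_mem
    (Ideal.span (Set.range fun s => map (eval y) (G s))) (by
      intro v hv
      by_contra hne
      obtain ⟨s, hs⟩ := hy v hne
      exact hs (hv _ (Ideal.subset_span ⟨s, rfl⟩)))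
  set A : Finset (ι →₀ ℕ) := Finset.univ.finsuppAntidiag D with hAdef
  have hA : ∀ α, α ∈ A ↔ α.degree = D := by
    intro α
    rw [hAdef, Finset.mem_finsuppAntidiag, Finsupp.degree_eq_sum]
    simp
  have hspan := span_coeff_eq_top (fun s => map (eval y) (G s)) d (hGy y)
    (fun α hα => hD α hα.ge) A fun α hα => (hA α).1 hα
  -- At the parameter `y` the rows of the Macaulay matrix span, so some of them form a basis. The
  -- same rows taken with polynomial coefficients form a square matrix whose determinant is the
  -- required eliminant: it is nonzero at `y` by construction.
  obtain ⟨κ, a, _, hκ, hli⟩ := exists_linearIndependent' k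
    (fun p : {p : (ι →₀ ℕ) × S // p.1.degree + d p.2 = D} =>
      fun α : A => coeff α.1 (monomial p.1.1 1 * map (eval y) (G p.1.2)))
  rw [hspan] at hκ
  let b : Module.Basis κ k (A → k) := Module.Basis.mk hli hκ.ge
  let c : A ≃ κ := (Pi.basisFun k A).indexEquiv b
  let Mat : Matrix A A (MvPolynomial τ k) := Matrix.of fun i α =>
    coeff α.1 (monomial (a (c i)).1.1 1 * G (a (c i)).1.2)
  have hMat : ∀ y', (eval y').mapMatrix Mat = Matrix.of fun i α =>
      coeff α.1 (monomial (a (c i)).1.1 1 * map (eval y') (G (a (c i)).1.2)) := by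
    intro y'
    ext i α
    have : monomial (a (c i)).1.1 (1 : k) = map (eval y') (monomial (a (c i)).1.1 1) := by simp
    change eval y' (coeff α.1 _) = coeff α.1 _
    rw [this, ← map_mul, coeff_map]
  refine ⟨Mat.det, ∑ i : A, e (a (c i)).1.2, ?_, ?_, ?_⟩
  · rw [Matrix.det_apply]
    refine IsHomogeneous.sum _ _ _ fun σ _ => ?_
    have h1 : (∏ i, Mat (σ i) i).IsHomogeneous (∑ i : A, e (a (c (σ i))).1.2) := by
      refine IsHomogeneous.prod _ _ _ fun i _ => ?_
      simp only [Mat, Matrix.of_apply]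
      rw [coeff_monomial_mul']
      split_ifs
      · rw [one_mul]; exact hc _ _
      · exact isHomogeneous_zero _ _ _
    rw [Equiv.sum_comp σ fun i => e (a (c i)).1.2] at h1
    rcases Int.units_eq_one_or (Equiv.Perm.sign σ) with h | h <;> rw [h]
    · rwa [one_smul]
    · rw [Units.neg_smul, one_smul]; exact h1.neg
  · rw [RingHom.map_det, hMat, ← isUnit_iff_ne_zero, ← Matrix.isUnit_iff_isUnit_det,
      ← Matrix.linearIndependent_rows_iff_isUnit]
    exact hli.comp c c.injective
  · rintro y' ⟨v, hv, hvs⟩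
    rw [RingHom.map_det, hMat, ← Matrix.exists_mulVec_eq_zero_iff]
    -- A nontrivial solution `v` produces a kernel vector, the monomials of degree `D` evaluated at
    -- `v`. It is nonzero because it contains the `D`-th power of a nonzero coordinate.
    refine ⟨fun α => ∏ i, v i ^ α.1 i, ?_, ?_⟩
    · obtain ⟨i, hi⟩ := Function.ne_iff.1 hv
      refine Function.ne_iff.2 ⟨⟨Finsupp.single i D, (hA _).2 (by simp)⟩, ?_⟩
      simp only [Pi.zero_apply]
      refine Finset.prod_ne_zero_iff.2 fun j _ => ?_
      by_cases hj : j = i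
      · subst hj; exact pow_ne_zero _ hi
      · simp [Ne.symm hj]
    · ext i
      set Q := monomial (a (c i)).1.1 1 * map (eval y') (G (a (c i)).1.2) with hQ
      have hQh : Q.IsHomogeneous D := by
        have := (isHomogeneous_monomial (σ := ι) (1 : k) (d := (a (c i)).1.1) rfl).mul
          (hGy y' (a (c i)).1.2)
        rwa [(a (c i)).2] at this
      have h1 : eval v Q = 0 := by rw [hQ, map_mul, hvs, mul_zero]
      rw [Pi.zero_apply, ← h1, eval_eq']
      change ∑ α : A, coeff α.1 Q * ∏ i, v i ^ α.1 i = _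
      rw [Finset.sum_coe_sort A fun α => coeff α Q * ∏ i, v i ^ α i]
      symm
      refine Finset.sum_subset (fun α hα => (hA α).2 ?_) fun α _ hα => ?_
      · by_contra hne
        exact (mem_support_iff.1 hα) (hQh.coeff_eq_zero hne)
      · rw [notMem_support_iff.1 hα, zero_mul]

/-- The locus of subspaces for which a system of equations, linear in the forms that vanish on the
subspace and homogeneous in auxiliary variables, has a nontrivial solution, is closed. -/
theorem Grass.isClosed_exists [IsAlgClosed k] {ι S S₀ : Type*} [Fintype ι]
    (g : S → Fin (n + 1) → MvPolynomial ι k) (d : S → ℕ)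
    (hg : ∀ s j, (g s j).IsHomogeneous (d s))
    (g₀ : S₀ → MvPolynomial ι k) (d₀ : S₀ → ℕ) (hg₀ : ∀ s, (g₀ s).IsHomogeneous (d₀ s)) :
    IsClosed {W : Grass k n | ∃ v : ι → k, v ≠ 0 ∧ (∀ s, eval v (g₀ s) = 0) ∧
      ∀ s, ∀ f ∈ pencil W.1, ∑ j, f j * eval v (g s j) = 0} := by
  -- The pencil is spanned by the rows of the Plücker matrix, so each equation in `f` is imposed on
  -- every row `i`. Its coefficients are then homogeneous of degree one in the Plücker coordinates;
  -- the equations `g₀` have constant coefficients.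
  let G : (S × Fin (n + 1)) ⊕ S₀ → MvPolynomial ι (MvPolynomial (Fin (n + 1) × Fin (n + 1)) k) :=
    Sum.elim (fun p => ∑ j, C (X (p.2, j)) * map C (g p.1 j)) fun s => map C (g₀ s)
  have hcomp : ∀ (y : Fin (n + 1) × Fin (n + 1) → k) (p : MvPolynomial ι k),
      map (eval y) (map C p) = p := by
    intro y p
    rw [MvPolynomial.map_map, show (eval y).comp (C : k →+* MvPolynomial (Fin (n + 1) × Fin (n + 1)) k) =
      RingHom.id k from by ext x; simp, MvPolynomial.map_id]
  have hG : ∀ s, (G s).IsHomogeneous (Sum.elim (fun p => d p.1) d₀ s) := by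
    rintro (⟨s, i⟩ | s)
    · refine IsHomogeneous.sum _ _ _ fun j _ => ?_
      exact ((hg s j).map C).C_mul _
    · exact (hg₀ s).map C
  have hc : ∀ s α, ((G s).coeff α).IsHomogeneous (Sum.elim (fun _ => 1) (fun _ => 0) s) := by
    rintro (⟨s, i⟩ | s) α
    · simp only [G, Sum.elim_inl, coeff_sum, coeff_C_mul, coeff_map]
      refine IsHomogeneous.sum _ _ _ fun j _ => ?_
      have := (isHomogeneous_X k (i, j)).mul (isHomogeneous_C _ (coeff α (g s j)))
      simpa using this
    · simp only [G, Sum.elim_inr, coeff_map]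
      exact isHomogeneous_C _ _
  have hmem : ∀ (W : Grass k n) (L M : Fin (n + 1) → k), W.1 = zeroSpace L M → ∀ v : ι → k,
      ((∀ s, eval v (g₀ s) = 0) ∧ ∀ s, ∀ f ∈ pencil W.1, ∑ j, f j * eval v (g s j) = 0) ↔
      ∀ s, eval v (map (eval (plucker L M)) (G s)) = 0 := by
    intro W L M hW v
    rw [hW, pencil_zeroSpace, ← span_plucker (linearIndependent_of_eq_zeroSpace hW)]
    constructor
    · rintro ⟨h0, h1⟩ (⟨s, i⟩ | s)
      · have := h1 s _ (Submodule.subset_span ⟨i, rfl⟩)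
        simpa [G, hcomp] using this
      · simpa [G, hcomp] using h0 s
    · intro h
      refine ⟨fun s => by simpa [G, hcomp] using h (Sum.inr s), fun s f hf => ?_⟩
      induction hf using Submodule.span_induction with
      | mem x hx =>
        obtain ⟨i, rfl⟩ := hx
        simpa [G, hcomp] using h (Sum.inl (s, i))
      | zero => simp
      | add x y _ _ hx hy => simp [add_mul, Finset.sum_add_distrib, hx, hy]
      | smul c x _ hx => simp [mul_assoc, ← Finset.mul_sum, hx]
  rw [← isOpen_compl_iff, isOpen_iff_forall_mem_open]
  intro W hW
  obtain ⟨L, M, hLM⟩ := W.exists_rep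
  obtain ⟨F, e, hF, hne, hzero⟩ := exists_eliminant G _ _ hG hc (plucker L M) (by
    intro v hv
    by_contra! hcon
    exact hW ⟨v, hv, (hmem W L M hLM v).2 hcon⟩)
  refine ⟨_, ?_, (Grass.isClosed_setOf_eval_eq_zero hF).isOpen_compl, fun h => hne (h L M hLM)⟩
  intro W' hW' hmem'
  refine hW' fun L' M' h' => hzero _ ?_
  obtain ⟨v, hv, h⟩ := hmem'
  exact ⟨v, hv, (hmem W' L' M' h' v).1 h⟩

/-- A base point is a nontrivial common zero of the forms of the pencil, so the complement is closed
by elimination of two variables. -/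
theorem isOpen_baseFree [IsAlgClosed k] (n : ℕ) : IsOpen (baseFree k n) := by
  have h := Grass.isClosed_exists (k := k) (n := n) (ι := Fin 2) (S := Unit) (S₀ := Empty)
    (fun _ j => X 0 ^ (n - (j : ℕ)) * X 1 ^ (j : ℕ)) (fun _ => n) (by
      intro _ j
      have := (isHomogeneous_X_pow (R := k) (0 : Fin 2) (n - (j : ℕ))).mul
        (isHomogeneous_X_pow (R := k) (1 : Fin 2) (j : ℕ))
      rwa [Nat.sub_add_cancel (by omega)] at this) (fun _ => 0) (fun _ => 0) (by rintro ⟨⟩)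
  rw [← isClosed_compl_iff]
  convert h using 1
  ext W
  simp [baseFree, evalForm_apply]

end RationalNormal

end

/-! ### Dimension and closed maps of noetherian spaces -/

noncomputable section

namespace RationalNormal

open TopologicalSpace

section Topology

variable {X Y : Type*} [TopologicalSpace X] [TopologicalSpace Y]

theorem isIrreducible_subset_iUnion {ι : Type*} [Finite ι] {Z : Set X} (hZ : IsIrreducible Z)
    {A : ι → Set X} (hA : ∀ i, IsClosed (A i)) (h : Z ⊆ ⋃ i, A i) : ∃ i, Z ⊆ A i := by
  classical
  cases nonempty_fintype ι
  obtain ⟨z, hz, hZz⟩ := isIrreducible_iff_sUnion_isClosed.1 hZ (Finset.univ.image A)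
    (by simpa using hA) (by simpa [Set.sUnion_range] using h)
  obtain ⟨i, -, rfl⟩ := Finset.mem_image.1 hz
  exact ⟨i, hZz⟩

/-- In a noetherian space no homeomorphism moves a closed set into a proper subset. -/
theorem image_not_ssubset [NoetherianSpace X] (h : X ≃ₜ X) {Z : Set X} (hZ : IsClosed Z) :
    ¬ Z ⊂ h '' Z := by
  have hwf : WellFoundedLT (Closeds X) := ((noetherianSpace_TFAE X).out 0 1 :).1 inferInstance
  suffices H : ∀ C : Closeds X, ¬ (C : Set X) ⊂ h '' C from H ⟨Z, hZ⟩
  intro C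
  induction C using hwf.induction with
  | ind C ih =>
    intro hC
    -- Descent: pulling a counterexample back along `h` gives a strictly smaller closed
    -- counterexample.
    let C' : Closeds X := ⟨h.symm '' C, h.symm.isClosed_image.2 C.isClosed⟩
    have himg : h '' (C' : Set X) = C := by
      change h '' (h.symm '' _) = _
      rw [Set.image_image]; simp
    have h1 : (C' : Set X) ⊂ C := by
      rw [← h.injective.injOn.image_ssubset_image_iff (Set.subset_univ _) (Set.subset_univ _),
        himg]
      exact hC
    exact ih C' h1 (by rw [himg]; exact h1)

/-- A closed map with fibres covered by finitely many homeomorphisms does not lower the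
dimension. -/
theorem topologicalKrullDim_le_of_fibers [NoetherianSpace X] {f : X → Y} (hf : Continuous f)
    (hcl : IsClosedMap f) {ι : Type*} [Finite ι] (h : ι → X ≃ₜ X)
    (hfib : ∀ x x', f x = f x' → ∃ i, Inseparable x' (h i x)) :
    topologicalKrullDim X ≤ topologicalKrullDim Y := by
  let φ : IrreducibleCloseds X → IrreducibleCloseds Y := fun Z =>
    ⟨f '' Z, Z.isIrreducible.image f hf.continuousOn, hcl _ Z.isClosed⟩
  refine Order.krullDim_le_of_strictMono φ fun Z Z' hlt => ?_
  have hss : (Z : Set X) ⊂ Z' := hlt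
  have hle : f '' Z ⊆ f '' Z' := Set.image_mono hss.subset
  refine lt_of_le_of_ne hle fun heq => ?_
  have heq' : f '' (Z : Set X) = f '' Z' := congrArg (fun W : IrreducibleCloseds Y => (W : Set Y)) heq
  -- If `Z` and `Z'` had the same image, the translates of `Z` would cover `Z'`. By irreducibility a
  -- single translate would contain `Z'`, hence contain `Z` properly, which is impossible in a
  -- noetherian space.
  have hcover : (Z' : Set X) ⊆ ⋃ i, h i '' Z := by
    intro x' hx'
    obtain ⟨x, hx, hxx'⟩ : f x' ∈ f '' (Z : Set X) := heq' ▸ ⟨x', hx', rfl⟩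
    obtain ⟨i, hi⟩ := hfib x x' hxx'
    refine Set.mem_iUnion.2 ⟨i, ?_⟩
    exact (hi.mem_closed_iff ((h i).isClosed_image.2 Z.isClosed)).2 ⟨x, hx, rfl⟩
  obtain ⟨i, hi⟩ := isIrreducible_subset_iUnion Z'.isIrreducible
    (fun i => (h i).isClosed_image.2 Z.isClosed) hcover
  exact image_not_ssubset (h i) Z.isClosed (hss.trans_subset hi)

/-- Take a minimal closed subset of `C` whose image contains `Z`. Intersecting it with the preimage
of `Z` shows that its image is exactly `Z`. A decomposition into two closed pieces would decompose
`Z`, so minimality makes it irreducible. -/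
theorem exists_irreducible_image_eq [NoetherianSpace X] {f : X → Y} (hf : Continuous f)
    (hcl : IsClosedMap f) {C : Set X} (hC : IsClosed C) {Z : Set Y} (hZ : IsIrreducible Z)
    (hZc : IsClosed Z) (hsub : Z ⊆ f '' C) :
    ∃ T : IrreducibleCloseds X, (T : Set X) ⊆ C ∧ f '' T = Z := by
  have hwf : WellFoundedLT (Closeds X) := ((noetherianSpace_TFAE X).out 0 1 :).1 inferInstance
  obtain ⟨T, ⟨hTC, hTZ⟩, hmin⟩ := hwf.wf.has_min
    {T : Closeds X | (T : Set X) ⊆ C ∧ Z ⊆ f '' T} ⟨⟨C, hC⟩, subset_rfl, hsub⟩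
  have hmin' : ∀ T' : Set X, IsClosed T' → T' ⊆ T → Z ⊆ f '' T' → (T : Set X) ⊆ T' := by
    intro T' hT' hle h
    by_contra hne
    exact hmin ⟨T', hT'⟩ ⟨hle.trans hTC, h⟩ ⟨hle, hne⟩
  have himg : f '' T = Z := by
    refine subset_antisymm ?_ hTZ
    have := hmin' (T ∩ f ⁻¹' Z) (T.isClosed.inter (hZc.preimage hf)) Set.inter_subset_left (by
      intro z hz
      obtain ⟨x, hx, rfl⟩ := hTZ hz
      exact ⟨x, ⟨hx, hz⟩, rfl⟩)
    rintro _ ⟨x, hx, rfl⟩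
    exact (this hx).2
  have hirr : IsIrreducible (T : Set X) := by
    constructor
    · obtain ⟨z, hz⟩ := hZ.nonempty
      obtain ⟨x, hx, -⟩ := hTZ hz
      exact ⟨x, hx⟩
    · rw [isPreirreducible_iff_isClosed_union_isClosed]
      intro A B hA hB hAB
      have h1 := isPreirreducible_iff_isClosed_union_isClosed.1 hZ.isPreirreducible
        (f '' (T ∩ A)) (f '' (T ∩ B)) (hcl _ (T.isClosed.inter hA)) (hcl _ (T.isClosed.inter hB))
        (by
          intro z hz
          obtain ⟨x, hx, rfl⟩ := hTZ hz
          rcases hAB hx with h | h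
          · exact Or.inl ⟨x, ⟨hx, h⟩, rfl⟩
          · exact Or.inr ⟨x, ⟨hx, h⟩, rfl⟩)
      rcases h1 with h1 | h1
      · exact Or.inl ((hmin' _ (T.isClosed.inter hA) Set.inter_subset_left h1).trans
          Set.inter_subset_right)
      · exact Or.inr ((hmin' _ (T.isClosed.inter hB) Set.inter_subset_left h1).trans
          Set.inter_subset_right)
  exact ⟨⟨T, hirr, T.isClosed⟩, hTC, himg⟩

/-- A space whose irreducible closed subsets are covered by closed maps from a noetherian space
has at most the dimension of that space. -/
theorem topologicalKrullDim_le_of_cover [NoetherianSpace X] {ι : Type*} (f : ι → X → Y)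
    (hf : ∀ i, Continuous (f i)) (hcl : ∀ i, IsClosedMap (f i))
    (hcov : ∀ Z : IrreducibleCloseds Y, ∃ i, (Z : Set Y) ⊆ Set.range (f i)) :
    topologicalKrullDim Y ≤ topologicalKrullDim X := by
  -- A chain is lifted from its largest member downwards, each new irreducible set being chosen
  -- inside the previous one; strictness survives because the images differ.
  have key : ∀ (i : ι) (r : ℕ) (p : LTSeries (IrreducibleCloseds Y)), p.length = r →
      ∀ C : Set X, IsClosed C → (p.last : Set Y) ⊆ f i '' C →
      ∃ q : LTSeries (IrreducibleCloseds X), q.length = r ∧ (q.last : Set X) ⊆ C ∧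
        f i '' (q.last : Set X) = p.last := by
    intro i r
    induction r with
    | zero =>
      intro p hp C hC hsub
      obtain ⟨T, hT, himg⟩ := exists_irreducible_image_eq (hf i) (hcl i) hC
        p.last.isIrreducible p.last.isClosed hsub
      exact ⟨RelSeries.singleton _ T, rfl, hT, himg⟩
    | succ r ih =>
      intro p hp C hC hsub
      obtain ⟨T, hT, himg⟩ := exists_irreducible_image_eq (hf i) (hcl i) hC
        p.last.isIrreducible p.last.isClosed hsub
      have hne : p.length ≠ 0 := by omega
      have hlt : p.eraseLast.last < p.last := p.eraseLast_last_rel_last hne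
      obtain ⟨q, hq, hqT, hqimg⟩ := ih p.eraseLast (by simp [hp]) T T.isClosed
        (by rw [himg]; exact hlt.le)
      have hqlt : q.last < T := by
        refine lt_of_le_of_ne hqT fun h => hlt.ne ?_
        apply IrreducibleCloseds.ext
        rw [← hqimg, h, himg]
      refine ⟨q.snoc T hqlt, by simp [hq], ?_, ?_⟩
      · simpa using hT
      · simpa using himg
  refine iSup_le fun p => ?_
  obtain ⟨i, hi⟩ := hcov p.last
  obtain ⟨q, hq, -, -⟩ := key i p.length p rfl Set.univ isClosed_univ (by simpa using hi)
  rw [← hq]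
  exact Order.LTSeries.length_le_krullDim q

/-- A finite union of images of closed maps into an open set, with fibres covered by finitely many
homeomorphisms, is locally closed and has the dimension of the source. -/
theorem isLocallyClosedOfDim_iUnion_range [NoetherianSpace X] {U : Set Y} (hU : IsOpen U)
    {ι κ : Type*} [Finite ι] [Nonempty ι] [Finite κ] (f : ι → X → Y) (hf : ∀ i, Continuous (f i))
    (hcl : ∀ i (Z : Set X), IsClosed Z → ∃ C, IsClosed C ∧ f i '' Z = C ∩ U)
    (i₀ : ι) (h : κ → X ≃ₜ X) (hfib : ∀ x x', f i₀ x = f i₀ x' → ∃ j, Inseparable x' (h j x))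
    {d : ℕ} (hd : topologicalKrullDim X = d) :
    IsLocallyClosedOfDim (⋃ i, Set.range (f i)) d := by
  set S := ⋃ i, Set.range (f i) with hS
  have hC : ∀ i, ∃ C, IsClosed C ∧ Set.range (f i) = C ∩ U := fun i => by
    simpa using hcl i Set.univ isClosed_univ
  choose C hCc hCU using hC
  have hSU : S = (⋃ i, C i) ∩ U := by
    rw [hS, Set.iUnion_inter]
    exact Set.iUnion_congr hCU
  refine ⟨?_, ?_⟩
  · rw [hSU]
    exact (isClosed_iUnion_of_finite hCc).isLocallyClosed.inter hU.isLocallyClosed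
  let g : ι → X → S := fun i x => ⟨f i x, Set.mem_iUnion.2 ⟨i, x, rfl⟩⟩
  have hg : ∀ i, Continuous (g i) := fun i => (hf i).subtype_mk _
  have hgcl : ∀ i, IsClosedMap (g i) := by
    intro i Z hZ
    obtain ⟨C', hC', himg⟩ := hcl i Z hZ
    refine isClosed_induced_iff.2 ⟨C', hC', ?_⟩
    ext ⟨y, hy⟩
    have h1 : y ∈ f i '' Z ↔ y ∈ C' ∩ U := by rw [himg]
    have h2 : y ∈ U := (hSU ▸ hy : y ∈ (⋃ i, C i) ∩ U).2
    simp only [Set.mem_preimage, Set.mem_image, g, Subtype.mk.injEq]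
    rw [← Set.mem_image, h1]
    exact ⟨fun h => ⟨h, h2⟩, fun h => h.1⟩
  -- For the upper bound, an irreducible closed set lies in one of the finitely many closed images.
  -- For the lower bound, the single map `f i₀` with controlled fibres is enough.
  refine le_antisymm ?_ ?_
  · rw [← hd]
    refine topologicalKrullDim_le_of_cover g hg hgcl fun Z => ?_
    refine isIrreducible_subset_iUnion Z.isIrreducible
      (fun i => by simpa using hgcl i Set.univ isClosed_univ) ?_
    rintro ⟨y, hy⟩ -
    obtain ⟨i, x, rfl⟩ := Set.mem_iUnion.1 hy
    exact Set.mem_iUnion.2 ⟨i, x, rfl⟩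
  · rw [← hd]
    exact topologicalKrullDim_le_of_fibers (hg i₀) (hgcl i₀) h fun x x' hxx' =>
      hfib x x' (congrArg Subtype.val hxx')

end Topology

end RationalNormal

end

/-! ### Cones with the topology of homogeneous polynomials -/

noncomputable section

namespace RationalNormal

open TopologicalSpace MvPolynomial

/-- The space `k^ι`, with the topology whose closed sets are the zero loci of homogeneous
polynomials. -/
structure Cone (k ι : Type*) where
  /-- The coordinates of a point. -/
  coord : ι → k

variable {k : Type*} [Field k] {ι : Type*}

instance : TopologicalSpace (Cone k ι) :=
  TopologicalSpace.generateFrom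
    {U | ∃ (F : MvPolynomial ι k) (e : ℕ), F.IsHomogeneous e ∧ U = {v | eval v.coord F ≠ 0}}

theorem Cone.isTopologicalBasis : IsTopologicalBasis
    {U : Set (Cone k ι) | ∃ (F : MvPolynomial ι k) (e : ℕ), F.IsHomogeneous e ∧
      U = {v | eval v.coord F ≠ 0}} where
  exists_subset_inter := by
    rintro _ ⟨F, e, hF, rfl⟩ _ ⟨G, e', hG, rfl⟩ v ⟨hv, hv'⟩
    refine ⟨_, ⟨F * G, e + e', hF.mul hG, rfl⟩, ?_, ?_⟩
    · exact (map_mul (eval v.coord) F G).trans_ne (mul_ne_zero hv hv')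
    · intro w hw
      have hw' : eval w.coord (F * G) ≠ 0 := hw
      rw [map_mul] at hw'
      exact ⟨left_ne_zero_of_mul hw', right_ne_zero_of_mul hw'⟩
  sUnion_eq := by
    refine Set.eq_univ_of_forall fun v => ⟨_, ⟨1, 0, isHomogeneous_one _ _, rfl⟩, ?_⟩
    exact (map_one (eval v.coord)).trans_ne one_ne_zero
  eq_generateFrom := rfl

theorem Cone.isOpen_ne_zero {F : MvPolynomial ι k} {e : ℕ} (hF : F.IsHomogeneous e) :
    IsOpen {v : Cone k ι | eval v.coord F ≠ 0} :=
  Cone.isTopologicalBasis.isOpen ⟨F, e, hF, rfl⟩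

theorem Cone.isClosed_eq_zero {F : MvPolynomial ι k} {e : ℕ} (hF : F.IsHomogeneous e) :
    IsClosed {v : Cone k ι | eval v.coord F = 0} := by
  rw [← isOpen_compl_iff]
  exact Cone.isOpen_ne_zero hF

variable {X : Set (Cone k ι)}

theorem Cone.exists_of_isOpen {U : Set X} (hU : IsOpen U) {v : X} (hv : v ∈ U) :
    ∃ (F : MvPolynomial ι k) (e : ℕ), F.IsHomogeneous e ∧ eval v.1.coord F ≠ 0 ∧
      ∀ w : X, eval w.1.coord F ≠ 0 → w ∈ U := by
  obtain ⟨V, hV, rfl⟩ := isOpen_induced_iff.1 hU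
  obtain ⟨_, ⟨F, e, hF, rfl⟩, hvF, hsub⟩ :=
    Cone.isTopologicalBasis.exists_subset_of_mem_open hv hV
  exact ⟨F, e, hF, hvF, fun w hw => hsub hw⟩

theorem Cone.mem_of_isClosed {Z : Set X} (hZ : IsClosed Z) {v : X}
    (h : ∀ (F : MvPolynomial ι k) (e : ℕ), F.IsHomogeneous e → (∀ z ∈ Z, eval z.1.coord F = 0) →
      eval v.1.coord F = 0) : v ∈ Z := by
  by_contra hv
  obtain ⟨F, e, hF, hvF, hsub⟩ := Cone.exists_of_isOpen hZ.isOpen_compl hv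
  refine hvF (h F e hF fun z hz => ?_)
  by_contra hne
  exact hsub z hne hz

/-- The ideal of polynomials vanishing on a subset of a cone. -/
def Cone.ideal (Z : Set X) : Ideal (MvPolynomial ι k) := vanishingIdeal k ((fun z : X => z.1.coord) '' Z)

theorem Cone.mem_ideal {Z : Set X} {F : MvPolynomial ι k} :
    F ∈ Cone.ideal Z ↔ ∀ z ∈ Z, eval z.1.coord F = 0 := by
  simp only [Cone.ideal, mem_vanishingIdeal_iff, Set.forall_mem_image]
  rfl

theorem Cone.ideal_strictAnti {Z Z' : Set X} (hZ : IsClosed Z) (h : Z ⊂ Z') :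
    Cone.ideal Z' < Cone.ideal Z := by
  refine lt_of_le_not_ge (fun F hF => mem_ideal.2 fun z hz => mem_ideal.1 hF z (h.subset hz)) ?_
  intro hle
  refine h.not_subset fun v hv => Cone.mem_of_isClosed hZ fun F e _ hFZ => ?_
  exact mem_ideal.1 (hle (mem_ideal.2 hFZ)) v hv

/-- Passing to vanishing ideals reverses strict inclusions of closed sets, and the polynomial ring
is noetherian. -/
instance [Finite ι] : NoetherianSpace X := by
  refine ((noetherianSpace_TFAE X).out 0 1 :).2 ⟨?_⟩
  have : WellFounded fun Z Z' : Closeds X => Cone.ideal (Z' : Set X) < Cone.ideal (Z : Set X) :=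
    InvImage.wf (fun Z : Closeds X => Cone.ideal (Z : Set X))
      (IsWellFounded.wf : WellFounded fun I J : Ideal (MvPolynomial ι k) => I > J)
  exact Subrelation.wf (fun {Z Z'} h => Cone.ideal_strictAnti Z.isClosed h) this

theorem Cone.smul_mem {Z : Set X} (hZ : IsClosed Z) {v : X} (hv : v ∈ Z) {c : k} {w : X}
    (h : ∀ i, w.1.coord i = c * v.1.coord i) : w ∈ Z := by
  refine Cone.mem_of_isClosed hZ fun F e hF hFZ => ?_
  have : w.1.coord = c • v.1.coord := funext h
  rw [this, eval_smul_of_isHomogeneous hF, hFZ v hv, mul_zero]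

/-- Homogeneous polynomials cannot distinguish proportional points, so the topology on the cone sees
only the projective variety below it. -/
theorem Cone.inseparable {v w : X} {c : k} (hc : c ≠ 0) (h : ∀ i, w.1.coord i = c * v.1.coord i) :
    Inseparable w v := by
  rw [inseparable_iff_mem_closure]
  constructor
  · exact Cone.smul_mem isClosed_closure (subset_closure (Set.mem_singleton v)) h
  · refine Cone.smul_mem isClosed_closure (subset_closure (Set.mem_singleton w)) (c := c⁻¹) ?_
    intro i; rw [h i]; field_simp

/-- Evaluating `F` along the line through a point of `Z` gives a one-variable polynomial that
vanishes at all nonzero scalars. Hence all its coefficients, the values of the homogeneous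
components, are zero. -/
theorem Cone.homogeneousComponent_mem [Infinite k]
    (hX : ∀ v ∈ X, ∀ c : k, c ≠ 0 → ⟨c • v.coord⟩ ∈ X)
    {Z : Set X} (hZ : IsClosed Z) {F : MvPolynomial ι k} (hF : F ∈ Cone.ideal Z) (e : ℕ) :
    homogeneousComponent e F ∈ Cone.ideal Z := by
  rw [mem_ideal] at hF ⊢
  intro z hz
  let q : Polynomial k := ∑ i ∈ Finset.range (F.totalDegree + 1),
    Polynomial.C (eval z.1.coord (homogeneousComponent i F)) * Polynomial.X ^ i
  have hq : ∀ c : k, c ≠ 0 → q.eval c = 0 := by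
    intro c hc
    have h1 := hF ⟨_, hX z.1 z.2 c hc⟩ (Cone.smul_mem hZ hz (c := c) fun i => rfl)
    change eval (c • z.1.coord) F = 0 at h1
    rw [← sum_homogeneousComponent F, map_sum] at h1
    rw [← h1, Polynomial.eval_finsetSum]
    refine Finset.sum_congr rfl fun i _ => ?_
    rw [eval_smul_of_isHomogeneous (homogeneousComponent_isHomogeneous i F)]
    rw [Polynomial.eval_mul, Polynomial.eval_C, Polynomial.eval_pow, Polynomial.eval_X, mul_comm]
  have hq0 : q = 0 := by
    refine Polynomial.eq_zero_of_infinite_isRoot q ?_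
    refine Set.Infinite.mono (s := {0}ᶜ) (fun c hc => hq c hc) ?_
    exact (Set.finite_singleton 0).infinite_compl
  by_cases he : e < F.totalDegree + 1
  · have h2 : q.coeff e = 0 := by rw [hq0]; simp
    rw [Polynomial.finsetSum_coeff, Finset.sum_eq_single e] at h2
    · rwa [Polynomial.coeff_C_mul_X_pow, if_pos rfl] at h2
    · intro i _ hi
      rw [Polynomial.coeff_C_mul_X_pow, if_neg (Ne.symm hi)]
    · exact fun h => absurd (Finset.mem_range.2 he) h
  · rw [homogeneousComponent_eq_zero _ _ (by omega), map_zero]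

/-- Primality of a homogeneous ideal can be tested on homogeneous elements, whose zero loci are
closed here; for these it is the irreducibility of `Z`. -/
theorem Cone.isPrime_ideal [Infinite k]
    (hX : ∀ v ∈ X, ∀ c : k, c ≠ 0 → ⟨c • v.coord⟩ ∈ X)
    {Z : Set X} (hZ : IsClosed Z) (hirr : IsIrreducible Z) : (Cone.ideal Z).IsPrime := by
  let _ : GradedAlgebra (homogeneousSubmodule ι k) := gradedAlgebra
  refine Ideal.IsHomogeneous.isPrime_of_homogeneous_mem_or_mem
    (𝒜 := homogeneousSubmodule ι k) (I := Cone.ideal Z) ?_ ?_ ?_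
  · intro i F hF
    have := Cone.homogeneousComponent_mem hX hZ hF i
    rw [← decomposition.decompose'_apply] at this
    exact this
  · obtain ⟨z, hz⟩ := hirr.nonempty
    intro h
    have := mem_ideal.1 (h ▸ Submodule.mem_top : (1 : MvPolynomial ι k) ∈ Cone.ideal Z) z hz
    simp at this
  · rintro F G ⟨e, hF⟩ ⟨e', hG⟩ hFG
    have h1 := isPreirreducible_iff_isClosed_union_isClosed.1 hirr.isPreirreducible
      {v : X | eval v.1.coord F = 0} {v : X | eval v.1.coord G = 0}
      ((Cone.isClosed_eq_zero hF).preimage continuous_subtype_val)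
      ((Cone.isClosed_eq_zero hG).preimage continuous_subtype_val) (by
        intro z hz
        have := mem_ideal.1 hFG z hz
        rw [map_mul] at this
        exact mul_eq_zero.1 this)
    rcases h1 with h1 | h1
    · exact Or.inl (mem_ideal.2 fun z hz => h1 hz)
    · exact Or.inr (mem_ideal.2 fun z hz => h1 hz)

theorem Cone.ideal_lt_irrelevant [Infinite k]
    (hX : ∀ v ∈ X, ∀ c : k, c ≠ 0 → ⟨c • v.coord⟩ ∈ X)
    (hX0 : ∀ v ∈ X, ∃ i, v.coord i ≠ 0)
    {Z : Set X} (hZ : IsClosed Z) (hne : Z.Nonempty) :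
    Cone.ideal Z < RingHom.ker (constantCoeff (R := k) (σ := ι)) := by
  obtain ⟨z, hz⟩ := hne
  refine lt_of_le_not_ge (fun F hF => ?_) fun hle => ?_
  · have h0 := mem_ideal.1 (Cone.homogeneousComponent_mem hX hZ hF 0) z hz
    rw [homogeneousComponent_zero, eval_C] at h0
    exact h0
  · obtain ⟨i, hi⟩ := hX0 z.1 z.2
    apply hi
    have := mem_ideal.1 (hle (show (MvPolynomial.X i : MvPolynomial ι k) ∈ RingHom.ker _ by simp [RingHom.mem_ker])) z hz
    simpa using this

/-- A chain of irreducible closed sets gives a chain of primes in the polynomial ring, which can be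
extended by the irrelevant ideal. This extra member accounts for the difference between a cone and
its projectivization. -/
theorem Cone.krullDim_add_one_le [Infinite k] [Fintype ι]
    (hX : ∀ v ∈ X, ∀ c : k, c ≠ 0 → ⟨c • v.coord⟩ ∈ X)
    (hX0 : ∀ v ∈ X, ∃ i, v.coord i ≠ 0) [Nonempty (IrreducibleCloseds X)] :
    topologicalKrullDim X + 1 ≤ Fintype.card ι := by
  have hdim : ringKrullDim (MvPolynomial ι k) = Fintype.card ι := by
    rw [MvPolynomial.ringKrullDim_of_isNoetherianRing, ringKrullDim_eq_zero_of_field]; simp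
  let φ : WithTop (IrreducibleCloseds X)ᵒᵈ → PrimeSpectrum (MvPolynomial ι k) := fun Z =>
    match Z with
    | none => ⟨RingHom.ker constantCoeff, RingHom.ker_isPrime _⟩
    | some Z => ⟨Cone.ideal ((OrderDual.ofDual Z : IrreducibleCloseds X) : Set X),
        Cone.isPrime_ideal hX (OrderDual.ofDual Z).isClosed (OrderDual.ofDual Z).isIrreducible⟩
  have hφ : StrictMono φ := by
    intro Z Z' h
    match Z, Z', h with
    | none, _, h => exact absurd h not_top_lt
    | some Z, none, _ =>
      exact Cone.ideal_lt_irrelevant hX hX0 (OrderDual.ofDual Z).isClosed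
        (OrderDual.ofDual Z).isIrreducible.nonempty
    | some Z, some Z', h =>
      have h1 : Z < Z' := WithTop.coe_lt_coe.1 h
      exact Cone.ideal_strictAnti (OrderDual.ofDual Z').isClosed h1
  have := Order.krullDim_le_of_strictMono φ hφ
  rw [Order.krullDim_WithTop, Order.krullDim_orderDual] at this
  exact this.trans hdim.le

/-- As in the previous bound, but the chain of primes can also be extended by the zero ideal, since
every ideal in it contains the nonzero polynomial `F`. -/
theorem Cone.krullDim_add_two_le [Infinite k] [Fintype ι]
    (hX : ∀ v ∈ X, ∀ c : k, c ≠ 0 → ⟨c • v.coord⟩ ∈ X)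
    (hX0 : ∀ v ∈ X, ∃ i, v.coord i ≠ 0) [Nonempty (IrreducibleCloseds X)]
    {F : MvPolynomial ι k} (hF0 : F ≠ 0) (hF : ∀ v ∈ X, eval v.coord F = 0) :
    topologicalKrullDim X + 1 + 1 ≤ Fintype.card ι := by
  have hdim : ringKrullDim (MvPolynomial ι k) = Fintype.card ι := by
    rw [MvPolynomial.ringKrullDim_of_isNoetherianRing, ringKrullDim_eq_zero_of_field]; simp
  let φ : WithBot (WithTop (IrreducibleCloseds X)ᵒᵈ) → PrimeSpectrum (MvPolynomial ι k) := fun Z =>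
    match Z with
    | none => ⟨⊥, Ideal.isPrime_bot⟩
    | some none => ⟨RingHom.ker constantCoeff, RingHom.ker_isPrime _⟩
    | some (some Z) => ⟨Cone.ideal ((OrderDual.ofDual Z : IrreducibleCloseds X) : Set X),
        Cone.isPrime_ideal hX (OrderDual.ofDual Z).isClosed (OrderDual.ofDual Z).isIrreducible⟩
  have hbot : ∀ Z : Set X, (⊥ : Ideal (MvPolynomial ι k)) < Cone.ideal Z := by
    intro Z
    rw [bot_lt_iff_ne_bot]
    intro h
    exact hF0 (by simpa [h] using (mem_ideal.2 fun z _ => hF z.1 z.2 : F ∈ Cone.ideal Z))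
  have htop : ∀ Z : IrreducibleCloseds X,
      Cone.ideal (Z : Set X) < RingHom.ker (constantCoeff (R := k) (σ := ι)) := fun Z =>
    Cone.ideal_lt_irrelevant hX hX0 Z.isClosed Z.isIrreducible.nonempty
  have hφ : StrictMono φ := by
    intro Z Z' h
    match Z, Z', h with
    | some _, none, h => exact absurd h not_lt_bot
    | none, none, h => exact absurd h (lt_irrefl _)
    | none, some none, _ =>
      exact (hbot _).trans (htop (Classical.arbitrary _))
    | none, some (some Z), _ => exact hbot _
    | some none, some Z', h => exact absurd (WithBot.coe_lt_coe.1 h) not_top_lt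
    | some (some Z), some none, _ => exact htop (OrderDual.ofDual Z)
    | some (some Z), some (some Z'), h =>
      have h1 : WithTop.some Z < WithTop.some Z' := WithBot.coe_lt_coe.1 h
      have h2 : Z < Z' := WithTop.coe_lt_coe.1 h1
      exact Cone.ideal_strictAnti (OrderDual.ofDual Z').isClosed h2
  have := Order.krullDim_le_of_strictMono φ hφ
  rw [Order.krullDim_withBot, Order.krullDim_WithTop, Order.krullDim_orderDual] at this
  exact this.trans hdim.le

/-- The image of a polynomial map in an open subset of a cone is irreducible. -/
theorem Cone.isIrreducible_of_param [Infinite k] {σ : Type*} (θ : ι → MvPolynomial σ k)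
    (D : MvPolynomial ι k)
    {Z : Set X} (hZ : ∀ v : X, v ∈ Z ↔ ∃ t : σ → k, ∀ i, v.1.coord i = eval t (θ i))
    (hD : ∀ t : σ → k, eval (fun i => eval t (θ i)) D ≠ 0 → ⟨fun i => eval t (θ i)⟩ ∈ X)
    (hne : ∃ t : σ → k, eval (fun i => eval t (θ i)) D ≠ 0) : IsIrreducible Z := by
  have heval : ∀ (t : σ → k) (F : MvPolynomial ι k),
      eval t (aeval θ F) = eval (fun i => eval t (θ i)) F := by
    intro t F
    rw [← coe_aeval_eq_eval, ← coe_aeval_eq_eval, RingHom.coe_coe, RingHom.coe_coe,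
      ← AlgHom.comp_apply, comp_aeval]
  constructor
  · obtain ⟨t, ht⟩ := hne
    exact ⟨⟨_, hD t ht⟩, (hZ _).2 ⟨t, fun i => rfl⟩⟩
  · rintro U V hU hV ⟨u, hu, huU⟩ ⟨v, hv, hvV⟩
    obtain ⟨F, _, _, hFu, hFU⟩ := Cone.exists_of_isOpen hU huU
    obtain ⟨G, _, _, hGv, hGV⟩ := Cone.exists_of_isOpen hV hvV
    have hnz : ∀ (P : MvPolynomial ι k) (t : σ → k), eval (fun i => eval t (θ i)) P ≠ 0 →
        aeval θ P ≠ 0 := by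
      intro P t h h0
      apply h
      rw [← heval, h0, map_zero]
    obtain ⟨t, ht⟩ := hne
    have h1 := hnz D t ht
    have h2 : aeval θ F ≠ 0 := by
      obtain ⟨s, hs⟩ := (hZ u).1 hu
      refine hnz F s ?_
      rwa [← funext hs]
    have h3 : aeval θ G ≠ 0 := by
      obtain ⟨s, hs⟩ := (hZ v).1 hv
      refine hnz G s ?_
      rwa [← funext hs]
    -- The pullbacks to the parameter space lie in a domain, so a single parameter avoids the zeros
    -- of all three and yields a common point of the two open sets.
    have h4 : aeval θ D * (aeval θ F * aeval θ G) ≠ 0 := mul_ne_zero h1 (mul_ne_zero h2 h3)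
    obtain ⟨s, hs⟩ : ∃ s, eval s (aeval θ D * (aeval θ F * aeval θ G)) ≠ 0 := by
      by_contra! hcon
      exact h4 (MvPolynomial.funext fun s => by rw [hcon s, map_zero])
    simp only [map_mul, heval] at hs
    have hs1 := left_ne_zero_of_mul hs
    have hs2 := left_ne_zero_of_mul (right_ne_zero_of_mul hs)
    have hs3 := right_ne_zero_of_mul (right_ne_zero_of_mul hs)
    exact ⟨⟨_, hD s hs1⟩, (hZ _).2 ⟨s, fun i => rfl⟩, hFU _ hs2, hGV _ hs3⟩

end RationalNormal

end

/-! ### Finite slices of cones and continuity of polynomial maps -/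

noncomputable section

namespace RationalNormal

open TopologicalSpace MvPolynomial

variable {k : Type*} [Field k] {ι : Type*} {n : ℕ}

/-- By the projective Nullstellensatz every monomial of large degree is in the ideal generated by
the equations and `D`. On the slice where `D` equals one it can be rewritten in lower degree. So the
algebra of polynomial functions on the slice is finite-dimensional, and each coordinate takes
finitely many values. -/
theorem finite_zeros_of_isHomogeneous [IsAlgClosed k] [Fintype ι] {S : Type*}
    (G : S → MvPolynomial ι k) (d : S → ℕ) (hG : ∀ s, (G s).IsHomogeneous (d s))
    {D : MvPolynomial ι k} {e : ℕ} (he : e ≠ 0) (hD : D.IsHomogeneous e)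
    (h0 : ∀ v : ι → k, (∀ s, eval v (G s) = 0) → eval v D = 0 → v = 0) :
    {v : ι → k | (∀ s, eval v (G s) = 0) ∧ eval v D = 1}.Finite := by
  classical
  let _ : GradedAlgebra (homogeneousSubmodule ι k) := gradedAlgebra
  set T := {v : ι → k | (∀ s, eval v (G s) = 0) ∧ eval v D = 1} with hT
  obtain ⟨N, hN⟩ := exists_degree_monomial_mem
    (Ideal.span (Set.range G) ⊔ Ideal.span {D}) (by
      intro v hv
      refine h0 v (fun s => hv _ (Ideal.mem_sup_left (Ideal.subset_span ⟨s, rfl⟩)))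
        (hv _ (Ideal.mem_sup_right (Ideal.subset_span rfl))))
  let φ : MvPolynomial ι k →ₐ[k] (T → k) := AlgHom.pi fun t => aeval t.1
  have hφ : ∀ F t, φ F t = eval t.1 F := fun F t => by
    change aeval t.1 F = _
    rw [aeval_eq_eval]
  have hφG : ∀ F ∈ Ideal.span (Set.range G), φ F = 0 := by
    intro F hF
    have : Ideal.span (Set.range G) ≤ RingHom.ker φ := by
      rw [Ideal.span_le]
      rintro _ ⟨s, rfl⟩
      exact (RingHom.mem_ker).2 (funext fun t => by rw [hφ]; exact t.2.1 s)
    exact RingHom.mem_ker.1 (this hF)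
  have hφD : φ D = 1 := funext fun t => by rw [hφ]; exact t.2.2
  have hhom : (Ideal.span (Set.range G)).IsHomogeneous (homogeneousSubmodule ι k) := by
    refine Ideal.homogeneous_span _ _ ?_
    rintro _ ⟨s, rfl⟩
    exact ⟨d s, hG s⟩
  have hfin : {α : ι →₀ ℕ | α.degree < N}.Finite := by
    have : {α : ι →₀ ℕ | α.degree < N} ⊆
        ⋃ m ∈ Finset.range N, (Finset.univ.finsuppAntidiag m : Finset (ι →₀ ℕ)) := by
      intro α hα
      simp only [Set.mem_iUnion]
      refine ⟨α.degree, Finset.mem_range.2 hα, ?_⟩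
      simp [Finset.mem_finsuppAntidiag, Finsupp.degree_eq_sum]
    exact (Set.Finite.biUnion (Finset.finite_toSet _) fun m _ => Finset.finite_toSet _).subset this
  set V := Submodule.span k ((fun α : ι →₀ ℕ => φ (monomial α 1)) '' {α | α.degree < N}) with hV
  have hVmem : ∀ (m : ℕ) (α : ι →₀ ℕ), α.degree = m → φ (monomial α 1) ∈ V := by
    intro m
    induction m using Nat.strong_induction_on with
    | _ m ih =>
      intro α hα
      by_cases hlt : α.degree < N
      · exact Submodule.subset_span ⟨α, hlt, rfl⟩
      -- Keep only the part of degree `m`: the element `H` vanishes on the slice and `D` becomes 1,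
      -- so a polynomial of degree `m - e` remains. The assumption `e ≠ 0` makes the induction work.
      obtain ⟨H, hH, Q, hQ, hHQ⟩ := Submodule.mem_sup.1 (hN α (not_lt.1 hlt))
      obtain ⟨q, rfl⟩ := Ideal.mem_span_singleton'.1 hQ
      have h1 : (monomial α (1 : k)) = homogeneousComponent m H +
          ∑ i ∈ Finset.range (q.totalDegree + 1),
            homogeneousComponent m (homogeneousComponent i q * D) := by
        rw [← map_sum, ← Finset.sum_mul, sum_homogeneousComponent, ← map_add, hHQ,
          homogeneousComponent_eq_self (isHomogeneous_monomial 1 hα)]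
      rw [h1, map_add, hφG _ (homogeneousComponent_mem_of_mem hhom hH m), zero_add, map_sum]
      refine Submodule.sum_mem _ fun i _ => ?_
      have h2 : homogeneousComponent i q * D ∈ homogeneousSubmodule ι k (i + e) :=
        (homogeneousComponent_isHomogeneous i q).mul hD
      rw [homogeneousComponent_of_mem h2]
      split_ifs with hi
      · rw [map_mul, hφD, mul_one, (homogeneousComponent i q).as_sum, map_sum]
        refine Submodule.sum_mem _ fun β hβ => ?_
        have h3 : β.degree = i := by
          by_contra hne
          exact (mem_support_iff.1 hβ)
            ((homogeneousComponent_isHomogeneous i q).coeff_eq_zero hne)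
        have h4 := ih i (by omega) β h3
        rw [← mul_one (coeff β _), ← smul_eq_mul, ← smul_monomial, map_smul]
        exact V.smul_mem _ h4
      · rw [map_zero]; exact V.zero_mem
  have hrange : (AlgHom.range φ).toSubmodule ≤ V := by
    rintro _ ⟨F, rfl⟩
    change φ F ∈ V
    rw [F.as_sum, map_sum]
    refine Submodule.sum_mem _ fun β _ => ?_
    rw [← mul_one (coeff β _), ← smul_eq_mul, ← smul_monomial, map_smul]
    exact V.smul_mem _ (hVmem _ β rfl)
  have hVfin : Module.Finite k V := Module.Finite.span_of_finite k (hfin.image _)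
  have hAfin : Module.Finite k (AlgHom.range φ) :=
    Module.Finite.of_injective (Submodule.inclusion hrange) (Submodule.inclusion_injective hrange)
  have hint : ∀ i, ∃ p : Polynomial k, p ≠ 0 ∧ ∀ t : T, p.eval (t.1 i) = 0 := by
    intro i
    obtain ⟨p, hp, hp0⟩ := (Algebra.IsIntegral.of_finite k (AlgHom.range φ)).isIntegral
      ⟨φ (X i), ⟨X i, rfl⟩⟩
    refine ⟨p, hp.ne_zero, fun t => ?_⟩
    have h1 := congrFun (congrArg (AlgHom.range φ).val hp0) t
    rw [← Polynomial.aeval_def, ← Polynomial.aeval_algHom_apply] at h1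
    have h2 : Polynomial.aeval (φ (X i)) p t = 0 := h1
    have h3 := Polynomial.aeval_algHom_apply (Pi.evalAlgHom k (fun _ : T => k) t) (φ (X i)) p
    have h4 : Pi.evalAlgHom k (fun _ : T => k) t (φ (X i)) = t.1 i := by
      change φ (X i) t = _
      rw [hφ, eval_X]
    rw [h4, Polynomial.coe_aeval_eq_eval] at h3
    exact h3.trans h2
  choose p hp hpt using hint
  refine (Set.Finite.pi fun i => (p i).roots.toFinset.finite_toSet).subset fun v hv => ?_
  refine Set.mem_univ_pi.2 fun i => ?_
  rw [Finset.mem_coe, Multiset.mem_toFinset, Polynomial.mem_roots (hp i)]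
  exact hpt i ⟨v, hv⟩

theorem Cone.continuous_to_cone {ι' : Type*} {X : Set (Cone k ι)} {Y : Set (Cone k ι')}
    (f : X → Y) (A : ι' → MvPolynomial ι k) {d : ℕ} (hA : ∀ i, (A i).IsHomogeneous d)
    (h : ∀ v i, (f v).1.coord i = eval v.1.coord (A i)) : Continuous f := by
  refine continuous_induced_rng.2 (continuous_generateFrom_iff.2 ?_)
  rintro _ ⟨F, e, hF, rfl⟩
  have : Subtype.val ∘ f ⁻¹' {v | eval v.coord F ≠ 0} =
      Subtype.val ⁻¹' {v : Cone k ι | eval v.coord (aeval A F) ≠ 0} := by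
    ext v
    have h1 : eval v.1.coord (aeval A F) = eval (f v).1.coord F := by
      rw [← coe_aeval_eq_eval, ← coe_aeval_eq_eval, RingHom.coe_coe, RingHom.coe_coe,
        ← AlgHom.comp_apply, comp_aeval]
      congr 2
      ext i
      rw [h v i]; rfl
    change eval (f v).1.coord F ≠ 0 ↔ eval v.1.coord (aeval A F) ≠ 0
    rw [h1]
  rw [this]
  exact (Cone.isOpen_ne_zero (hF.aeval A hA)).preimage continuous_subtype_val

/-- The index `c` runs over charts, that is, pairs of equations with polynomial coefficients. Each
chart must describe `f` or degenerate to zero Plücker coordinates at every point, so the chart valid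
at `v` controls a whole neighbourhood of `v`. -/
theorem Cone.continuous_to_grass {I : Type*} {X : Set (Cone k ι)} (f : X → Grass k n)
    (A B : I → Fin (n + 1) → MvPolynomial ι k) {d : ℕ}
    (hA : ∀ c i, (A c i).IsHomogeneous d) (hB : ∀ c i, (B c i).IsHomogeneous d)
    (h1 : ∀ v, ∃ c, (f v).1 =
      zeroSpace (fun i => eval v.1.coord (A c i)) (fun i => eval v.1.coord (B c i)))
    (h2 : ∀ v c, (f v).1 =
      zeroSpace (fun i => eval v.1.coord (A c i)) (fun i => eval v.1.coord (B c i)) ∨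
      plucker (fun i => eval v.1.coord (A c i)) (fun i => eval v.1.coord (B c i)) = 0) :
    Continuous f := by
  refine continuous_generateFrom_iff.2 ?_
  rintro _ ⟨F, e, hF, rfl⟩
  rw [isOpen_iff_forall_mem_open]
  rintro v ⟨L, M, hLM, hne⟩
  obtain ⟨c, hc⟩ := h1 v
  let P : Fin (n + 1) × Fin (n + 1) → MvPolynomial ι k := fun p =>
    A c p.1 * B c p.2 - A c p.2 * B c p.1
  have hP : ∀ p, (P p).IsHomogeneous (d + d) := fun p =>
    ((hA _ _).mul (hB _ _)).sub ((hA _ _).mul (hB _ _))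
  have heval : ∀ w : ι → k, eval w (aeval P F) =
      eval (plucker (fun i => eval w (A c i)) (fun i => eval w (B c i))) F := by
    intro w
    rw [← coe_aeval_eq_eval, ← coe_aeval_eq_eval, RingHom.coe_coe, RingHom.coe_coe,
      ← AlgHom.comp_apply, comp_aeval]
    congr 2
    ext p
    simp [P, plucker]
  refine ⟨_, ?_, (Cone.isOpen_ne_zero (hF.aeval P hP)).preimage continuous_subtype_val, ?_⟩
  · intro w hw
    change eval w.1.coord (aeval P F) ≠ 0 at hw
    rw [heval] at hw
    rcases h2 w c with h | h
    · exact ⟨_, _, h, hw⟩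
    · obtain ⟨L', M', h'⟩ := (f w).exists_rep
      refine ⟨L', M', h', fun h0 => hw ?_⟩
      -- Where the chart degenerates, the value of `F` at 0 is `0 ^ e` times its value at the true
      -- Plücker coordinates; so it can be nonzero only if the latter is.
      rw [h, ← zero_smul k (plucker L' M'), eval_smul_of_isHomogeneous hF, h0, mul_zero]
  · change eval v.1.coord (aeval P F) ≠ 0
    rw [heval]
    exact fun h0 => hne (eval_plucker_eq_zero hc hLM hF h0)

/-- The value of a binary form at a pair of polynomials. -/
def substForm (L : Fin (n + 1) → k) (p q : MvPolynomial ι k) : MvPolynomial ι k :=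
  ∑ j, C (L j) * (p ^ (n - (j : ℕ)) * q ^ (j : ℕ))

theorem isHomogeneous_pow_mul_pow {p q : MvPolynomial ι k} {e : ℕ} (hp : p.IsHomogeneous e)
    (hq : q.IsHomogeneous e) (j : Fin (n + 1)) :
    (p ^ (n - (j : ℕ)) * q ^ (j : ℕ)).IsHomogeneous (e * n) := by
  have := (hp.pow (n - (j : ℕ))).mul (hq.pow (j : ℕ))
  rwa [← mul_add, Nat.sub_add_cancel (by omega)] at this

theorem isHomogeneous_substForm (L : Fin (n + 1) → k) {p q : MvPolynomial ι k} {e : ℕ}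
    (hp : p.IsHomogeneous e) (hq : q.IsHomogeneous e) :
    (substForm L p q).IsHomogeneous (e * n) :=
  IsHomogeneous.sum _ _ _ fun j _ => (isHomogeneous_pow_mul_pow hp hq j).C_mul _

theorem eval_substForm (L : Fin (n + 1) → k) (p q : MvPolynomial ι k) (v : ι → k) :
    eval v (substForm L p q) = evalForm n L ![eval v p, eval v q] := by
  simp [substForm, evalForm_apply]

end RationalNormal

end

/-! ### The action of matrices on pencils -/

noncomputable section

namespace RationalNormal

open TopologicalSpace MvPolynomial

variable {k : Type*} [Field k] {n : ℕ}

theorem linearIndependent_pair_map {V V' : Type*} [AddCommGroup V] [Module k V] [AddCommGroup V']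
    [Module k V'] (φ : V →ₗ[k] V') (hφ : Function.Injective φ) {x y : V}
    (h : LinearIndependent k ![x, y]) : LinearIndependent k ![φ x, φ y] := by
  rw [LinearIndependent.pair_iff] at h ⊢
  intro s t hst
  rw [← map_smul, ← map_smul, ← map_add] at hst
  exact h s t (hφ (hst.trans (map_zero φ).symm))

section Action

variable [Infinite k]

/-- The substitution `f ↦ f ∘ M` on binary forms of degree `n`. -/
def compLin (n : ℕ) (M : Matrix (Fin 2) (Fin 2) k) :
    (Fin (n + 1) → k) →ₗ[k] (Fin (n + 1) → k) where
  toFun := compForm M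
  map_add' L L' := evalForm_injective (by ext u; simp)
  map_smul' c L := evalForm_injective (by ext u; simp)

@[simp] theorem evalForm_compLin (M : Matrix (Fin 2) (Fin 2) k) (L : Fin (n + 1) → k)
    (u : Fin 2 → k) : evalForm n (compLin n M L) u = evalForm n L (M.mulVec u) :=
  evalForm_compForm M L u

theorem compLin_mul (M N : Matrix (Fin 2) (Fin 2) k) (L : Fin (n + 1) → k) :
    compLin n N (compLin n M L) = compLin n (M * N) L :=
  evalForm_injective (by
    ext u
    rw [evalForm_compLin, evalForm_compLin, evalForm_compLin, Matrix.mulVec_mulVec])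

theorem compLin_smul_one (c : k) (L : Fin (n + 1) → k) :
    compLin n (c • (1 : Matrix (Fin 2) (Fin 2) k)) L = c ^ n • L :=
  evalForm_injective (by ext u; simp [Matrix.smul_mulVec, evalForm_smul])

theorem compLin_injective {M : Matrix (Fin 2) (Fin 2) k} (hM : M.det ≠ 0) :
    Function.Injective (compLin (k := k) n M) := by
  intro L L' h
  have h1 : ∀ L : Fin (n + 1) → k, compLin n M⁻¹ (compLin n M L) = L := by
    intro L
    rw [compLin_mul, Matrix.mul_nonsing_inv _ (isUnit_iff_ne_zero.2 hM)]
    simpa using compLin_smul_one (n := n) (1 : k) L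
  rw [← h1 L, h, h1]

/-- The subspace whose pencil consists of the forms `f ∘ M`, for `f` in the pencil of `W`. -/
def Grass.comp (W : Grass k n) (M : Matrix (Fin 2) (Fin 2) k) (hM : M.det ≠ 0) : Grass k n :=
  Grass.mk (compLin n M W.exists_rep.choose)
    (compLin n M W.exists_rep.choose_spec.choose) (linearIndependent_pair_map _
      (compLin_injective hM)
      (linearIndependent_of_eq_zeroSpace W.exists_rep.choose_spec.choose_spec))

theorem Grass.pencil_comp (W : Grass k n) (M : Matrix (Fin 2) (Fin 2) k) (hM : M.det ≠ 0) :
    pencil (W.comp M hM).1 = (pencil W.1).map (compLin n M) := by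
  have h1 : pencil W.1 = Submodule.span k
      {W.exists_rep.choose, W.exists_rep.choose_spec.choose} := by
    conv_lhs => rw [W.exists_rep.choose_spec.choose_spec]
    exact pencil_zeroSpace _ _
  rw [h1, Submodule.map_span, Set.image_pair]
  exact pencil_zeroSpace _ _

theorem Grass.comp_eq_zeroSpace {W : Grass k n} {L L' : Fin (n + 1) → k}
    (h : W.1 = zeroSpace L L') (M : Matrix (Fin 2) (Fin 2) k) (hM : M.det ≠ 0) :
    (W.comp M hM).1 = zeroSpace (compLin n M L) (compLin n M L') := by
  obtain ⟨A, B, hAB⟩ := (W.comp M hM).exists_rep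
  rw [hAB]
  apply zeroSpace_eq_of_span_eq
  rw [← pencil_zeroSpace, ← hAB, Grass.pencil_comp, h, pencil_zeroSpace, Submodule.map_span,
    Set.image_pair]

theorem Grass.comp_comp (W : Grass k n) (M N : Matrix (Fin 2) (Fin 2) k) (hM : M.det ≠ 0)
    (hN : N.det ≠ 0) :
    (W.comp M hM).comp N hN = W.comp (M * N) (by rw [Matrix.det_mul]; exact mul_ne_zero hM hN) := by
  apply Grass.ext_pencil
  rw [Grass.pencil_comp, Grass.pencil_comp, Grass.pencil_comp, ← Submodule.map_comp]
  congr 1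
  exact LinearMap.ext fun L => compLin_mul M N L

theorem Grass.comp_smul_one (W : Grass k n) {c : k} (M : Matrix (Fin 2) (Fin 2) k)
    (hM : M.det ≠ 0) (h : M = c • 1) : W.comp M hM = W := by
  apply Grass.eq_of_pencil_le
  rw [Grass.pencil_comp]
  rintro _ ⟨f, hf, rfl⟩
  rw [h, compLin_smul_one]
  exact Submodule.smul_mem _ _ hf

theorem Grass.comp_eq_of_le {W W' : Grass k n} (M : Matrix (Fin 2) (Fin 2) k) (hM : M.det ≠ 0)
    (h : ∀ f ∈ pencil W.1, compLin n M f ∈ pencil W'.1) : W.comp M hM = W' := by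
  apply Grass.eq_of_pencil_le
  rw [Grass.pencil_comp]
  rintro _ ⟨f, hf, rfl⟩
  exact h f hf

theorem Grass.comp_mem_baseFree {W : Grass k n} (hW : W ∈ baseFree k n)
    (M : Matrix (Fin 2) (Fin 2) k) (hM : M.det ≠ 0) : W.comp M hM ∈ baseFree k n := by
  intro u hu
  obtain ⟨f, hf, hne⟩ := hW (M.mulVec u) fun h0 => hu (Matrix.eq_zero_of_mulVec_eq_zero hM h0)
  refine ⟨compLin n M f, ?_, by simpa using hne⟩
  rw [Grass.pencil_comp]
  exact ⟨f, hf, rfl⟩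

end Action

/-- The matrix with given entries. -/
def mat (v : Fin 4 → k) : Matrix (Fin 2) (Fin 2) k := !![v 0, v 1; v 2, v 3]

theorem mat_mulVec (v : Fin 4 → k) (u : Fin 2 → k) :
    (mat v).mulVec u = ![v 0 * u 0 + v 1 * u 1, v 2 * u 0 + v 3 * u 1] := by
  ext i; fin_cases i <;> simp [mat, Matrix.mulVec, dotProduct, Fin.sum_univ_two]

theorem det_mat (v : Fin 4 → k) : (mat v).det = v 0 * v 3 - v 1 * v 2 := by
  simp [mat, Matrix.det_fin_two]

theorem mat_eta {R : Type*} (M : Matrix (Fin 2) (Fin 2) R) :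
    mat ![M 0 0, M 0 1, M 1 0, M 1 1] = M := by
  ext i j; fin_cases i <;> fin_cases j <;> rfl

theorem exists_eq_smul_of_det_eq_zero {v : Fin 4 → k} (hv : v ≠ 0) (h : (mat v).det = 0) :
    ∃ w : Fin 2 → k, w ≠ 0 ∧ ∃ a b : k, (a, b) ≠ 0 ∧
      ∀ u, (mat v).mulVec u = (a * u 0 + b * u 1) • w := by
  rw [det_mat] at h
  simp only [mat_mulVec]
  by_cases h0 : ![v 0, v 1] = 0
  · have h1 := congrFun h0 0
    have h2 := congrFun h0 1
    simp only [Matrix.cons_val_zero, Matrix.cons_val_one, Pi.zero_apply] at h1 h2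
    refine ⟨![0, 1], fun h => by simpa using congrFun h 1, v 2, v 3, fun h3 => hv ?_, fun u => ?_⟩
    · ext i; fin_cases i
      · exact h1
      · exact h2
      · exact congrArg Prod.fst h3
      · exact congrArg Prod.snd h3
    · ext i; fin_cases i <;> simp [h1, h2]
  · obtain ⟨c, hc⟩ := (bracket_eq_zero_iff (v := ![v 2, v 3]) h0).1 (by simpa [bracket] using h)
    have h1 : v 2 = c * v 0 := by simpa using congrFun hc 0
    have h2 : v 3 = c * v 1 := by simpa using congrFun hc 1
    refine ⟨![1, c], fun h => by simpa using congrFun h 0, v 0, v 1, fun h3 => h0 ?_, fun u => ?_⟩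
    · ext i; fin_cases i
      · exact congrArg Prod.fst h3
      · exact congrArg Prod.snd h3
    · ext i; fin_cases i <;> simp [h1, h2]; ring

/-- The cone of invertible matrices. -/
def GLCone (k : Type*) [Field k] : Set (Cone k (Fin 4)) := {v | (mat v.coord).det ≠ 0}

theorem exists_minor_ne_zero {α : Type*} {f g : α → k} (h : LinearIndependent k ![f, g]) :
    ∃ i j, f i * g j - f j * g i ≠ 0 := by
  by_contra! h0
  rw [LinearIndependent.pair_iff] at h
  have h1 : ∀ i, f i = 0 := by
    intro i
    have := h (g i) (-f i) (by
      ext j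
      simp only [Pi.add_apply, Pi.smul_apply, smul_eq_mul, Pi.zero_apply]
      linear_combination -h0 i j)
    simpa using this.2
  have := h 1 0 (by ext j; simp [h1])
  simp at this

theorem linearIndependent_evalForm [Infinite k] {L M : Fin (n + 1) → k}
    (h : LinearIndependent k ![L, M]) : LinearIndependent k ![evalForm n L, evalForm n M] := by
  exact linearIndependent_pair_map _ evalForm_injective h

/-- Membership in a pencil, expressed by the vanishing of determinants of values. -/
theorem mem_span_pair_iff_forall_det [Infinite k] {L M : Fin (n + 1) → k}
    (h : LinearIndependent k ![L, M]) (N : Fin (n + 1) → k) :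
    N ∈ Submodule.span k {L, M} ↔ ∀ x y z : Fin 2 → k,
      evalForm n N x * (evalForm n L y * evalForm n M z - evalForm n L z * evalForm n M y) +
      evalForm n N y * (evalForm n L z * evalForm n M x - evalForm n L x * evalForm n M z) +
      evalForm n N z * (evalForm n L x * evalForm n M y - evalForm n L y * evalForm n M x) = 0 := by
  rw [Submodule.mem_span_pair]
  constructor
  · rintro ⟨a, b, rfl⟩ x y z
    simp only [map_add, map_smul, Pi.add_apply, Pi.smul_apply, smul_eq_mul]
    ring
  · intro hN
    obtain ⟨y, z, hyz⟩ := exists_minor_ne_zero (linearIndependent_evalForm h)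
    set δ := evalForm n L y * evalForm n M z - evalForm n L z * evalForm n M y with hδ
    refine ⟨(evalForm n N y * evalForm n M z - evalForm n N z * evalForm n M y) / δ,
      (evalForm n L y * evalForm n N z - evalForm n L z * evalForm n N y) / δ,
      evalForm_injective ?_⟩
    ext x
    have := hN x y z
    simp only [map_add, map_smul, Pi.add_apply, Pi.smul_apply, smul_eq_mul]
    field_simp
    rw [hδ]
    linear_combination -this

/-- The polynomials in the entries of `M` expressing that `f ∘ M` lies in the pencil spanned by
`L` and `L'`. -/
def stabPoly (L L' : Fin (n + 1) → k) (s : (Fin 2 → k) × (Fin 2 → k) × (Fin 2 → k))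
    (j : Fin (n + 1)) : MvPolynomial (Fin 4) k :=
  let m (u : Fin 2 → k) : MvPolynomial (Fin 4) k :=
    (C (u 0) * X 0 + C (u 1) * X 1) ^ (n - (j : ℕ)) * (C (u 0) * X 2 + C (u 1) * X 3) ^ (j : ℕ)
  let δ (u v : Fin 2 → k) : k := evalForm n L u * evalForm n L' v - evalForm n L v * evalForm n L' u
  C (δ s.2.1 s.2.2) * m s.1 + C (δ s.2.2 s.1) * m s.2.1 + C (δ s.1 s.2.1) * m s.2.2

theorem isHomogeneous_linear {ι : Type*} (a b : k) (i j : ι) :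
    (C a * X i + C b * X j : MvPolynomial ι k).IsHomogeneous 1 :=
  (isHomogeneous_C_mul_X a i).add (isHomogeneous_C_mul_X b j)

theorem isHomogeneous_stabPoly (L L' : Fin (n + 1) → k) (s j) :
    (stabPoly L L' s j).IsHomogeneous n := by
  have h : ∀ u : Fin 2 → k, ((C (u 0) * X 0 + C (u 1) * X 1 : MvPolynomial (Fin 4) k) ^
      (n - (j : ℕ)) * (C (u 0) * X 2 + C (u 1) * X 3) ^ (j : ℕ)).IsHomogeneous n := by
    intro u
    simpa using isHomogeneous_pow_mul_pow (isHomogeneous_linear (u 0) (u 1) (0 : Fin 4) 1)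
      (isHomogeneous_linear (u 0) (u 1) 2 3) j
  exact (((h _).C_mul _).add ((h _).C_mul _)).add ((h _).C_mul _)

theorem sum_stabPoly (L L' f : Fin (n + 1) → k) (x y z : Fin 2 → k) (v : Fin 4 → k) :
    ∑ j, f j * eval v (stabPoly L L' (x, y, z) j) =
      evalForm n f ((mat v).mulVec x) *
        (evalForm n L y * evalForm n L' z - evalForm n L z * evalForm n L' y) +
      evalForm n f ((mat v).mulVec y) *
        (evalForm n L z * evalForm n L' x - evalForm n L x * evalForm n L' z) +
      evalForm n f ((mat v).mulVec z) *
        (evalForm n L x * evalForm n L' y - evalForm n L y * evalForm n L' x) := by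
  have h : ∀ u c, evalForm n f ((mat v).mulVec u) * c =
      ∑ j : Fin (n + 1), f j * (c * ((u 0 * v 0 + u 1 * v 1) ^ (n - (j : ℕ)) *
        (u 0 * v 2 + u 1 * v 3) ^ (j : ℕ))) := by
    intro u c
    rw [evalForm_apply, Finset.sum_mul, mat_mulVec]
    refine Finset.sum_congr rfl fun j _ => ?_
    simp only [Matrix.cons_val_zero, Matrix.cons_val_one]
    ring
  rw [h, h, h, ← Finset.sum_add_distrib, ← Finset.sum_add_distrib]
  refine Finset.sum_congr rfl fun j _ => ?_
  simp [stabPoly]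
  ring

theorem forall_stabPoly_iff [Infinite k] {W W' : Grass k n} {L L' : Fin (n + 1) → k}
    (hW : W.1 = zeroSpace L L') (v : Fin 4 → k) :
    (∀ s, ∀ f ∈ pencil W'.1, ∑ j, f j * eval v (stabPoly L L' s j) = 0) ↔
      ∀ f ∈ pencil W'.1, compLin n (mat v) f ∈ pencil W.1 := by
  have h : ∀ f, compLin n (mat v) f ∈ pencil W.1 ↔
      ∀ s, ∑ j, f j * eval v (stabPoly L L' s j) = 0 := by
    intro f
    rw [hW, pencil_zeroSpace,
      mem_span_pair_iff_forall_det (linearIndependent_of_eq_zeroSpace hW)]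
    constructor
    · rintro h ⟨x, y, z⟩
      rw [sum_stabPoly]
      simpa using h x y z
    · intro h x y z
      have := h (x, y, z)
      rw [sum_stabPoly] at this
      simpa using this
  simp only [h]
  exact ⟨fun H f hf s => H s f hf, fun H s f hf => H f hf s⟩

/-- The pencil of `W` contains no `n`-th power of a linear form. -/
def NoPower (W : Grass k n) : Prop :=
  ∀ f ∈ pencil W.1, ∀ a b : k, (a, b) ≠ 0 → ¬ ∀ u, evalForm n f u = (a * u 0 + b * u 1) ^ n

/-- If the forms of a base point free pencil are mapped by a nonzero matrix to a pencil without
powers, then the matrix is invertible. -/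
theorem det_ne_zero_of_comp_le [Infinite k] {W W' : Grass k n} (hW : NoPower W)
    (hW' : W' ∈ baseFree k n) {v : Fin 4 → k} (hv : v ≠ 0)
    (h : ∀ f ∈ pencil W'.1, compLin n (mat v) f ∈ pencil W.1) : (mat v).det ≠ 0 := by
  intro hdet
  obtain ⟨w, hw, a, b, hab, hmul⟩ := exists_eq_smul_of_det_eq_zero hv hdet
  obtain ⟨f, hf, hne⟩ := hW' w hw
  -- A singular nonzero matrix sends every `u` to a multiple `ℓ u • w` of one vector, with `ℓ`
  -- linear, so substitution turns `f` into `f w * ℓ ^ n`. Normalizing by `f w`, which is nonzero,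
  -- exhibits a forbidden power in the pencil of `W`.
  refine hW _ (Submodule.smul_mem _ (evalForm n f w)⁻¹ (h f hf)) a b hab fun u => ?_
  rw [map_smul, Pi.smul_apply, evalForm_compLin, hmul, evalForm_smul, smul_eq_mul]
  field_simp

end RationalNormal

end

/-! ### Orbits of pencils and their dimension -/

noncomputable section

namespace RationalNormal

open TopologicalSpace MvPolynomial

variable {k : Type*} [Field k] {n : ℕ}

theorem det_adjugate_ne_zero {M : Matrix (Fin 2) (Fin 2) k} (h : M.det ≠ 0) :
    M.adjugate.det ≠ 0 := by
  rw [Matrix.det_adjugate]; simpa using h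

theorem GLCone.det_ne_zero (v : GLCone k) : (mat v.1.coord).det ≠ 0 := v.2

section Orbit

variable [Infinite k]

/-- The orbit map of a point of the Grassmannian. -/
def orbitMap (W : Grass k n) (v : GLCone k) : Grass k n :=
  W.comp (mat v.1.coord).adjugate (det_adjugate_ne_zero (GLCone.det_ne_zero v))

theorem orbitMap_comp (W : Grass k n) (v : GLCone k) :
    (orbitMap W v).comp (mat v.1.coord) (GLCone.det_ne_zero v) = W := by
  exact (Grass.comp_comp _ _ _ _ _).trans (Grass.comp_smul_one _ _ _ (Matrix.adjugate_mul _))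

/-- The adjugate is the inverse up to a scalar, and scalars act trivially on pencils. It is used
because its entries are polynomials in those of the matrix. -/
theorem orbitMap_eq_iff {W W' : Grass k n} {v : GLCone k} :
    orbitMap W v = W' ↔ W'.comp (mat v.1.coord) (GLCone.det_ne_zero v) = W := by
  constructor
  · rintro rfl; exact orbitMap_comp W v
  · rintro rfl
    exact (Grass.comp_comp _ _ _ _ _).trans (Grass.comp_smul_one _ _ _ (Matrix.mul_adjugate _))

theorem mem_range_orbitMap {W W' : Grass k n} :
    W' ∈ Set.range (orbitMap W) ↔ ∃ M, ∃ hM : M.det ≠ 0, W' = W.comp M hM := by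
  constructor
  · rintro ⟨v, rfl⟩
    exact ⟨_, _, rfl⟩
  · rintro ⟨M, hM, rfl⟩
    refine ⟨⟨⟨![M.adjugate 0 0, M.adjugate 0 1, M.adjugate 1 0, M.adjugate 1 1]⟩, ?_⟩, ?_⟩
    · change (mat _).det ≠ 0
      rw [mat_eta]; exact det_adjugate_ne_zero hM
    · refine orbitMap_eq_iff.2 ((Grass.comp_comp _ _ _ _ _).trans
        (Grass.comp_smul_one _ (c := M.det) _ _ ?_))
      rw [mat_eta, Matrix.mul_adjugate]

/-- By interpolation the coefficients of `f ∘ adj v` are fixed combinations of its values at the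
points (1, t), which are homogeneous of degree `n` in the entries of `v`. -/
theorem continuous_orbitMap (W : Grass k n) : Continuous (orbitMap W) := by
  obtain ⟨L, L', hW⟩ := W.exists_rep
  obtain ⟨t, c, hc⟩ := exists_interpolation k n
  let A (L : Fin (n + 1) → k) (i : Fin (n + 1)) : MvPolynomial (Fin 4) k :=
    ∑ a, C (c i a) * substForm L (C 1 * X 3 + C (-t a) * X 1) (C (-1) * X 2 + C (t a) * X 0)
  have hA : ∀ L i, (A L i).IsHomogeneous n := fun L i => by
    refine IsHomogeneous.sum _ _ _ fun a _ => IsHomogeneous.C_mul ?_ _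
    simpa using isHomogeneous_substForm L (isHomogeneous_linear 1 (-t a) 3 (1 : Fin 4))
      (isHomogeneous_linear (-1) (t a) 2 0)
  have heval : ∀ (v : Fin 4 → k) L, (fun i => eval v (A L i)) = compLin n (mat v).adjugate L := by
    intro v L
    ext i
    rw [hc (compLin n (mat v).adjugate L) i, map_sum]
    refine Finset.sum_congr rfl fun a _ => ?_
    rw [map_mul, eval_C, eval_substForm, evalForm_compLin]
    have : ![eval v (C 1 * X 3 + C (-t a) * X 1), eval v (C (-1) * X 2 + C (t a) * X 0)] =
        (mat v).adjugate.mulVec ![1, t a] := by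
      ext j; fin_cases j <;>
        simp [mat, Matrix.adjugate_fin_two, Matrix.vecHead, Matrix.vecTail, mul_comm]
    rw [this]
  have hz : ∀ v : GLCone k, (orbitMap W v).1 =
      zeroSpace (fun i => eval v.1.coord (A L i)) (fun i => eval v.1.coord (A L' i)) := by
    intro v
    rw [heval, heval]
    exact Grass.comp_eq_zeroSpace hW _ _
  exact Cone.continuous_to_grass (I := Unit) (orbitMap W) (fun _ => A L) (fun _ => A L')
    (fun _ => hA L) (fun _ => hA L') (fun v => ⟨(), hz v⟩) fun v _ => Or.inl (hz v)

end Orbit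

/-- The closed set consists of the `W'` for which some nonzero matrix satisfies the homogeneous
equations of `Z` and carries the pencil of `W'` into that of `W`. Over base point free `W'` such a
matrix is invertible because `W` contains no powers, so nothing outside the image appears. -/
theorem image_orbitMap_eq [IsAlgClosed k] {W : Grass k n} (hW : W ∈ baseFree k n) (hN : NoPower W)
    {Z : Set (GLCone k)} (hZ : IsClosed Z) :
    ∃ C, IsClosed C ∧ orbitMap W '' Z = C ∩ baseFree k n := by
  have := IsAlgClosed.instInfinite (K := k)
  obtain ⟨L, L', hL⟩ := W.exists_rep
  let S₀ := {F : MvPolynomial (Fin 4) k // ∃ e, F.IsHomogeneous e ∧ ∀ z ∈ Z, eval z.1.coord F = 0}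
  refine ⟨_, Grass.isClosed_exists (k := k) (n := n) (ι := Fin 4) (S₀ := S₀)
    (stabPoly L L') (fun _ => n) (isHomogeneous_stabPoly L L')
    (fun F => F.1) (fun F => F.2.choose) (fun F => F.2.choose_spec.1), ?_⟩
  ext W'
  simp only [forall_stabPoly_iff hL]
  constructor
  · rintro ⟨v, hv, rfl⟩
    refine ⟨⟨v.1.coord, ?_, fun F => F.2.choose_spec.2 v hv, ?_⟩, Grass.comp_mem_baseFree hW _ _⟩
    · intro h0
      apply v.2
      rw [h0, det_mat]; simp
    · intro f hf
      have h1 : compLin n (mat v.1.coord) f ∈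
          pencil ((orbitMap W v).comp (mat v.1.coord) (GLCone.det_ne_zero v)).1 := by
        rw [Grass.pencil_comp]; exact ⟨f, hf, rfl⟩
      rwa [orbitMap_comp] at h1
  · rintro ⟨⟨v, hv0, hvZ, hle⟩, hW'⟩
    have hdet := det_ne_zero_of_comp_le hN hW' hv0 hle
    refine ⟨⟨⟨v⟩, hdet⟩, Cone.mem_of_isClosed hZ fun F e hF hFZ => hvZ ⟨F, e, hF, hFZ⟩, ?_⟩
    exact orbitMap_eq_iff.2 (Grass.comp_eq_of_le _ _ hle)

/-- The matrices that preserve the pencil form a homogeneous system without nonzero singular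
solutions, so its slice of determinant one is finite. -/
theorem finite_stabilizer [IsAlgClosed k] {W : Grass k n} (hW : W ∈ baseFree k n)
    (hN : NoPower W) : {v : Fin 4 → k |
      (∀ f ∈ pencil W.1, compLin n (mat v) f ∈ pencil W.1) ∧ (mat v).det = 1}.Finite := by
  obtain ⟨L, L', hL⟩ := W.exists_rep
  have h := finite_zeros_of_isHomogeneous (k := k) (ι := Fin 4)
    (S := ((Fin 2 → k) × (Fin 2 → k) × (Fin 2 → k)) × pencil W.1)
    (fun s => ∑ j, C (s.2.1 j) * stabPoly L L' s.1 j) (fun _ => n)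
    (fun s => IsHomogeneous.sum _ _ _ fun j _ => (isHomogeneous_stabPoly L L' _ j).C_mul _)
    (D := X 0 * X 3 - X 1 * X 2) (e := 2) two_ne_zero
    (((isHomogeneous_X k 0).mul (isHomogeneous_X k 3)).sub
      ((isHomogeneous_X k 1).mul (isHomogeneous_X k 2))) (by
      intro v hv hD
      by_contra hne
      refine det_ne_zero_of_comp_le hN hW hne ((forall_stabPoly_iff hL v).1 fun s f hf => ?_) ?_
      · simpa using hv ⟨s, ⟨f, hf⟩⟩
      · rw [det_mat]; simpa using hD)
  refine h.subset fun v hv => ⟨?_, ?_⟩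
  · rintro ⟨s, ⟨f, hf⟩⟩
    simpa using (forall_stabPoly_iff hL v).2 hv.1 s f hf
  · rw [← hv.2, det_mat]; simp

theorem isIrreducible_univ_GLCone_aux [Infinite k] (θ : Fin 4 → MvPolynomial (Fin 4) k)
    {Z : Set (GLCone k)} (hZ : ∀ v : GLCone k, v ∈ Z ↔ ∃ t : Fin 4 → k, ∀ i, v.1.coord i =
      eval t (θ i)) (t₀ : Fin 4 → k)
    (ht₀ : (mat fun i => eval t₀ (θ i)).det ≠ 0) : IsIrreducible Z := by
  have h : ∀ v : Fin 4 → k, eval v (X 0 * X 3 - X 1 * X 2) = (mat v).det := by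
    intro v; rw [det_mat]; simp
  refine Cone.isIrreducible_of_param θ (X 0 * X 3 - X 1 * X 2) hZ (fun t ht => ?_) ⟨t₀, ?_⟩
  · rw [h] at ht; exact ht
  · rw [h]; exact ht₀

theorem le_krullDim_of_chain {α : Type*} [Preorder α] {a b c : α} (h₁ : a < b) (h₂ : b < c) :
    (2 : WithBot ℕ∞) ≤ Order.krullDim α := by
  exact Order.LTSeries.length_le_krullDim (LTSeries.mk 2 ![a, b, c]
    (Fin.strictMono_iff_lt_succ.2 fun i => by fin_cases i; exacts [h₁, h₂]))

theorem le_krullDim_of_chain' {α : Type*} [Preorder α] {a b c d : α} (h₁ : a < b) (h₂ : b < c)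
    (h₃ : c < d) : (3 : WithBot ℕ∞) ≤ Order.krullDim α := by
  exact Order.LTSeries.length_le_krullDim (LTSeries.mk 3 ![a, b, c, d]
    (Fin.strictMono_iff_lt_succ.2 fun i => by fin_cases i; exacts [h₁, h₂, h₃]))

theorem Cone.isClosed_coord_eq_zero {ι : Type*} {Y : Set (Cone k ι)} (i : ι) :
    IsClosed {v : Y | v.1.coord i = 0} := by
  have := (Cone.isClosed_eq_zero (isHomogeneous_X k i)).preimage
    (continuous_subtype_val : Continuous (Subtype.val : Y → Cone k ι))
  simpa using this

/-- The lower bound is the chain of scalar, diagonal, upper triangular and all invertible matrices.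
The upper bound is one less than the number of entries. -/
theorem topologicalKrullDim_GLCone [Infinite k] : topologicalKrullDim (GLCone k) = 3 := by
  have hX : ∀ v ∈ GLCone k, ∀ c : k, c ≠ 0 → ⟨c • v.coord⟩ ∈ GLCone k := by
    intro v hv c hc
    have h1 : (mat (c • v.coord)).det = c ^ 2 * (mat v.coord).det := by
      simp only [det_mat, Pi.smul_apply, smul_eq_mul]; ring
    change (mat (c • v.coord)).det ≠ 0
    rw [h1]
    exact mul_ne_zero (pow_ne_zero _ hc) hv
  have hX0 : ∀ v ∈ GLCone k, ∃ i, v.coord i ≠ 0 := by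
    intro v hv
    by_contra! h0
    apply hv
    rw [det_mat]; simp [h0]
  classical
  obtain ⟨c, hc⟩ := Infinite.exists_notMem_finset ({0, 1} : Finset k)
  simp only [Finset.mem_insert, Finset.mem_singleton, not_or] at hc
  have hdiff : IsClosed {v : GLCone k | v.1.coord 0 - v.1.coord 3 = 0} := by
    have := (Cone.isClosed_eq_zero ((isHomogeneous_X k (0 : Fin 4)).sub
      (isHomogeneous_X k 3))).preimage
      (continuous_subtype_val : Continuous (Subtype.val : GLCone k → Cone k (Fin 4)))
    simpa using this
  let pt (a b c d : k) (h : a * d - b * c ≠ 0) : GLCone k :=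
    ⟨⟨![a, b, c, d]⟩, by change (mat _).det ≠ 0; rw [det_mat]; simpa using h⟩
  let Z₃ : IrreducibleCloseds (GLCone k) := ⟨Set.univ,
    isIrreducible_univ_GLCone_aux X
      (fun v => ⟨fun _ => ⟨v.1.coord, by simp⟩, fun _ => trivial⟩) ![1, 0, 0, 1]
      (by rw [det_mat]; simp), isClosed_univ⟩
  let Z₂ : IrreducibleCloseds (GLCone k) := ⟨{v | v.1.coord 2 = 0},
    isIrreducible_univ_GLCone_aux ![X 0, X 1, 0, X 3]
      (fun v => ⟨fun h => ⟨v.1.coord, by intro i; fin_cases i <;> simp [h.out]⟩,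
        fun ⟨t, ht⟩ => (ht 2).trans (by simp)⟩) ![1, 0, 0, 1]
      (by rw [det_mat]; simp), Cone.isClosed_coord_eq_zero 2⟩
  let Z₁ : IrreducibleCloseds (GLCone k) := ⟨{v | v.1.coord 2 = 0} ∩ {v | v.1.coord 1 = 0},
    isIrreducible_univ_GLCone_aux ![X 0, 0, 0, X 3]
      (fun v => ⟨fun h => ⟨v.1.coord, by intro i; fin_cases i <;> simp [h.1.out, h.2.out]⟩,
        fun ⟨t, ht⟩ => ⟨(ht 2).trans (by simp), (ht 1).trans (by simp)⟩⟩) ![1, 0, 0, 1]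
      (by rw [det_mat]; simp),
    (Cone.isClosed_coord_eq_zero 2).inter (Cone.isClosed_coord_eq_zero 1)⟩
  let Z₀ : IrreducibleCloseds (GLCone k) :=
    ⟨({v | v.1.coord 2 = 0} ∩ {v | v.1.coord 1 = 0}) ∩ {v | v.1.coord 0 - v.1.coord 3 = 0},
    isIrreducible_univ_GLCone_aux ![X 0, 0, 0, X 0]
      (fun v => ⟨fun h => ⟨v.1.coord, by
          intro i; fin_cases i <;> simp [h.1.1.out, h.1.2.out, (sub_eq_zero.1 h.2.out)]⟩,
        fun ⟨t, ht⟩ => ⟨⟨(ht 2).trans (by simp), (ht 1).trans (by simp)⟩, by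
          simp only [Set.mem_ofPred_eq, ht]; simp⟩⟩) ![1, 0, 0, 1]
      (by rw [det_mat]; simp),
    ((Cone.isClosed_coord_eq_zero 2).inter (Cone.isClosed_coord_eq_zero 1)).inter hdiff⟩
  have h01 : Z₀ < Z₁ := by
    refine ⟨fun v hv => hv.1, fun h => ?_⟩
    have : pt 1 0 0 c (by simpa using hc.1) ∈ (Z₀ : Set (GLCone k)) :=
      h ⟨by simp [pt], by simp [pt]⟩
    have h' : (1 : k) - c = 0 := this.2
    exact hc.2 (sub_eq_zero.1 h').symm
  have h12 : Z₁ < Z₂ := by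
    refine ⟨fun v hv => hv.1, fun h => ?_⟩
    have : pt 1 1 0 1 (by simp) ∈ (Z₁ : Set (GLCone k)) :=
      h (show (0 : k) = 0 from rfl)
    exact one_ne_zero (show (1 : k) = 0 from this.2)
  have h23 : Z₂ < Z₃ := by
    refine ⟨fun v _ => trivial, fun h => ?_⟩
    have : pt 1 0 1 1 (by simp) ∈ (Z₂ : Set (GLCone k)) := h trivial
    exact one_ne_zero (show (1 : k) = 0 from this)
  refine le_antisymm ?_ (le_krullDim_of_chain' h01 h12 h23)
  have : Nonempty (IrreducibleCloseds (GLCone k)) := ⟨Z₀⟩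
  have h := Cone.krullDim_add_one_le hX hX0
  rw [Fintype.card_fin] at h
  exact ENat.WithBot.add_le_add_one_right_iff.1 h

/-- Right multiplication by an invertible matrix. -/
def GLCone.mulRight (N : Matrix (Fin 2) (Fin 2) k) (hN : N.det ≠ 0) (v : GLCone k) : GLCone k :=
  ⟨⟨![v.1.coord 0 * N 0 0 + v.1.coord 1 * N 1 0, v.1.coord 0 * N 0 1 + v.1.coord 1 * N 1 1,
    v.1.coord 2 * N 0 0 + v.1.coord 3 * N 1 0, v.1.coord 2 * N 0 1 + v.1.coord 3 * N 1 1]⟩, by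
    change (mat _).det ≠ 0
    have h : v.1.coord 0 * v.1.coord 3 - v.1.coord 1 * v.1.coord 2 ≠ 0 := by
      rw [← det_mat]; exact v.2
    have : N.det * (v.1.coord 0 * v.1.coord 3 - v.1.coord 1 * v.1.coord 2) ≠ 0 := mul_ne_zero hN h
    convert this using 1
    rw [det_mat, Matrix.det_fin_two]
    simp
    ring⟩

theorem GLCone.mat_mulRight (N : Matrix (Fin 2) (Fin 2) k) (hN : N.det ≠ 0) (v : GLCone k) :
    mat (GLCone.mulRight N hN v).1.coord = mat v.1.coord * N := by
  ext i j; fin_cases i <;> fin_cases j <;>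
    simp [mat, GLCone.mulRight, Matrix.mul_apply, Fin.sum_univ_two]

theorem GLCone.ext_mat {v w : GLCone k} (h : mat v.1.coord = mat w.1.coord) : v = w := by
  obtain ⟨⟨v⟩, _⟩ := v
  obtain ⟨⟨w⟩, _⟩ := w
  have : v = w := by
    ext i; fin_cases i
    · exact congrFun (congrFun h 0) 0
    · exact congrFun (congrFun h 0) 1
    · exact congrFun (congrFun h 1) 0
    · exact congrFun (congrFun h 1) 1
  subst this; rfl

theorem GLCone.continuous_mulRight (N : Matrix (Fin 2) (Fin 2) k) (hN : N.det ≠ 0) :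
    Continuous (GLCone.mulRight N hN) := by
  refine Cone.continuous_to_cone _ (d := 1) ![C (N 0 0) * X 0 + C (N 1 0) * X 1,
    C (N 0 1) * X 0 + C (N 1 1) * X 1, C (N 0 0) * X 2 + C (N 1 0) * X 3,
    C (N 0 1) * X 2 + C (N 1 1) * X 3] (fun i => ?_) fun v i => ?_
  · fin_cases i <;> exact isHomogeneous_linear _ _ _ _
  · fin_cases i <;> simp [GLCone.mulRight, mul_comm]

/-- Right multiplication by an invertible matrix, as a homeomorphism. -/
def GLCone.mulRightHomeo (N : Matrix (Fin 2) (Fin 2) k) (hN : N.det ≠ 0) :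
    GLCone k ≃ₜ GLCone k where
  toFun := GLCone.mulRight N hN
  invFun := GLCone.mulRight N⁻¹ (by
    rw [Matrix.det_nonsing_inv, Ring.inverse_eq_inv']; exact inv_ne_zero hN)
  left_inv v := GLCone.ext_mat (by
    rw [GLCone.mat_mulRight, GLCone.mat_mulRight, Matrix.mul_assoc,
      Matrix.mul_nonsing_inv _ (isUnit_iff_ne_zero.2 hN), Matrix.mul_one])
  right_inv v := GLCone.ext_mat (by
    rw [GLCone.mat_mulRight, GLCone.mat_mulRight, Matrix.mul_assoc,
      Matrix.nonsing_inv_mul _ (isUnit_iff_ne_zero.2 hN), Matrix.mul_one])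
  continuous_toFun := GLCone.continuous_mulRight N hN
  continuous_invFun := GLCone.continuous_mulRight _ _

/-- Two matrices with the same image differ by an element of the stabilizer. Division by a square
root of its determinant puts it into the finite set of stabilizing matrices of determinant one, at
the cost of a scalar that the topology does not see. -/
theorem exists_inseparable_of_orbitMap_eq [IsAlgClosed k] {W : Grass k n} {v v' : GLCone k}
    (h : orbitMap W v = orbitMap W v') :
    ∃ (w : Fin 4 → k) (hw : (mat w).det = 1),
      (∀ f ∈ pencil W.1, compLin n (mat w) f ∈ pencil W.1) ∧
      Inseparable v' (GLCone.mulRightHomeo (mat w) (by rw [hw]; exact one_ne_zero) v) := by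
  set M := mat v.1.coord with hM
  set M' := mat v'.1.coord with hM'
  have hMd : M.det ≠ 0 := v.2
  have hMd' : M'.det ≠ 0 := v'.2
  set N := M.adjugate * M' with hN
  have hNd : N.det ≠ 0 := by
    rw [hN, Matrix.det_mul]; exact mul_ne_zero (det_adjugate_ne_zero hMd) hMd'
  have hstab : W.comp N hNd = W := by
    have h1 := orbitMap_comp W v'
    rw [← h] at h1
    exact (Grass.comp_comp _ _ _ _ _).symm.trans h1
  obtain ⟨s, hs⟩ := IsAlgClosed.exists_pow_nat_eq N.det (n := 2) two_pos
  have hs0 : s ≠ 0 := by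
    rintro rfl
    exact hNd (by simpa using hs.symm)
  obtain ⟨w, hw⟩ : ∃ w, mat w = s⁻¹ • N := ⟨_, mat_eta _⟩
  have hw1 : (mat w).det = 1 := by
    rw [hw, Matrix.det_smul, Fintype.card_fin, ← hs]; field_simp
  refine ⟨w, hw1, ?_, ?_⟩
  · intro f hf
    rw [hw]
    have h2 : compLin n N f ∈ pencil (W.comp N hNd).1 := by
      rw [Grass.pencil_comp]; exact ⟨f, hf, rfl⟩
    rw [hstab] at h2
    have h3 : s⁻¹ • N = N * (s⁻¹ • (1 : Matrix (Fin 2) (Fin 2) k)) := by simp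
    rw [h3, ← compLin_mul, compLin_smul_one]
    exact Submodule.smul_mem _ _ h2
  · have h4 : ∀ (N' : Matrix (Fin 2) (Fin 2) k) (hN' : N'.det ≠ 0), N' = s⁻¹ • N → ∀ i,
        (GLCone.mulRight N' hN' v).1.coord i = s⁻¹ * M.det * v'.1.coord i := by
      intro N' hN' h i
      have h5 : mat (GLCone.mulRight N' hN' v).1.coord = (s⁻¹ * M.det) • M' := by
        rw [GLCone.mat_mulRight, ← hM, h, hN, Matrix.mul_smul, ← Matrix.mul_assoc,
          Matrix.mul_adjugate, Matrix.smul_mul, Matrix.one_mul, smul_smul]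
      fin_cases i
      · exact congrFun (congrFun h5 0) 0
      · exact congrFun (congrFun h5 0) 1
      · exact congrFun (congrFun h5 1) 0
      · exact congrFun (congrFun h5 1) 1
    exact (Cone.inseparable (c := s⁻¹ * M.det) (mul_ne_zero (inv_ne_zero hs0) hMd)
      (h4 _ (by rw [hw1]; exact one_ne_zero) hw)).symm

/-- A finite union of orbits of base point free pencils without powers of linear forms is locally
closed of dimension `3`. -/
theorem isLocallyClosedOfDim_orbits [IsAlgClosed k] {ι : Type*} [Finite ι] [Nonempty ι]
    (W : ι → Grass k n) (hW : ∀ i, W i ∈ baseFree k n) (hN : ∀ i, NoPower (W i)) :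
    IsLocallyClosedOfDim (⋃ i, Set.range (orbitMap (W i))) 3 := by
  let i₀ : ι := Classical.arbitrary ι
  have hfin := (finite_stabilizer (hW i₀) (hN i₀)).to_subtype
  refine isLocallyClosedOfDim_iUnion_range (isOpen_baseFree n) (fun i => orbitMap (W i))
    (fun i => continuous_orbitMap (W i)) (fun i Z hZ => image_orbitMap_eq (hW i) (hN i) hZ) i₀
    (fun w : {v : Fin 4 → k | (∀ f ∈ pencil (W i₀).1, compLin n (mat v) f ∈ pencil (W i₀).1) ∧
      (mat v).det = 1} => GLCone.mulRightHomeo (mat w.1) (by rw [w.2.2]; exact one_ne_zero))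
    (fun v v' h => ?_) topologicalKrullDim_GLCone
  obtain ⟨w, hw, hstab, hins⟩ := exists_inseparable_of_orbitMap_eq h
  exact ⟨⟨w, hstab, hw⟩, hins⟩

end RationalNormal

end

/-! ### The family 𝒟 as a single orbit -/

noncomputable section

namespace RationalNormal

variable {k : Type*} [Field k] {n : ℕ}

theorem evalForm_formL (n : ℕ) (a c : k) (u : Fin 2 → k) :
    evalForm n (formL n a c) u = (c * u 0 - a * u 1) ^ n := by
  rw [evalForm_apply, sub_eq_neg_add, add_pow, ← Fin.sum_univ_eq_sum_range
    (fun i => (-(a * u 1)) ^ i * (c * u 0) ^ (n - i) * (n.choose i : k))]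
  refine Finset.sum_congr rfl fun i _ => ?_
  rw [formL, neg_eq_neg_one_mul (a * u 1), mul_pow (-1), mul_pow, mul_pow]
  ring

/-- The definition of `formA` is the trinomial expansion of the power of the product; a term with
exponents (i, j, l) contributes to x_{i+2l}. -/
theorem evalForm_formA (m : ℕ) (a b c d : k) (u : Fin 2 → k) :
    evalForm (2 * m) (formA m a b c d) u =
      ((a * u 0 - c * u 1) * (b * u 0 - d * u 1)) ^ m := by
  have h : (a * u 0 - c * u 1) * (b * u 0 - d * u 1) =
      ∑ i : Fin 3, ![-((a * d + b * c) * u 0 * u 1), a * b * u 0 ^ 2, c * d * u 1 ^ 2] i := by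
    simp [Fin.sum_univ_three]; ring
  rw [h, Finset.sum_pow_eq_sum_piAntidiag, evalForm_apply]
  simp only [formA, Finset.sum_filter, Finset.sum_mul]
  rw [Finset.sum_comm]
  refine Finset.sum_congr rfl fun s hs => ?_
  have hs' : s 0 + s 1 + s 2 = m := by
    rw [Finset.mem_piAntidiag, Fin.sum_univ_three] at hs
    exact hs.1
  rw [Finset.sum_eq_single_of_mem (⟨s 0 + 2 * s 2, by omega⟩ : Fin (2 * m + 1)) (mem_univ _)]
  · have h1 : 2 * m - (s 0 + 2 * s 2) = s 0 + 2 * s 1 := by omega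
    simp only [if_true, h1, Fin.prod_univ_three]
    simp only [Matrix.cons_val_zero, Matrix.cons_val_one, Matrix.cons_val]
    rw [neg_eq_neg_one_mul (_ * u 1), mul_pow (-1 : k), mul_pow _ (u 1), mul_pow _ (u 0)]
    ring
  · intro r _ hr
    rw [if_neg, zero_mul]
    exact fun h => hr (Fin.ext h.symm)

theorem evalForm_formB (m : ℕ) (α a b c d : k) (u : Fin 2 → k) :
    evalForm (2 * m) (formB m α a b c d) u =
      α ^ m * (a * u 0 - c * u 1) ^ (2 * m) + (b * u 0 - d * u 1) ^ (2 * m) := by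
  have h : formB m α a b c d = α ^ m • formL (2 * m) c a + formL (2 * m) d b := by
    ext i
    simp only [formB, formL, Pi.add_apply, Pi.smul_apply, smul_eq_mul]
    ring
  rw [h, map_add, map_smul, Pi.add_apply, Pi.smul_apply, evalForm_formL, evalForm_formL,
    smul_eq_mul]

theorem evalForm_single (i : Fin (n + 1)) (u : Fin 2 → k) :
    evalForm n (Pi.single i 1) u = u 0 ^ (n - (i : ℕ)) * u 1 ^ (i : ℕ) := by
  rw [evalForm_apply, Finset.sum_eq_single_of_mem i (mem_univ _)]
  · simp
  · intro j _ hj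
    simp [hj]

/-- The form `x ^ m * y ^ m`. -/
def middleForm (k : Type*) [Field k] (m : ℕ) : Fin (2 * m + 1) → k :=
  Pi.single ⟨m, by omega⟩ 1

/-- The form `x ^ n + y ^ n`. -/
def endForm (k : Type*) [Field k] (n : ℕ) : Fin (n + 1) → k :=
  Pi.single 0 1 + Pi.single (Fin.last n) 1

theorem evalForm_middleForm (m : ℕ) (u : Fin 2 → k) :
    evalForm (2 * m) (middleForm k m) u = (u 0 * u 1) ^ m := by
  rw [middleForm, evalForm_single, mul_pow]
  simp only
  congr 2
  omega

theorem evalForm_endForm (u : Fin 2 → k) : evalForm n (endForm k n) u = u 0 ^ n + u 1 ^ n := by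
  rw [endForm, map_add, Pi.add_apply, evalForm_single, evalForm_single]
  simp

theorem linearIndependent_middleForm {m : ℕ} (hm : 1 ≤ m) :
    LinearIndependent k ![middleForm k m, endForm k (2 * m)] := by
  rw [LinearIndependent.pair_iff]
  intro s t h
  have h0 := congrFun h 0
  have hm' := congrFun h ⟨m, by omega⟩
  have e1 : (0 : Fin (2 * m + 1)) ≠ ⟨m, by omega⟩ := fun h => by
    have := congrArg Fin.val h; simp at this; omega
  have e2 : (0 : Fin (2 * m + 1)) ≠ Fin.last (2 * m) := fun h => by
    have := congrArg Fin.val h; simp at this; omega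
  have e3 : (⟨m, by omega⟩ : Fin (2 * m + 1)) ≠ Fin.last (2 * m) := fun h => by
    have := congrArg Fin.val h; simp at this; omega
  have ht : t = 0 := by
    simpa [middleForm, endForm, Pi.single_apply, e1, e2] using h0
  subst ht
  simpa [middleForm, endForm, Pi.single_apply] using hm'

/-- The subspace `{x ^ m * y ^ m = x ^ (2 * m) + y ^ (2 * m) = 0}`. -/
def dihedralSpace (k : Type*) [Field k] {m : ℕ} (hm : 1 ≤ m) : Grass k (2 * m) :=
  Grass.mk _ _ (linearIndependent_middleForm (k := k) hm)

theorem mem_pencil_dihedralSpace {m : ℕ} (hm : 1 ≤ m) {f : Fin (2 * m + 1) → k} :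
    f ∈ pencil (dihedralSpace k hm).1 ↔
      ∃ s t : k, s • middleForm k m + t • endForm k (2 * m) = f := by
  rw [← Submodule.mem_span_pair, ← pencil_zeroSpace]
  rfl

theorem dihedralSpace_mem_baseFree {m : ℕ} (hm : 1 ≤ m) :
    dihedralSpace k hm ∈ baseFree k (2 * m) := by
  intro u hu
  by_cases h : u 0 * u 1 = 0
  · refine ⟨_, (mem_pencil_dihedralSpace hm).2 ⟨0, 1, rfl⟩, ?_⟩
    rw [zero_smul, one_smul, zero_add, evalForm_endForm]
    have h2 : 2 * m ≠ 0 := by omega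
    rcases mul_eq_zero.1 h with h | h
    · have h1 : u 1 ≠ 0 := fun h1 => hu (by ext i; fin_cases i <;> assumption)
      simp [h, h1, h2]
    · have h1 : u 0 ≠ 0 := fun h1 => hu (by ext i; fin_cases i <;> assumption)
      simp [h, h1, h2]
  · refine ⟨_, (mem_pencil_dihedralSpace hm).2 ⟨1, 0, rfl⟩, ?_⟩
    rw [zero_smul, one_smul, add_zero, evalForm_middleForm]
    exact pow_ne_zero _ h

/-- Since `2 ≤ m`, forms of this pencil have no term x^(2m-1) y, whereas a power (ax + by)^(2m) has
coefficient 2m a^(2m-1) b there. So a or b is zero; the two end coefficients agree, so both are. -/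
theorem noPower_dihedralSpace [Infinite k] {m : ℕ} (hm : 1 ≤ m) (hm2 : 2 ≤ m)
    (hk : ((2 * m : ℕ) : k) ≠ 0) : NoPower (dihedralSpace k hm) := by
  intro f hf a b hab h
  obtain ⟨s, t, rfl⟩ := (mem_pencil_dihedralSpace hm).1 hf
  have h1 : s • middleForm k m + t • endForm k (2 * m) = formL (2 * m) (-b) a :=
    evalForm_injective (funext fun u => by rw [h, evalForm_formL]; ring)
  have c0 := congrFun h1 0
  have c1 := congrFun h1 ⟨1, by omega⟩
  have c2 := congrFun h1 (Fin.last _)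
  have e1 : (0 : Fin (2 * m + 1)) ≠ ⟨m, by omega⟩ := fun h => by
    have := congrArg Fin.val h; simp at this; omega
  have e2 : (0 : Fin (2 * m + 1)) ≠ Fin.last (2 * m) := fun h => by
    have := congrArg Fin.val h; simp at this; omega
  have e3 : Fin.last (2 * m) ≠ (⟨m, by omega⟩ : Fin (2 * m + 1)) := fun h => by
    have := congrArg Fin.val h; simp at this; omega
  have e4 : (⟨1, by omega⟩ : Fin (2 * m + 1)) ≠ ⟨m, by omega⟩ := fun h => by
    have := congrArg Fin.val h; simp at this; omega
  have e5 : (⟨1, by omega⟩ : Fin (2 * m + 1)) ≠ Fin.last (2 * m) := fun h => by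
    have := congrArg Fin.val h; simp at this; omega
  have e6 : (⟨1, by omega⟩ : Fin (2 * m + 1)) ≠ 0 := fun h => by
    have := congrArg Fin.val h; simp at this
  simp [middleForm, endForm, e1, e2, e3, e4, e5, e6, e2.symm, formL] at c0 c1 c2
  have h2 : 2 * m ≠ 0 := by omega
  have h3 : 2 * m - 1 ≠ 0 := by omega
  push_cast at hk
  have hk' : (2 : k) ≠ 0 ∧ (m : k) ≠ 0 := mul_ne_zero_iff.1 hk
  rw [c0] at c2
  rcases c1 with h | h
  · rcases h with h | h
    · exact absurd h (by simpa [not_or] using hk')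
    · simp [h, h2] at c2
      exact hab (by simp [h, c2])
  · rw [h.1, zero_pow h2, eq_comm] at c2
    exact hab (by simp [h.1, pow_eq_zero_iff h2 |>.1 c2])

theorem familyD_eq_range [IsAlgClosed k] {m : ℕ} (hm : 1 ≤ m) :
    familyD k m = Set.range (orbitMap (dihedralSpace k hm)) := by
  ext W
  rw [mem_range_orbitMap]
  have hz : (dihedralSpace k hm).1 = zeroSpace (middleForm k m) (endForm k (2 * m)) := rfl
  constructor
  · rintro ⟨α, a, b, c, d, hα, hd, hW⟩
    -- Substituting x ↦ β(ax - cy), y ↦ bx - dy produces the coefficient β^(2m) = α^m of `formB`,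
    -- and multiplies the middle form only by the irrelevant factor β^m.
    obtain ⟨β, hβ⟩ := IsAlgClosed.exists_pow_nat_eq α (n := 2) (by norm_num)
    have hβ0 : β ≠ 0 := by rintro rfl; simp at hβ; exact hα hβ.symm
    have hM : (!![β * a, -(β * c); b, -d]).det ≠ 0 := by
      rw [Matrix.det_fin_two_of]
      intro h
      exact mul_ne_zero hβ0 hd (by linear_combination -h)
    refine ⟨_, hM, Subtype.ext ?_⟩
    rw [hW, Grass.comp_eq_zeroSpace hz]
    have h1 : compLin (2 * m) !![β * a, -(β * c); b, -d] (middleForm k m) =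
        β ^ m • formA m a b c d := by
      refine evalForm_injective (funext fun u => ?_)
      rw [evalForm_compLin, evalForm_middleForm, map_smul, Pi.smul_apply, evalForm_formA,
        smul_eq_mul, ← mul_pow]
      simp [Matrix.mulVec, dotProduct, Fin.sum_univ_two]
      ring
    have h2 : compLin (2 * m) !![β * a, -(β * c); b, -d] (endForm k (2 * m)) =
        formB m α a b c d := by
      refine evalForm_injective (funext fun u => ?_)
      rw [evalForm_compLin, evalForm_endForm, evalForm_formB, ← hβ, ← pow_mul, ← mul_pow]
      simp [Matrix.mulVec, dotProduct, Fin.sum_univ_two]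
      ring
    rw [h1, h2]
    apply zeroSpace_eq_of_span_eq
    rw [Submodule.span_insert, Submodule.span_insert,
      Submodule.span_singleton_smul_eq (isUnit_iff_ne_zero.2 (pow_ne_zero m hβ0))]
  · rintro ⟨M, hM, rfl⟩
    refine ⟨1, M 0 0, M 1 0, -M 0 1, -M 1 1, one_ne_zero, ?_, ?_⟩
    · rw [Matrix.det_fin_two] at hM
      exact fun h => hM (by linear_combination -h)
    · rw [Grass.comp_eq_zeroSpace hz]
      congr 1
      · refine evalForm_injective (funext fun u => ?_)
        rw [evalForm_compLin, evalForm_middleForm, evalForm_formA]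
        simp [Matrix.mulVec, dotProduct, Fin.sum_univ_two]
      · refine evalForm_injective (funext fun u => ?_)
        rw [evalForm_compLin, evalForm_endForm, evalForm_formB]
        simp [Matrix.mulVec, dotProduct, Fin.sum_univ_two]

theorem isLocallyClosedOfDim_familyD [IsAlgClosed k] {m : ℕ} (hm : 3 ≤ m)
    (hk : ((2 * m : ℕ) : k) ≠ 0) : IsLocallyClosedOfDim (familyD k m) 3 := by
  have hm1 : 1 ≤ m := by omega
  rw [familyD_eq_range hm1]
  have h := isLocallyClosedOfDim_orbits (fun _ : Unit => dihedralSpace k hm1)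
    (fun _ => dihedralSpace_mem_baseFree hm1) fun _ => noPower_dihedralSpace hm1 (by omega) hk
  rwa [Set.iUnion_const] at h

end RationalNormal

end

/-! ### Pencils spanned by two powers of linear forms -/

noncomputable section

namespace RationalNormal

open TopologicalSpace MvPolynomial

variable {k : Type*} [Field k] {n : ℕ}

/-- The `n`-th power of the linear form with coefficients `r`. -/
def powForm (n : ℕ) (r : Fin 2 → k) : Fin (n + 1) → k := formL n (-r 1) (r 0)

theorem evalForm_powForm (r u : Fin 2 → k) :
    evalForm n (powForm n r) u = (r 0 * u 0 + r 1 * u 1) ^ n := by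
  rw [powForm, evalForm_formL]; ring

theorem formL_eq_powForm (a c : k) : formL n a c = powForm n ![c, -a] := by
  simp [powForm]

theorem powForm_smul (c : k) (r : Fin 2 → k) : powForm n (c • r) = c ^ n • powForm n r := by
  ext i
  simp only [powForm, formL, Pi.smul_apply, smul_eq_mul]
  have h : c ^ n = c ^ (i : ℕ) * c ^ (n - (i : ℕ)) := by
    rw [← pow_add]; congr 1; have := i.2; omega
  rw [h, mul_pow, neg_eq_neg_one_mul (c * r 1), neg_eq_neg_one_mul (r 1), mul_pow, mul_pow, mul_pow]
  ring

theorem powForm_zero (hn : n ≠ 0) : powForm n (0 : Fin 2 → k) = 0 := by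
  have := powForm_smul (n := n) (0 : k) 0
  rwa [zero_smul, zero_pow hn, zero_smul] at this

theorem linearIndependent_powForm (hn : n ≠ 0) {r s : Fin 2 → k} (h : bracket r s ≠ 0) :
    LinearIndependent k ![powForm n r, powForm n s] := by
  rw [bracket] at h
  rw [LinearIndependent.pair_iff]
  intro x y hxy
  have h1 : ∀ u : Fin 2 → k, x * (r 0 * u 0 + r 1 * u 1) ^ n + y * (s 0 * u 0 + s 1 * u 1) ^ n = 0 := by
    intro u
    have := congrFun (congrArg (evalForm n) hxy) u
    simpa [evalForm_powForm] using this
  constructor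
  · have h2 := h1 ![s 1, -s 0]
    simp only [Matrix.cons_val_zero, Matrix.cons_val_one] at h2
    rw [show s 0 * s 1 + s 1 * -s 0 = 0 by ring, zero_pow hn, mul_zero, add_zero,
      show r 0 * s 1 + r 1 * -s 0 = r 0 * s 1 - r 1 * s 0 by ring] at h2
    exact (mul_eq_zero.1 h2).resolve_right (pow_ne_zero _ h)
  · have h2 := h1 ![-r 1, r 0]
    simp only [Matrix.cons_val_zero, Matrix.cons_val_one] at h2
    rw [show r 0 * -r 1 + r 1 * r 0 = 0 by ring, zero_pow hn, mul_zero, zero_add,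
      show s 0 * -r 1 + s 1 * r 0 = r 0 * s 1 - r 1 * s 0 by ring] at h2
    exact (mul_eq_zero.1 h2).resolve_right (pow_ne_zero _ h)

theorem plucker_powForm_eq_zero (hn : n ≠ 0) {r s : Fin 2 → k} (h : bracket r s = 0) :
    plucker (powForm n r) (powForm n s) = 0 := by
  by_cases hr : r = 0
  · ext p; simp [hr, powForm_zero hn, plucker]
  · obtain ⟨c, rfl⟩ := (bracket_eq_zero_iff hr).1 h
    ext p
    simp only [plucker, powForm_smul, Pi.smul_apply, smul_eq_mul, Pi.zero_apply]
    ring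

/-- The subspace whose pencil is spanned by the powers of two linear forms. -/
def powerSpace (hn : n ≠ 0) (r s : Fin 2 → k) (h : bracket r s ≠ 0) : Grass k n :=
  Grass.mk _ _ (linearIndependent_powForm hn h)

theorem pencil_powerSpace (hn : n ≠ 0) {r s : Fin 2 → k} (h : bracket r s ≠ 0) :
    pencil (powerSpace hn r s h).1 = Submodule.span k {powForm n r, powForm n s} :=
  pencil_zeroSpace _ _

theorem mem_familyC_iff (hn : n ≠ 0) {W : Grass k n} :
    W ∈ familyC k n ↔ ∃ r s h, W = powerSpace hn r s h := by
  constructor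
  · rintro ⟨a, b, c, d, h, hW⟩
    refine ⟨![c, -a], ![d, -b], ?_, Subtype.ext ?_⟩
    · simp only [bracket, Matrix.cons_val_zero, Matrix.cons_val_one]
      exact fun h0 => h (by linear_combination h0)
    · rw [hW, formL_eq_powForm, formL_eq_powForm]; rfl
  · rintro ⟨r, s, h, rfl⟩
    refine ⟨-r 1, -s 1, r 0, s 0, ?_, rfl⟩
    rw [bracket] at h
    exact fun h0 => h (by linear_combination h0)

theorem powerSpace_mem_baseFree (hn : n ≠ 0) {r s : Fin 2 → k} (h : bracket r s ≠ 0) :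
    powerSpace hn r s h ∈ baseFree k n := by
  intro u hu
  by_contra! h0
  rw [pencil_powerSpace] at h0
  have h1 := h0 _ (Submodule.subset_span (Set.mem_insert _ _))
  have h2 := h0 _ (Submodule.subset_span (Set.mem_insert_of_mem _ (Set.mem_singleton _)))
  rw [evalForm_powForm, pow_eq_zero_iff hn] at h1 h2
  rw [bracket] at h
  have e0 : (r 0 * s 1 - r 1 * s 0) * u 0 = 0 := by linear_combination s 1 * h1 - r 1 * h2
  have e1 : (r 0 * s 1 - r 1 * s 0) * u 1 = 0 := by linear_combination -s 0 * h1 + r 0 * h2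
  refine hu (funext fun i => ?_)
  fin_cases i
  · exact (mul_eq_zero.1 e0).resolve_left h
  · exact (mul_eq_zero.1 e1).resolve_left h

theorem compLin_diag [Infinite k] (x y : k) (g : Fin (n + 1) → k) (i : Fin (n + 1)) :
    compLin n !![x, 0; 0, y] g i = x ^ (n - (i : ℕ)) * y ^ (i : ℕ) * g i := by
  have h : compLin n !![x, 0; 0, y] g = fun i : Fin (n + 1) => x ^ (n - (i : ℕ)) * y ^ (i : ℕ) * g i := by
    refine evalForm_injective (funext fun u => ?_)
    rw [evalForm_compLin, evalForm_apply, evalForm_apply]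
    refine Finset.sum_congr rfl fun i _ => ?_
    simp [Matrix.mulVec, dotProduct, Fin.sum_univ_two, mul_pow]
    ring
  exact congrFun h i

theorem vecMul_eq {r w : Fin 2 → k} {M : Matrix (Fin 2) (Fin 2) k} (h : Matrix.vecMul r M = w)
    (u : Fin 2 → k) : r 0 * M.mulVec u 0 + r 1 * M.mulVec u 1 = w 0 * u 0 + w 1 * u 1 := by
  rw [← h]
  simp [Matrix.vecMul, Matrix.mulVec, dotProduct, Fin.sum_univ_two]
  ring

/-- A form invariant under an operator of order `n` is a combination of the powers of the two
eigenforms. -/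
theorem mem_span_powForm [Infinite k] (hn : n ≠ 0) {ζ : k} (hζ : IsPrimitiveRoot ζ n)
    {r s : Fin 2 → k} (h : bracket r s ≠ 0) {M : Matrix (Fin 2) (Fin 2) k} {τ : k} (hτ : τ ≠ 0)
    (hr : Matrix.vecMul r M = τ • r) (hs : Matrix.vecMul s M = (ζ * τ) • s)
    {f : Fin (n + 1) → k} (hf : compLin n M f = τ ^ n • f) :
    f ∈ Submodule.span k {powForm n r, powForm n s} := by
  -- In the coordinates given by the two eigenforms, the operator is diagonal and multiplies x^(n-i)
  -- y^i by τ^n ζ^i. Since ζ is primitive, an invariant form involves only i = 0 and i = n.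
  let T : Matrix (Fin 2) (Fin 2) k := !![r 0, r 1; s 0, s 1]
  have hT : T.det ≠ 0 := by rw [Matrix.det_fin_two_of]; exact h
  set g := compLin n T⁻¹ f with hg
  have hfg : f = compLin n T g := by
    rw [hg, compLin_mul, Matrix.nonsing_inv_mul _ (isUnit_iff_ne_zero.2 hT)]
    simpa using (compLin_smul_one (n := n) (1 : k) f).symm
  have hcomm : T * M = !![τ, 0; 0, ζ * τ] * T := by
    have r0 := congrFun hr 0
    have r1 := congrFun hr 1
    have s0 := congrFun hs 0
    have s1 := congrFun hs 1
    simp only [Matrix.vecMul, dotProduct, Fin.sum_univ_two, Pi.smul_apply, smul_eq_mul] at r0 r1 s0 s1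
    ext i j; fin_cases i <;> fin_cases j <;>
      simp [T, Matrix.mul_apply, Fin.sum_univ_two, r0, r1, s0, s1]
  have hgi : compLin n !![τ, 0; 0, ζ * τ] g = τ ^ n • g := by
    apply compLin_injective hT
    rw [compLin_mul, ← hcomm, ← compLin_mul, ← hfg, hf, map_smul, ← hfg]
  have hz : ∀ i : Fin (n + 1), i ≠ 0 → i ≠ Fin.last n → g i = 0 := by
    intro i h0 hl
    have h1 := congrFun hgi i
    rw [compLin_diag, mul_pow, Pi.smul_apply, smul_eq_mul] at h1
    have h2 : τ ^ n = τ ^ (n - (i : ℕ)) * τ ^ (i : ℕ) := by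
      rw [← pow_add]; congr 1; have := i.2; omega
    have h3 : τ ^ n * ((ζ ^ (i : ℕ) - 1) * g i) = 0 := by
      rw [h2] at h1 ⊢; linear_combination h1
    refine (mul_eq_zero.1 ((mul_eq_zero.1 h3).resolve_left (pow_ne_zero _ hτ))).resolve_left ?_
    refine sub_ne_zero.2 ?_
    refine hζ.pow_ne_one_of_pos_of_lt (fun h => h0 (Fin.ext h)) ?_
    have := i.2
    have : (i : ℕ) ≠ n := fun h => hl (Fin.ext h)
    omega
  rw [Submodule.mem_span_pair]
  refine ⟨g 0, g (Fin.last n), ?_⟩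
  have hg2 : g = g 0 • Pi.single 0 1 + g (Fin.last n) • Pi.single (Fin.last n) 1 := by
    have hne : (0 : Fin (n + 1)) ≠ Fin.last n := fun h => hn (congrArg Fin.val h).symm
    ext i
    by_cases h0 : i = 0
    · subst h0; simp [hne]
    · by_cases hl : i = Fin.last n
      · subst hl; simp [hne.symm]
      · simp [h0, hl, hz i h0 hl]
  rw [hfg]
  refine evalForm_injective (funext fun u => ?_)
  conv_rhs => rw [hg2]
  simp only [map_add, map_smul, Pi.add_apply, Pi.smul_apply, evalForm_compLin, evalForm_single,
    evalForm_powForm, smul_eq_mul]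
  simp [T, Matrix.mulVec, dotProduct, Fin.sum_univ_two]

/-- A power of a linear form is a combination of two such powers only in the obvious cases. -/
theorem bracket_eq_zero_of_powForm_mem [Infinite k] (hn : 2 ≤ n) (hk : (n : k) ≠ 0)
    {r s t : Fin 2 → k} (h : bracket r s ≠ 0)
    (ht : powForm n t ∈ Submodule.span k {powForm n r, powForm n s}) :
    bracket r t = 0 ∨ bracket s t = 0 := by
  obtain ⟨x, y, hxy⟩ := Submodule.mem_span_pair.1 ht
  set δ := bracket r s with hδ
  -- Taking r and s as coordinates, t becomes a linear form whose power is a combination of x^n and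
  -- y^n. Since n ≠ 0 in k, the coefficient of x^(n-1) y forces one of its two coefficients to
  -- vanish.
  have h1 : formL n (-(bracket r t / δ)) (-(bracket s t / δ)) =
      x • Pi.single 0 1 + y • Pi.single (Fin.last n) 1 := by
    refine evalForm_injective (funext fun u => ?_)
    have h2 := congrFun (congrArg (evalForm n) hxy)
      ![(s 1 * u 0 - r 1 * u 1) / δ, (-s 0 * u 0 + r 0 * u 1) / δ]
    simp only [map_add, map_smul, Pi.add_apply, Pi.smul_apply, smul_eq_mul, evalForm_powForm,
      Matrix.cons_val_zero, Matrix.cons_val_one] at h2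
    simp only [map_add, map_smul, Pi.add_apply, Pi.smul_apply, smul_eq_mul, evalForm_single,
      evalForm_formL]
    have e1 : r 0 * ((s 1 * u 0 - r 1 * u 1) / δ) + r 1 * ((-s 0 * u 0 + r 0 * u 1) / δ) = u 0 := by
      rw [mul_div_assoc', mul_div_assoc', ← add_div, div_eq_iff h, hδ, bracket]; ring
    have e2 : s 0 * ((s 1 * u 0 - r 1 * u 1) / δ) + s 1 * ((-s 0 * u 0 + r 0 * u 1) / δ) = u 1 := by
      rw [mul_div_assoc', mul_div_assoc', ← add_div, div_eq_iff h, hδ, bracket]; ring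
    have e3 : t 0 * ((s 1 * u 0 - r 1 * u 1) / δ) + t 1 * ((-s 0 * u 0 + r 0 * u 1) / δ) =
        -(bracket s t / δ) * u 0 - -(bracket r t / δ) * u 1 := by
      simp only [bracket]; field_simp; ring
    rw [e1, e2, e3] at h2
    rw [← h2]
    simp
  have h3 := congrFun h1 ⟨1, by omega⟩
  have e4 : (⟨1, by omega⟩ : Fin (n + 1)) ≠ 0 := fun h => by
    have := congrArg Fin.val h; simp at this
  have e5 : (⟨1, by omega⟩ : Fin (n + 1)) ≠ Fin.last n := fun h => by
    have := congrArg Fin.val h; simp at this; omega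
  have hn1 : n - 1 ≠ 0 := by omega
  simp [formL, e4, e5, hk, h, hn1] at h3
  tauto

end RationalNormal

end

/-! ### Parametrization of 𝒞 by multiples of projections -/

noncomputable section

namespace RationalNormal

open TopologicalSpace MvPolynomial

variable {k : Type*} [Field k] {n : ℕ}

/-- The cone of singular matrices with nonzero trace, that is, of multiples of projections. -/
def ProjCone (k : Type*) [Field k] : Set (Cone k (Fin 4)) :=
  {v | (mat v.coord).det = 0 ∧ v.coord 0 + v.coord 3 ≠ 0}

theorem ProjCone.det_eq (v : ProjCone k) : (mat v.1.coord).det = 0 := v.2.1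

theorem ProjCone.trace_ne (v : ProjCone k) : v.1.coord 0 + v.1.coord 3 ≠ 0 := v.2.2

/-- The matrix with eigenvalues `τ` and `ζ * τ`, where `0` and `τ` are those of the given one. -/
def rotation (ζ : k) (v : Fin 4 → k) : Matrix (Fin 2) (Fin 2) k :=
  (ζ - 1) • mat v + (v 0 + v 3) • 1

/-- Cayley–Hamilton for determinant zero: the square of the matrix is its trace times the matrix. -/
theorem vecMul_row {v : Fin 4 → k} (hv : (mat v).det = 0) (i : Fin 2) :
    Matrix.vecMul (mat v i) (mat v) = (v 0 + v 3) • mat v i := by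
  rw [det_mat] at hv
  ext j
  fin_cases i <;> fin_cases j <;>
    simp [Matrix.vecMul, dotProduct, Fin.sum_univ_two, mat] <;> first | linear_combination hv | linear_combination -hv | ring

theorem vecMul_adjugate_row {v : Fin 4 → k} (hv : (mat v).det = 0) (i : Fin 2) :
    Matrix.vecMul ((mat v).adjugate i) (mat v) = 0 := by
  have h := congrFun (Matrix.adjugate_mul (mat v)) i
  rw [hv, zero_smul] at h
  exact h

theorem vecMul_rotation (ζ : k) (v : Fin 4 → k) (r : Fin 2 → k) :
    Matrix.vecMul r (rotation ζ v) =
      (ζ - 1) • Matrix.vecMul r (mat v) + (v 0 + v 3) • r := by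
  rw [rotation, Matrix.vecMul_add, Matrix.vecMul_smul, Matrix.vecMul_smul, Matrix.vecMul_one]

theorem vecMul_row_rotation {v : Fin 4 → k} (hv : (mat v).det = 0) (ζ : k) (i : Fin 2) :
    Matrix.vecMul (mat v i) (rotation ζ v) = (ζ * (v 0 + v 3)) • mat v i := by
  rw [vecMul_rotation, vecMul_row hv, smul_smul, ← add_smul]
  congr 1; ring

theorem vecMul_adjugate_row_rotation {v : Fin 4 → k} (hv : (mat v).det = 0) (ζ : k) (i : Fin 2) :
    Matrix.vecMul ((mat v).adjugate i) (rotation ζ v) = (v 0 + v 3) • (mat v).adjugate i := by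
  rw [vecMul_rotation, vecMul_adjugate_row hv, smul_zero, zero_add]

/-- The rows of the adjugate and of the matrix are left eigenvectors for 0 and for the trace; as the
trace is nonzero, the two eigenlines are different, and each is given by some row. -/
theorem ProjCone.exists_bracket_ne (v : ProjCone k) :
    ∃ j i, bracket ((mat v.1.coord).adjugate j) (mat v.1.coord i) ≠ 0 := by
  by_contra! h
  have hτ := (ProjCone.trace_ne v)
  have hd := (ProjCone.det_eq v)
  rw [det_mat] at hd
  have h0 := h 1 0
  have h3 := h 0 1
  simp [bracket, Matrix.adjugate_fin_two, mat] at h0 h3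
  have e0 : (v.1.coord 0 + v.1.coord 3) * v.1.coord 0 = 0 := by linear_combination hd - h0
  have e3 : (v.1.coord 0 + v.1.coord 3) * v.1.coord 3 = 0 := by linear_combination hd + h3
  apply hτ
  rw [(mul_eq_zero.1 e0).resolve_left hτ, (mul_eq_zero.1 e3).resolve_left hτ, add_zero]

/-- The map from multiples of projections to pencils spanned by two powers: the two linear forms
define the image and the kernel of the projection. -/
def projMap (hn : n ≠ 0) (v : ProjCone k) : Grass k n :=
  powerSpace hn _ _ (ProjCone.exists_bracket_ne v).choose_spec.choose_spec

theorem compLin_powForm [Infinite k] {M : Matrix (Fin 2) (Fin 2) k} {r : Fin 2 → k} {c : k}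
    (h : Matrix.vecMul r M = c • r) : compLin n M (powForm n r) = c ^ n • powForm n r := by
  rw [← powForm_smul]
  refine evalForm_injective (funext fun u => ?_)
  rw [evalForm_compLin, evalForm_powForm, evalForm_powForm, vecMul_eq h]

theorem compLin_rotation_of_mem [Infinite k] (hn : n ≠ 0) {ζ : k} (hζ : ζ ^ n = 1) (v : ProjCone k)
    {f : Fin (n + 1) → k} (hf : f ∈ pencil (projMap hn v).1) :
    compLin n (rotation ζ v.1.coord) f = (v.1.coord 0 + v.1.coord 3) ^ n • f := by
  rw [projMap, pencil_powerSpace] at hf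
  obtain ⟨x, y, rfl⟩ := Submodule.mem_span_pair.1 hf
  rw [map_add, map_smul, map_smul, compLin_powForm (vecMul_adjugate_row_rotation (ProjCone.det_eq v) ζ _),
    compLin_powForm (vecMul_row_rotation (ProjCone.det_eq v) ζ _), mul_pow, hζ, one_mul, smul_add,
    smul_comm x, smul_comm y]

/-- The pencil is characterized by the rotation: only combinations of the two powers are multiplied
by τ^n. This condition is polynomial in the matrix and needs no choice of eigenvectors. -/
theorem eq_projMap [Infinite k] (hn : n ≠ 0) {ζ : k} (hζ : IsPrimitiveRoot ζ n) (v : ProjCone k)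
    {W : Grass k n} (h : ∀ f ∈ pencil W.1,
      compLin n (rotation ζ v.1.coord) f = (v.1.coord 0 + v.1.coord 3) ^ n • f) :
    projMap hn v = W := by
  refine (Grass.eq_of_pencil_le fun f hf => ?_).symm
  rw [projMap, pencil_powerSpace]
  exact mem_span_powForm hn hζ (ProjCone.exists_bracket_ne v).choose_spec.choose_spec (ProjCone.trace_ne v)
    (vecMul_adjugate_row_rotation (ProjCone.det_eq v) ζ _) (vecMul_row_rotation (ProjCone.det_eq v) ζ _) (h f hf)

/-- The rows chosen in `projMap` are immaterial: any pair of left eigenvectors gives the same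
pencil. -/
theorem projMap_eq_powerSpace (hn : n ≠ 0) [Infinite k] {ζ : k} (hζ : IsPrimitiveRoot ζ n)
    (v : ProjCone k) {r s : Fin 2 → k} (h : bracket r s ≠ 0)
    (hr : Matrix.vecMul r (mat v.1.coord) = 0)
    (hs : Matrix.vecMul s (mat v.1.coord) = (v.1.coord 0 + v.1.coord 3) • s) :
    projMap hn v = powerSpace hn r s h := by
  refine eq_projMap hn hζ v fun f hf => ?_
  rw [pencil_powerSpace] at hf
  obtain ⟨x, y, rfl⟩ := Submodule.mem_span_pair.1 hf
  have h1 : Matrix.vecMul r (rotation ζ v.1.coord) = (v.1.coord 0 + v.1.coord 3) • r := by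
    rw [vecMul_rotation, hr, smul_zero, zero_add]
  have h2 : Matrix.vecMul s (rotation ζ v.1.coord) = (ζ * (v.1.coord 0 + v.1.coord 3)) • s := by
    rw [vecMul_rotation, hs, smul_smul, ← add_smul]; congr 1; ring
  rw [map_add, map_smul, map_smul, compLin_powForm h1, compLin_powForm h2, mul_pow, hζ.pow_eq_one,
    one_mul, smul_add, smul_comm x, smul_comm y]

/-- The coefficients of the power of a linear form with polynomial coefficients. -/
def powPoly (n : ℕ) (r : Fin 2 → MvPolynomial (Fin 4) k) (i : Fin (n + 1)) :
    MvPolynomial (Fin 4) k :=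
  C ((n.choose i : k) * (-1) ^ (i : ℕ)) * ((-r 1) ^ (i : ℕ) * r 0 ^ (n - (i : ℕ)))

theorem isHomogeneous_powPoly {r : Fin 2 → MvPolynomial (Fin 4) k}
    (hr : ∀ j, (r j).IsHomogeneous 1) (i : Fin (n + 1)) : (powPoly n r i).IsHomogeneous n := by
  have h := (((hr 1).neg.pow (i : ℕ)).mul ((hr 0).pow (n - (i : ℕ))))
  have h1 : 1 * (i : ℕ) + 1 * (n - (i : ℕ)) = n := by have := i.2; omega
  rw [h1] at h
  exact h.C_mul _

theorem eval_powPoly (r : Fin 2 → MvPolynomial (Fin 4) k) (v : Fin 4 → k) :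
    (fun i => eval v (powPoly n r i)) = powForm n (fun j => eval v (r j)) := by
  ext i
  simp [powPoly, powForm, formL]
  ring

/-- Each choice of a row of the adjugate and a row of the matrix is a chart with polynomial
coefficients. Where the two rows are proportional, the Plücker coordinates vanish. -/
theorem continuous_projMap [Infinite k] (hn : n ≠ 0) {ζ : k} (hζ : IsPrimitiveRoot ζ n) :
    Continuous (projMap (k := k) hn) := by
  let R : Fin 2 → Fin 2 → MvPolynomial (Fin 4) k := ![![X 0, X 1], ![X 2, X 3]]
  let S : Fin 2 → Fin 2 → MvPolynomial (Fin 4) k := ![![X 3, -X 1], ![-X 2, X 0]]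
  have hR : ∀ i j, (R i j).IsHomogeneous 1 := by
    intro i j; fin_cases i <;> fin_cases j <;> exact isHomogeneous_X _ _
  have hS : ∀ i j, (S i j).IsHomogeneous 1 := by
    intro i j; fin_cases i <;> fin_cases j
    exacts [isHomogeneous_X _ _, (isHomogeneous_X _ _).neg, (isHomogeneous_X _ _).neg,
      isHomogeneous_X _ _]
  have eR : ∀ (v : Fin 4 → k) i, (fun j => eval v (R i j)) = mat v i := by
    intro v i; ext j; fin_cases i <;> fin_cases j <;> simp [R, mat]
  have eS : ∀ (v : Fin 4 → k) i, (fun j => eval v (S i j)) = (mat v).adjugate i := by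
    intro v i; ext j; fin_cases i <;> fin_cases j <;> simp [S, mat, Matrix.adjugate_fin_two]
  refine Cone.continuous_to_grass (I := Fin 2 × Fin 2) (projMap hn) (fun c => powPoly n (S c.1))
    (fun c => powPoly n (R c.2)) (fun c => isHomogeneous_powPoly (hS _))
    (fun c => isHomogeneous_powPoly (hR _)) (fun v => ?_) fun v c => ?_
  · obtain ⟨j, i, hji⟩ := (ProjCone.exists_bracket_ne v)
    refine ⟨(j, i), ?_⟩
    rw [eval_powPoly, eval_powPoly, eS, eR, projMap_eq_powerSpace hn hζ v hji
      (vecMul_adjugate_row (ProjCone.det_eq v) _) (vecMul_row (ProjCone.det_eq v) _)]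
    rfl
  · rw [eval_powPoly, eval_powPoly, eS, eR]
    by_cases h : bracket ((mat v.1.coord).adjugate c.1) (mat v.1.coord c.2) = 0
    · exact Or.inr (plucker_powForm_eq_zero hn h)
    · rw [projMap_eq_powerSpace hn hζ v h (vecMul_adjugate_row (ProjCone.det_eq v) _) (vecMul_row (ProjCone.det_eq v) _)]
      exact Or.inl rfl

/-- The polynomials expressing that a form is fixed up to a factor by `rotation ζ v`. -/
def fixPoly (n : ℕ) (ζ : k) (u : Fin 2 → k) (j : Fin (n + 1)) : MvPolynomial (Fin 4) k :=
  (C ((ζ - 1) * u 0) * X 0 + C ((ζ - 1) * u 1) * X 1 + (C (u 0) * X 0 + C (u 0) * X 3)) ^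
      (n - (j : ℕ)) *
    (C ((ζ - 1) * u 0) * X 2 + C ((ζ - 1) * u 1) * X 3 + (C (u 1) * X 0 + C (u 1) * X 3)) ^
      (j : ℕ) -
  C (u 0 ^ (n - (j : ℕ)) * u 1 ^ (j : ℕ)) * (X 0 + X 3) ^ n

theorem isHomogeneous_fixPoly (ζ : k) (u : Fin 2 → k) (j : Fin (n + 1)) :
    (fixPoly n ζ u j).IsHomogeneous n := by
  refine IsHomogeneous.sub ?_ (IsHomogeneous.C_mul ?_ _)
  · simpa using isHomogeneous_pow_mul_pow
      ((isHomogeneous_linear ((ζ - 1) * u 0) ((ζ - 1) * u 1) (0 : Fin 4) 1).add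
        (isHomogeneous_linear (u 0) (u 0) 0 3))
      ((isHomogeneous_linear ((ζ - 1) * u 0) ((ζ - 1) * u 1) (2 : Fin 4) 3).add
        (isHomogeneous_linear (u 1) (u 1) 0 3)) j
  · simpa using ((isHomogeneous_X k (0 : Fin 4)).add (isHomogeneous_X k 3)).pow n

theorem sum_fixPoly (ζ : k) (u : Fin 2 → k) (v : Fin 4 → k) (f : Fin (n + 1) → k) :
    ∑ j, f j * eval v (fixPoly n ζ u j) =
      evalForm n f ((rotation ζ v).mulVec u) - (v 0 + v 3) ^ n * evalForm n f u := by
  rw [evalForm_apply, evalForm_apply, Finset.mul_sum, ← Finset.sum_sub_distrib]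
  refine Finset.sum_congr rfl fun j _ => ?_
  simp [fixPoly, rotation, Matrix.add_mulVec, Matrix.smul_mulVec, mat, Matrix.vecHead, Matrix.vecTail]
  ring

theorem forall_fixPoly_iff [Infinite k] (ζ : k) (v : Fin 4 → k) (W : Grass k n) :
    (∀ u, ∀ f ∈ pencil W.1, ∑ j, f j * eval v (fixPoly n ζ u j) = 0) ↔
      ∀ f ∈ pencil W.1, compLin n (rotation ζ v) f = (v 0 + v 3) ^ n • f := by
  simp only [sum_fixPoly, sub_eq_zero]
  constructor
  · intro h f hf
    refine evalForm_injective (funext fun u => ?_)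
    rw [evalForm_compLin, map_smul, Pi.smul_apply, smul_eq_mul]
    exact h u f hf
  · intro h u f hf
    rw [← evalForm_compLin, h f hf, map_smul, Pi.smul_apply, smul_eq_mul]

/-- The image is cut out by the existence of a nonzero matrix, satisfying the equations of `Z`,
whose rotation multiplies all forms of the pencil by the `n`-th power of the trace. The determinant
is among the equations of `Z`, so it vanishes automatically. -/
theorem image_projMap_eq [IsAlgClosed k] (hn : n ≠ 0) {ζ : k} (hζ : IsPrimitiveRoot ζ n)
    (hζ1 : ζ ≠ 1) {Z : Set (ProjCone k)} (hZ : IsClosed Z) :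
    ∃ C, IsClosed C ∧ projMap hn '' Z = C ∩ baseFree k n := by
  have := IsAlgClosed.instInfinite (K := k)
  let S₀ := {F : MvPolynomial (Fin 4) k // ∃ e, F.IsHomogeneous e ∧ ∀ z ∈ Z, eval z.1.coord F = 0}
  refine ⟨_, Grass.isClosed_exists (k := k) (n := n) (ι := Fin 4) (S₀ := S₀)
    (fixPoly n ζ) (fun _ => n) (isHomogeneous_fixPoly ζ)
    (fun F => F.1) (fun F => F.2.choose) (fun F => F.2.choose_spec.1), ?_⟩
  ext W'
  simp only [forall_fixPoly_iff]
  constructor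
  · rintro ⟨v, hv, rfl⟩
    refine ⟨⟨v.1.coord, ?_, fun F => F.2.choose_spec.2 v hv,
      fun f hf => compLin_rotation_of_mem hn hζ.pow_eq_one v hf⟩, powerSpace_mem_baseFree hn _⟩
    intro h0
    apply (ProjCone.trace_ne v)
    rw [h0]; simp
  · rintro ⟨⟨v, hv0, hvZ, hfix⟩, hW'⟩
    have hdet : (mat v).det = 0 := by
      have := hvZ ⟨X 0 * X 3 - X 1 * X 2, 2, ((isHomogeneous_X k 0).mul (isHomogeneous_X k 3)).sub
        ((isHomogeneous_X k 1).mul (isHomogeneous_X k 2)), fun z _ => by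
          have h := (ProjCone.det_eq z)
          rw [det_mat] at h
          simpa using h⟩
      rw [det_mat]; simpa using this
    -- With trace zero the rotation would be a nonzero multiple of a rank one matrix and would
    -- annihilate every form of the pencil, which contradicts base point freeness at the image of
    -- that matrix.
    have htr : v 0 + v 3 ≠ 0 := by
      intro htr
      obtain ⟨w, hw, a, b, hab, hmul⟩ := exists_eq_smul_of_det_eq_zero hv0 hdet
      obtain ⟨f, hf, hne⟩ := hW' w hw
      obtain ⟨u, hu⟩ : ∃ u : Fin 2 → k, a * u 0 + b * u 1 ≠ 0 := by
        by_contra! h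
        have h1 := h ![1, 0]
        have h2 := h ![0, 1]
        simp at h1 h2
        exact hab (by simp [h1, h2])
      have h1 := congrFun (congrArg (evalForm n) (hfix f hf)) u
      rw [evalForm_compLin, rotation, htr, zero_smul, add_zero, Matrix.smul_mulVec, hmul,
        evalForm_smul, evalForm_smul, zero_pow hn, zero_smul, map_zero] at h1
      exact mul_ne_zero (pow_ne_zero _ (sub_ne_zero.2 hζ1)) (mul_ne_zero (pow_ne_zero _ hu) hne) h1
    refine ⟨⟨⟨v⟩, hdet, htr⟩, Cone.mem_of_isClosed hZ fun F e hF hFZ => hvZ ⟨F, e, hF, hFZ⟩, ?_⟩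
    exact eq_projMap hn hζ ⟨⟨v⟩, hdet, htr⟩ hfix

end RationalNormal

end

/-! ### Dimension of 𝒞 -/

noncomputable section

namespace RationalNormal

open TopologicalSpace MvPolynomial

variable {k : Type*} [Field k] {n : ℕ}

/-- The chain consists of the multiples of diag(1, 0), the matrices with zero second row, and the
whole cone, which is irreducible since its points are products of a column and a row. The upper
bound improves by one because the determinant vanishes. -/
theorem topologicalKrullDim_ProjCone [Infinite k] : topologicalKrullDim (ProjCone k) = 2 := by
  have hX : ∀ v ∈ ProjCone k, ∀ c : k, c ≠ 0 → ⟨c • v.coord⟩ ∈ ProjCone k := by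
    intro v hv c hc
    refine ⟨?_, ?_⟩
    · have h1 : (mat (c • v.coord)).det = c ^ 2 * (mat v.coord).det := by
        simp only [det_mat, Pi.smul_apply, smul_eq_mul]; ring
      exact h1.trans (by rw [hv.1, mul_zero])
    · have h2 : (c • v.coord) 0 + (c • v.coord) 3 = c * (v.coord 0 + v.coord 3) := by
        simp only [Pi.smul_apply, smul_eq_mul]; ring
      exact h2.trans_ne (mul_ne_zero hc hv.2)
  have hX0 : ∀ v ∈ ProjCone k, ∃ i, v.coord i ≠ 0 := by
    intro v hv
    by_contra! h0
    exact hv.2 (by simp [h0])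
  let pt (a b c d : k) (h : a * d - b * c = 0) (h' : a + d ≠ 0) : ProjCone k :=
    ⟨⟨![a, b, c, d]⟩, by rw [det_mat]; simpa using h, by simpa using h'⟩
  have hirr : ∀ (θ : Fin 4 → MvPolynomial (Fin 4) k)
      (_ : ∀ t : Fin 4 → k, (mat fun i => eval t (θ i)).det = 0)
      (_ : eval (fun i => eval ![1, 0, 1, 0] (θ i)) (X 0 + X 3) ≠ 0)
      (Z : Set (ProjCone k)) (_ : ∀ v : ProjCone k, v ∈ Z ↔ ∃ t : Fin 4 → k, ∀ i, v.1.coord i =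
        eval t (θ i)), IsIrreducible Z := by
    intro θ hθ h1 Z hZ
    exact Cone.isIrreducible_of_param θ (X 0 + X 3) hZ
      (fun t ht => ⟨hθ t, by simpa using ht⟩) ⟨_, h1⟩
  let Z₂ : IrreducibleCloseds (ProjCone k) := ⟨Set.univ,
    hirr ![X 0 * X 2, X 0 * X 3, X 1 * X 2, X 1 * X 3]
      (fun t => by rw [det_mat]; simp; ring) (by simp) _ (fun v => ⟨fun _ => by
        have hv0 : v.1.coord ≠ 0 := fun h => ProjCone.trace_ne v (by simp [h])
        obtain ⟨w, -, a, b, -, hmul⟩ := exists_eq_smul_of_det_eq_zero hv0 (ProjCone.det_eq v)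
        refine ⟨![w 0, w 1, a, b], fun i => ?_⟩
        have h1 := hmul ![1, 0]
        have h2 := hmul ![0, 1]
        rw [mat_mulVec] at h1 h2
        have h10 := congrFun h1 0
        have h11 := congrFun h1 1
        have h20 := congrFun h2 0
        have h21 := congrFun h2 1
        simp at h10 h11 h20 h21
        fin_cases i <;> simp [*, mul_comm], fun _ => trivial⟩), isClosed_univ⟩
  let Z₁ : IrreducibleCloseds (ProjCone k) := ⟨{v | v.1.coord 2 = 0} ∩ {v | v.1.coord 3 = 0},
    hirr ![X 0, X 1, 0, 0] (fun t => by rw [det_mat]; simp) (by simp) _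
      (fun v => ⟨fun h => ⟨v.1.coord, by intro i; fin_cases i <;> simp [h.1.out, h.2.out]⟩,
        fun ⟨t, ht⟩ => ⟨(ht 2).trans (by simp), (ht 3).trans (by simp)⟩⟩),
    (Cone.isClosed_coord_eq_zero 2).inter (Cone.isClosed_coord_eq_zero 3)⟩
  let Z₀ : IrreducibleCloseds (ProjCone k) :=
    ⟨({v | v.1.coord 2 = 0} ∩ {v | v.1.coord 3 = 0}) ∩ {v | v.1.coord 1 = 0},
    hirr ![X 0, 0, 0, 0] (fun t => by rw [det_mat]; simp) (by simp) _
      (fun v => ⟨fun h => ⟨v.1.coord, by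
          intro i; fin_cases i <;> simp [h.1.1.out, h.1.2.out, h.2.out]⟩,
        fun ⟨t, ht⟩ => ⟨⟨(ht 2).trans (by simp), (ht 3).trans (by simp)⟩, (ht 1).trans (by simp)⟩⟩),
    ((Cone.isClosed_coord_eq_zero 2).inter (Cone.isClosed_coord_eq_zero 3)).inter
      (Cone.isClosed_coord_eq_zero 1)⟩
  have h01 : Z₀ < Z₁ := by
    refine ⟨fun v hv => hv.1, fun h => ?_⟩
    have : pt 1 1 0 0 (by simp) (by simp) ∈ (Z₀ : Set (ProjCone k)) :=
      h ⟨by simp [pt], by simp [pt]⟩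
    exact one_ne_zero (show (1 : k) = 0 from this.2)
  have h12 : Z₁ < Z₂ := by
    refine ⟨fun v _ => trivial, fun h => ?_⟩
    have : pt 1 0 1 0 (by simp) (by simp) ∈ (Z₁ : Set (ProjCone k)) := h trivial
    exact one_ne_zero (show (1 : k) = 0 from this.1)
  refine le_antisymm ?_ (le_krullDim_of_chain h01 h12)
  have : Nonempty (IrreducibleCloseds (ProjCone k)) := ⟨Z₀⟩
  have hF : (X 0 * X 3 - X 1 * X 2 : MvPolynomial (Fin 4) k) ≠ 0 := by
    intro h
    have := congrArg (eval ![1, 0, 0, 1]) h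
    simp at this
  have h := Cone.krullDim_add_two_le hX hX0 hF fun v hv => by
    have h := hv.1
    rw [det_mat] at h
    simpa using h
  rw [Fintype.card_fin] at h
  exact ENat.WithBot.add_le_add_one_right_iff.1 (ENat.WithBot.add_le_add_one_right_iff.1 h)

/-- Exchange of the kernel and the image of a multiple of a projection. -/
def ProjCone.swap (v : ProjCone k) : ProjCone k :=
  ⟨⟨![v.1.coord 3, -v.1.coord 1, -v.1.coord 2, v.1.coord 0]⟩, by
    have h := ProjCone.det_eq v
    rw [det_mat] at h
    change (mat _).det = 0
    rw [det_mat]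
    simp
    linear_combination h, by
    have h := ProjCone.trace_ne v
    simpa [add_comm] using h⟩

theorem ProjCone.swap_swap (v : ProjCone k) : ProjCone.swap (ProjCone.swap v) = v := by
  have h : ![v.1.coord 0, - -v.1.coord 1, - -v.1.coord 2, v.1.coord 3] = v.1.coord := by
    ext i; fin_cases i <;> simp
  exact Subtype.ext (congrArg Cone.mk h)

theorem ProjCone.continuous_swap : Continuous (ProjCone.swap (k := k)) := by
  refine Cone.continuous_to_cone _ (d := 1) ![X 3, -X 1, -X 2, X 0] (fun i => ?_) fun v i => ?_
  · fin_cases i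
    exacts [isHomogeneous_X _ _, (isHomogeneous_X _ _).neg, (isHomogeneous_X _ _).neg,
      isHomogeneous_X _ _]
  · fin_cases i <;> simp [ProjCone.swap]

/-- `ProjCone.swap` as a homeomorphism. -/
def ProjCone.swapHomeo (k : Type*) [Field k] : ProjCone k ≃ₜ ProjCone k where
  toFun := ProjCone.swap
  invFun := ProjCone.swap
  left_inv := ProjCone.swap_swap
  right_inv := ProjCone.swap_swap
  continuous_toFun := ProjCone.continuous_swap
  continuous_invFun := ProjCone.continuous_swap

/-- A multiple of a projection is determined up to a factor by its two left eigenvectors. -/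
theorem ProjCone.inseparable_of_vecMul {v w : ProjCone k} {r s : Fin 2 → k} (h : bracket r s ≠ 0)
    (hr : Matrix.vecMul r (mat v.1.coord) = 0)
    (hs : Matrix.vecMul s (mat v.1.coord) = (v.1.coord 0 + v.1.coord 3) • s)
    (hr' : Matrix.vecMul r (mat w.1.coord) = 0)
    (hs' : Matrix.vecMul s (mat w.1.coord) = (w.1.coord 0 + w.1.coord 3) • s) :
    Inseparable w v := by
  have hv := ProjCone.trace_ne v
  have hw := ProjCone.trace_ne w
  set τ := v.1.coord 0 + v.1.coord 3
  set τ' := w.1.coord 0 + w.1.coord 3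
  let T : Matrix (Fin 2) (Fin 2) k := !![r 0, r 1; s 0, s 1]
  have hT : IsUnit T.det := by
    rw [isUnit_iff_ne_zero, Matrix.det_fin_two_of]; exact h
  have h1 : T * mat w.1.coord = T * ((τ' / τ) • mat v.1.coord) := by
    rw [Matrix.mul_smul]
    ext i j
    have e1 := congrFun hr j
    have e2 := congrFun hs j
    have e3 := congrFun hr' j
    have e4 := congrFun hs' j
    simp only [Matrix.vecMul, dotProduct, Fin.sum_univ_two, Pi.smul_apply, smul_eq_mul,
      Pi.zero_apply] at e1 e2 e3 e4
    rw [Matrix.mul_apply, Fin.sum_univ_two, Matrix.smul_apply, Matrix.mul_apply, Fin.sum_univ_two]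
    fin_cases i
    · change r 0 * _ + r 1 * _ = _ • (r 0 * _ + r 1 * _)
      rw [e1, e3, smul_zero]
    · change s 0 * _ + s 1 * _ = _ • (s 0 * _ + s 1 * _)
      rw [e2, e4, smul_eq_mul]
      field_simp
  have h2 : mat w.1.coord = (τ' / τ) • mat v.1.coord := by
    have := congrArg (T⁻¹ * ·) h1
    simpa [← Matrix.mul_assoc, Matrix.nonsing_inv_mul _ hT] using this
  refine Cone.inseparable (c := τ' / τ) (div_ne_zero hw hv) fun i => ?_
  fin_cases i
  · exact congrFun (congrFun h2 0) 0
  · exact congrFun (congrFun h2 0) 1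
  · exact congrFun (congrFun h2 1) 0
  · exact congrFun (congrFun h2 1) 1

theorem ne_zero_of_bracket_ne {r s : Fin 2 → k} (h : bracket r s ≠ 0) : r ≠ 0 ∧ s ≠ 0 := by
  constructor <;> rintro rfl <;> simp [bracket] at h

/-- The only powers of linear forms in the pencil are multiples of the two spanning ones, so the
eigenlines agree up to order. Exchanging them replaces the matrix by its adjugate, which is `swap`.
-/
theorem inseparable_of_projMap_eq [Infinite k] (hn : 2 ≤ n) (hk : (n : k) ≠ 0) {v w : ProjCone k}
    (h : projMap (n := n) (by omega) v = projMap (by omega) w) :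
    Inseparable w v ∨ Inseparable w (ProjCone.swap v) := by
  have hn0 : n ≠ 0 := by omega
  obtain ⟨r, s, hrs, hr, hs, hv⟩ : ∃ (r s : Fin 2 → k) (hrs : bracket r s ≠ 0),
      Matrix.vecMul r (mat v.1.coord) = 0 ∧
      Matrix.vecMul s (mat v.1.coord) = (v.1.coord 0 + v.1.coord 3) • s ∧
      projMap hn0 v = powerSpace hn0 r s hrs :=
    ⟨_, _, (ProjCone.exists_bracket_ne v).choose_spec.choose_spec,
      vecMul_adjugate_row (ProjCone.det_eq v) _, vecMul_row (ProjCone.det_eq v) _, rfl⟩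
  obtain ⟨r', s', hrs', hr', hs', hw⟩ : ∃ (r s : Fin 2 → k) (hrs : bracket r s ≠ 0),
      Matrix.vecMul r (mat w.1.coord) = 0 ∧
      Matrix.vecMul s (mat w.1.coord) = (w.1.coord 0 + w.1.coord 3) • s ∧
      projMap hn0 w = powerSpace hn0 r s hrs :=
    ⟨_, _, (ProjCone.exists_bracket_ne w).choose_spec.choose_spec,
      vecMul_adjugate_row (ProjCone.det_eq w) _, vecMul_row (ProjCone.det_eq w) _, rfl⟩
  have hspan : Submodule.span k {powForm n r', powForm n s'} =
      Submodule.span k {powForm n r, powForm n s} := by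
    rw [← pencil_powerSpace hn0 hrs, ← pencil_powerSpace hn0 hrs', ← hv, ← hw, h]
  obtain ⟨hr0, hs0⟩ := ne_zero_of_bracket_ne hrs
  have hr1 := bracket_eq_zero_of_powForm_mem hn hk hrs (t := r')
    (hspan ▸ Submodule.subset_span (Set.mem_insert _ _))
  have hs1 := bracket_eq_zero_of_powForm_mem hn hk hrs (t := s')
    (hspan ▸ Submodule.subset_span (Set.mem_insert_of_mem _ (Set.mem_singleton _)))
  rw [bracket_eq_zero_iff hr0, bracket_eq_zero_iff hs0] at hr1 hs1
  have hτ : (ProjCone.swap v).1.coord 0 + (ProjCone.swap v).1.coord 3 = v.1.coord 0 + v.1.coord 3 := by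
    simp [ProjCone.swap, add_comm]
  have hadj : ∀ x : Fin 2 → k, Matrix.vecMul x (mat (ProjCone.swap v).1.coord) =
      (v.1.coord 0 + v.1.coord 3) • x - Matrix.vecMul x (mat v.1.coord) := by
    intro x
    ext j
    fin_cases j <;> simp [Matrix.vecMul, dotProduct, Fin.sum_univ_two, mat, ProjCone.swap,
      Matrix.vecHead, Matrix.vecTail] <;> ring
  rcases hr1 with ⟨c, rfl⟩ | ⟨c, rfl⟩ <;> rcases hs1 with ⟨d, rfl⟩ | ⟨d, rfl⟩
  · simp [bracket] at hrs'; exact absurd (by ring) hrs'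
  · refine Or.inl (ProjCone.inseparable_of_vecMul hrs' ?_ ?_ hr' hs')
    · rw [Matrix.smul_vecMul, hr, smul_zero]
    · rw [Matrix.smul_vecMul, hs, smul_comm]
  · refine Or.inr (ProjCone.inseparable_of_vecMul hrs' ?_ ?_ hr' hs')
    · rw [Matrix.smul_vecMul, hadj, hs, sub_self, smul_zero]
    · rw [Matrix.smul_vecMul, hadj, hr, sub_zero, hτ, smul_comm]
  · simp [bracket] at hrs'; exact absurd (by ring) hrs'

theorem familyC_eq_range [IsAlgClosed k] (hn : n ≠ 0) {ζ : k} (hζ : IsPrimitiveRoot ζ n) :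
    familyC k n = Set.range (projMap (k := k) hn) := by
  have := IsAlgClosed.instInfinite (K := k)
  ext W
  rw [mem_familyC_iff hn]
  constructor
  · rintro ⟨r, s, h, rfl⟩
    have hδ : r 0 * s 1 - r 1 * s 0 ≠ 0 := h
    -- the projection with kernel `s = 0`
    refine ⟨⟨⟨![-(r 1 * s 0), -(r 1 * s 1), r 0 * s 0, r 0 * s 1]⟩, ?_, ?_⟩, ?_⟩
    · rw [det_mat]; simp; ring
    · simp only [Matrix.cons_val_zero, Matrix.cons_val]
      exact fun h0 => hδ (by linear_combination h0)
    · refine projMap_eq_powerSpace hn hζ _ h ?_ ?_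
      · ext j
        fin_cases j <;> simp [Matrix.vecMul, dotProduct, Fin.sum_univ_two, mat] <;> ring
      · ext j
        fin_cases j <;> simp [Matrix.vecMul, dotProduct, Fin.sum_univ_two, mat] <;> ring
  · rintro ⟨v, rfl⟩
    exact ⟨_, _, _, rfl⟩

theorem isLocallyClosedOfDim_familyC [IsAlgClosed k] (hn : 2 ≤ n) (hk : (n : k) ≠ 0) :
    IsLocallyClosedOfDim (familyC k n) 2 := by
  have := IsAlgClosed.instInfinite (K := k)
  have hn0 : n ≠ 0 := by omega
  have : NeZero (n : k) := ⟨hk⟩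
  obtain ⟨ζ, hζ⟩ := HasEnoughRootsOfUnity.exists_primitiveRoot k n
  rw [familyC_eq_range hn0 hζ]
  have h := isLocallyClosedOfDim_iUnion_range (isOpen_baseFree n)
    (fun _ : Unit => projMap (k := k) hn0)
    (fun _ => continuous_projMap hn0 hζ)
    (fun _ Z hZ => image_projMap_eq hn0 hζ (hζ.ne_one (by omega)) hZ) ()
    (fun b : Bool => if b then Homeomorph.refl _ else ProjCone.swapHomeo k)
    (fun v w h => by
      rcases inseparable_of_projMap_eq hn hk h with h | h
      · exact ⟨true, h⟩
      · exact ⟨false, h⟩) topologicalKrullDim_ProjCone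
  rwa [Set.iUnion_const] at h

end RationalNormal

end

/-! ### Invariant pencils and projective representations -/

noncomputable section

namespace RationalNormal

variable {k : Type*} [Field k] {n : ℕ}

/-- The map `ℙ¹ → ℙ¹` defined by the pencil of `W` is invariant under `M`. -/
def Invariant (W : Grass k n) (M : Matrix (Fin 2) (Fin 2) k) : Prop :=
  ∀ f ∈ pencil W.1, ∀ h ∈ pencil W.1, ∀ u, evalForm n f (M.mulVec u) * evalForm n h u =
    evalForm n f u * evalForm n h (M.mulVec u)

/-- An injective homomorphism from a group to `PGL₂`, with representatives of determinant one. -/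
structure ProjRep (k : Type*) [Field k] (G : Type*) [Group G] where
  /-- The matrix of a group element, determined up to a factor. -/
  toFun : G → Matrix (Fin 2) (Fin 2) k
  det_eq_one : ∀ g, (toFun g).det = 1
  exists_mul : ∀ g h, ∃ c : k, toFun g * toFun h = c • toFun (g * h)
  eq_one : ∀ (g : G) (c : k), toFun g = c • 1 → g = 1

theorem eq_zero_of_forall_affine [Infinite k] {L : Fin (n + 1) → k}
    (h : ∀ t, evalForm n L ![t, 1] = 0) : L = 0 := by
  obtain ⟨s, hs⟩ := Infinite.exists_subset_card_eq k (n + 1)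
  refine eq_zero_of_card_zeros s (fun t => ![t, 1]) (fun t _ h => ?_) (fun t _ t' _ h => ?_)
    (by omega) fun t _ => h t
  · simpa using congrFun h 1
  · simpa [bracket] using sub_ne_zero.2 h

/-- Both sides are forms of degree 2n in `u`, so the points (t, 1) suffice to compare them; this is
the version that rational functions of t can express. -/
theorem invariant_iff_affine [Infinite k] {W : Grass k n} {M : Matrix (Fin 2) (Fin 2) k} :
    Invariant W M ↔ ∀ f ∈ pencil W.1, ∀ h ∈ pencil W.1, ∀ t,
      evalForm n f (M.mulVec ![t, 1]) * evalForm n h ![t, 1] =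
        evalForm n f ![t, 1] * evalForm n h (M.mulVec ![t, 1]) := by
  refine ⟨fun H f hf h hh t => H f hf h hh _, fun H f hf h hh => ?_⟩
  obtain ⟨L, hL⟩ : IsForm (n + n) ((fun u => evalForm n f (M.mulVec u)) * evalForm n h) :=
    (IsForm.comp ⟨f, rfl⟩ M).mul ⟨h, rfl⟩
  obtain ⟨L', hL'⟩ : IsForm (n + n) (evalForm n f * fun u => evalForm n h (M.mulVec u)) :=
    IsForm.mul ⟨f, rfl⟩ (IsForm.comp ⟨h, rfl⟩ M)
  have h0 : L - L' = 0 := eq_zero_of_forall_affine fun t => by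
    rw [map_sub, hL, hL', Pi.sub_apply, sub_eq_zero]
    exact H f hf h hh t
  intro u
  have h1 : evalForm (n + n) L u = evalForm (n + n) L' u := by rw [sub_eq_zero.1 h0]
  rwa [hL, hL'] at h1

end RationalNormal

end

/-! ### Fractional linear transformations of k(t) -/

noncomputable section

namespace RationalNormal

open RatFunc IntermediateField

variable {k : Type*} [Field k] {n : ℕ}

/-- The value of a binary form at a pair of polynomials. -/
def formPoly (f : Fin (n + 1) → k) (p q : Polynomial k) : Polynomial k :=
  ∑ i : Fin (n + 1), Polynomial.C (f i) * (p ^ (n - (i : ℕ)) * q ^ (i : ℕ))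

theorem eval_formPoly (f : Fin (n + 1) → k) (p q : Polynomial k) (t : k) :
    (formPoly f p q).eval t = evalForm n f ![p.eval t, q.eval t] := by
  rw [evalForm_apply, formPoly, Polynomial.eval_finsetSum]
  simp

theorem algebraMap_formPoly (f : Fin (n + 1) → k) (p q : Polynomial k) :
    algebraMap (Polynomial k) (RatFunc k) (formPoly f p q) = ∑ i : Fin (n + 1), RatFunc.C (f i) *
      (algebraMap (Polynomial k) (RatFunc k) p ^ (n - (i : ℕ)) *
        algebraMap (Polynomial k) (RatFunc k) q ^ (i : ℕ)) := by
  rw [formPoly, map_sum]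
  simp [RatFunc.algebraMap_C]

theorem restrictForm_eq (f : Fin (n + 1) → k) :
    restrictForm f = algebraMap (Polynomial k) (RatFunc k) (formPoly f Polynomial.X 1) := by
  rw [algebraMap_formPoly, restrictForm]
  simp

theorem formPoly_add (f g : Fin (n + 1) → k) (p q : Polynomial k) :
    formPoly (f + g) p q = formPoly f p q + formPoly g p q := by
  simp [formPoly, add_mul, Finset.sum_add_distrib]

theorem formPoly_smul (c : k) (f : Fin (n + 1) → k) (p q : Polynomial k) :
    formPoly (c • f) p q = Polynomial.C c * formPoly f p q := by
  simp [formPoly, mul_assoc, Finset.mul_sum]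

theorem restrictForm_add (f g : Fin (n + 1) → k) :
    restrictForm (f + g) = restrictForm f + restrictForm g := by
  rw [restrictForm_eq, formPoly_add, map_add, ← restrictForm_eq, ← restrictForm_eq]

theorem restrictForm_smul (c : k) (f : Fin (n + 1) → k) :
    restrictForm (c • f) = RatFunc.C c * restrictForm f := by
  rw [restrictForm_eq, formPoly_smul, map_mul, ← restrictForm_eq, RatFunc.algebraMap_C]

theorem restrictForm_eq_zero [Infinite k] {f : Fin (n + 1) → k} : restrictForm f = 0 ↔ f = 0 := by
  constructor
  · intro h
    rw [restrictForm_eq] at h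
    replace h := RatFunc.algebraMap_injective k (h.trans (map_zero _).symm)
    refine eq_zero_of_forall_affine fun t => ?_
    have := eval_formPoly f Polynomial.X 1 t
    rw [h] at this
    simpa using this.symm
  · rintro rfl
    simp [restrictForm]

/-- The numerator of `mobX M`. -/
def mobNum (M : Matrix (Fin 2) (Fin 2) k) : Polynomial k :=
  Polynomial.C (M 0 0) * Polynomial.X + Polynomial.C (M 0 1)

/-- The denominator of `mobX M`. -/
def mobDen (M : Matrix (Fin 2) (Fin 2) k) : Polynomial k :=
  Polynomial.C (M 1 0) * Polynomial.X + Polynomial.C (M 1 1)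

/-- The image of `X` under the fractional linear transformation with matrix `M`. -/
def mobX (M : Matrix (Fin 2) (Fin 2) k) : RatFunc k :=
  algebraMap (Polynomial k) (RatFunc k) (mobNum M) / algebraMap (Polynomial k) (RatFunc k) (mobDen M)

theorem linear_eq_zero {a b : k} (h : Polynomial.C a * Polynomial.X + Polynomial.C b = 0) :
    a = 0 ∧ b = 0 := by
  constructor
  · simpa using congrArg (Polynomial.coeff · 1) h
  · simpa using congrArg (Polynomial.coeff · 0) h

theorem mobDen_ne_zero {M : Matrix (Fin 2) (Fin 2) k} (hM : M.det ≠ 0) : mobDen M ≠ 0 := by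
  intro h
  obtain ⟨h1, h2⟩ := linear_eq_zero h
  rw [Matrix.det_fin_two, h1, h2] at hM
  simp at hM

theorem algebraMap_mobDen_ne_zero {M : Matrix (Fin 2) (Fin 2) k} (hM : M.det ≠ 0) :
    algebraMap (Polynomial k) (RatFunc k) (mobDen M) ≠ 0 :=
  RatFunc.algebraMap_ne_zero (mobDen_ne_zero hM)

theorem algebraMap_mobNum (M : Matrix (Fin 2) (Fin 2) k) :
    algebraMap (Polynomial k) (RatFunc k) (mobNum M) = C (M 0 0) * X + C (M 0 1) := by
  simp [mobNum, RatFunc.algebraMap_C]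

theorem algebraMap_mobDen (M : Matrix (Fin 2) (Fin 2) k) :
    algebraMap (Polynomial k) (RatFunc k) (mobDen M) = C (M 1 0) * X + C (M 1 1) := by
  simp [mobDen, RatFunc.algebraMap_C]

/-- A fractional linear transformation is determined by its matrix up to a factor. -/
theorem exists_eq_smul_of_mobX_eq {M N : Matrix (Fin 2) (Fin 2) k} (hM : M.det ≠ 0)
    (hN : N.det ≠ 0) (h : mobX M = mobX N) : ∃ c : k, M = c • N := by
  rw [mobX, mobX, div_eq_div_iff (algebraMap_mobDen_ne_zero hM) (algebraMap_mobDen_ne_zero hN),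
    ← map_mul, ← map_mul] at h
  have h := RatFunc.algebraMap_injective k h
  have hc : ∀ a b c d : k, ((Polynomial.C a * Polynomial.X + Polynomial.C b) *
      (Polynomial.C c * Polynomial.X + Polynomial.C d)) = Polynomial.C (a * c) * Polynomial.X ^ 2 +
      Polynomial.C (a * d + b * c) * Polynomial.X + Polynomial.C (b * d) := by
    intro a b c d
    simp only [map_mul, map_add]; ring
  rw [mobNum, mobDen, mobNum, mobDen, hc, hc] at h
  have e0 := congrArg (Polynomial.coeff · 0) h
  have e1 := congrArg (Polynomial.coeff · 1) h
  have e2 := congrArg (Polynomial.coeff · 2) h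
  simp only [Polynomial.coeff_add, Polynomial.coeff_C_mul, Polynomial.coeff_X_pow,
    Polynomial.coeff_X, Polynomial.coeff_C] at e0 e1 e2
  norm_num at e0 e1 e2
  -- Comparing coefficients in the cross-multiplied identity says exactly that `adj N * M` is
  -- scalar.
  have hadj : N.adjugate * M = (N 1 1 * M 0 0 - N 0 1 * M 1 0) • 1 := by
    rw [Matrix.adjugate_fin_two]
    ext i j
    fin_cases i <;> fin_cases j <;> simp [Matrix.mul_apply, Fin.sum_univ_two]
    · ring
    · linear_combination e0
    · linear_combination -e2
    · linear_combination -e1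
  refine ⟨(N 1 1 * M 0 0 - N 0 1 * M 1 0) / N.det, ?_⟩
  have h1 := congrArg (N * ·) hadj
  simp only [← Matrix.mul_assoc, Matrix.mul_adjugate, Matrix.smul_mul, Matrix.one_mul,
    Matrix.mul_smul, Matrix.mul_one] at h1
  rw [div_eq_inv_mul, ← smul_smul, ← h1, smul_smul, inv_mul_cancel₀ hN, one_smul]

theorem mobX_smul {M : Matrix (Fin 2) (Fin 2) k} {c : k} (hc : c ≠ 0) :
    mobX (c • M) = mobX M := by
  have h1 : mobNum (c • M) = Polynomial.C c * mobNum M := by simp [mobNum]; ring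
  have h2 : mobDen (c • M) = Polynomial.C c * mobDen M := by simp [mobDen]; ring
  rw [mobX, h1, h2, map_mul, map_mul, mul_div_mul_left _ _ ?_, mobX]
  exact RatFunc.algebraMap_ne_zero (by simpa using hc)

theorem mobX_one : mobX (1 : Matrix (Fin 2) (Fin 2) k) = X := by
  rw [mobX, algebraMap_mobNum, algebraMap_mobDen]; simp

/-- Fractional linear transformations are composed by multiplying their matrices. -/
theorem map_mobX {F : Type*} [FunLike F (RatFunc k) (RatFunc k)]
    [RingHomClass F (RatFunc k) (RatFunc k)] (σ : F) (hC : ∀ c : k, σ (C c) = C c)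
    {M : Matrix (Fin 2) (Fin 2) k} (hM : M.det ≠ 0) (hσ : σ X = mobX M)
    (N : Matrix (Fin 2) (Fin 2) k) : σ (mobX N) = mobX (N * M) := by
  have h0 := algebraMap_mobDen_ne_zero hM
  have key : ∀ a b : k, σ (C a * X + C b) =
      (C (a * M 0 0 + b * M 1 0) * X + C (a * M 0 1 + b * M 1 1)) /
        algebraMap (Polynomial k) (RatFunc k) (mobDen M) := by
    intro a b
    rw [map_add, map_mul, hC, hC, hσ, mobX, eq_div_iff h0, add_mul, mul_assoc, div_mul_cancel₀ _ h0,
      algebraMap_mobNum, algebraMap_mobDen]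
    simp only [map_add, map_mul]
    ring
  rw [mobX, map_div₀, algebraMap_mobNum, algebraMap_mobDen, key, key,
    div_div_div_cancel_right₀ h0, mobX, algebraMap_mobNum, algebraMap_mobDen]
  simp [Matrix.mul_apply, Fin.sum_univ_two]

/-- The substitution of a fractional linear transformation in a form. -/
theorem map_restrictForm {F : Type*} [FunLike F (RatFunc k) (RatFunc k)]
    [RingHomClass F (RatFunc k) (RatFunc k)] (σ : F) (hC : ∀ c : k, σ (C c) = C c)
    {M : Matrix (Fin 2) (Fin 2) k} (hM : M.det ≠ 0) (hσ : σ X = mobX M) (f : Fin (n + 1) → k) :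
    σ (restrictForm f) =
      algebraMap (Polynomial k) (RatFunc k) (formPoly f (mobNum M) (mobDen M)) /
        algebraMap (Polynomial k) (RatFunc k) (mobDen M) ^ n := by
  have h0 := algebraMap_mobDen_ne_zero hM
  rw [restrictForm, map_sum, algebraMap_formPoly, Finset.sum_div]
  refine Finset.sum_congr rfl fun i _ => ?_
  have h1 : algebraMap (Polynomial k) (RatFunc k) (mobDen M) ^ n =
      algebraMap (Polynomial k) (RatFunc k) (mobDen M) ^ (n - (i : ℕ)) *
        algebraMap (Polynomial k) (RatFunc k) (mobDen M) ^ (i : ℕ) := by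
    rw [← pow_add]; congr 1; have := i.2; omega
  rw [map_mul, map_pow, hC, hσ, mobX, h1, div_pow]
  field_simp

/-- A fractional linear transformation fixes the subfield of `W` if and only if the pencil of `W`
is invariant. -/
theorem forall_projField_iff [Infinite k] {F : Type*} [FunLike F (RatFunc k) (RatFunc k)]
    [RingHomClass F (RatFunc k) (RatFunc k)] (σ : F) (hC : ∀ c : k, σ (C c) = C c)
    {M : Matrix (Fin 2) (Fin 2) k} (hM : M.det ≠ 0) (hσ : σ X = mobX M) {W : Grass k n} :
    (∀ x ∈ projField W, σ x = x) ↔ Invariant W M := by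
  have h0 := algebraMap_mobDen_ne_zero hM
  have hev : ∀ (f : Fin (n + 1) → k) t, (formPoly f (mobNum M) (mobDen M)).eval t =
      evalForm n f (M.mulVec ![t, 1]) := by
    intro f t
    rw [eval_formPoly]
    refine congrArg (evalForm n f) ?_
    ext i; fin_cases i <;> simp [mobNum, mobDen]
  have hev' : ∀ (f : Fin (n + 1) → k) t, (formPoly f Polynomial.X 1).eval t =
      evalForm n f ![t, 1] := by
    intro f t
    rw [eval_formPoly]
    simp
  have key : ∀ f h : Fin (n + 1) → k, restrictForm h ≠ 0 →
      (σ (restrictForm f / restrictForm h) = restrictForm f / restrictForm h ↔ ∀ t,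
      evalForm n f (M.mulVec ![t, 1]) * evalForm n h ![t, 1] =
        evalForm n f ![t, 1] * evalForm n h (M.mulVec ![t, 1])) := by
    intro f h hh
    have hσh : σ (restrictForm h) ≠ 0 := (map_ne_zero σ).2 hh
    rw [map_restrictForm σ hC hM hσ] at hσh
    rw [map_div₀, map_restrictForm σ hC hM hσ, map_restrictForm σ hC hM hσ,
      div_div_div_cancel_right₀ (pow_ne_zero _ h0),
      div_eq_div_iff (fun h1 => hσh (by rw [h1, zero_div])) hh, restrictForm_eq, restrictForm_eq,
      ← map_mul, ← map_mul, (RatFunc.algebraMap_injective k).eq_iff]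
    constructor
    · intro H t
      have := congrArg (Polynomial.eval t) H
      simpa only [Polynomial.eval_mul, hev, hev'] using this
    · intro H
      refine Polynomial.funext fun t => ?_
      simpa only [Polynomial.eval_mul, hev, hev'] using H t
  rw [invariant_iff_affine]
  constructor
  · intro H f hf h hh
    by_cases h1 : restrictForm h = 0
    · rw [restrictForm_eq_zero.1 h1]; simp
    · refine (key f h h1).1 (H _ (subset_adjoin _ _ ⟨f, h, ?_, ?_, h1, rfl⟩))
      exacts [mem_pencil.1 hf, mem_pencil.1 hh]
  · intro H x hx
    induction hx using adjoin_induction with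
    | mem x hx =>
      obtain ⟨f, h, hf, hh, hne, rfl⟩ := hx
      exact (key f h hne).2 (H f (mem_pencil.2 hf) h (mem_pencil.2 hh))
    | algebraMap c => exact hC c
    | add x y _ _ hx hy => rw [map_add, hx, hy]
    | inv x _ hx => rw [map_inv₀, hx]
    | mul x y _ _ hx hy => rw [map_mul, hx, hy]

end RationalNormal

end

/-! ### The degree of k(t) over the subfield of a pencil, and its automorphisms -/

noncomputable section

namespace RationalNormal

open RatFunc IntermediateField

variable {k : Type*} [Field k] {n : ℕ}

theorem natDegree_num_div {p q : Polynomial k} (hq : q ≠ 0) (h : IsCoprime p q) :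
    (num (algebraMap (Polynomial k) (RatFunc k) p / algebraMap (Polynomial k) (RatFunc k) q)
      ).natDegree = p.natDegree ∧
    (denom (algebraMap (Polynomial k) (RatFunc k) p / algebraMap (Polynomial k) (RatFunc k) q)
      ).natDegree = q.natDegree := by
  set x := algebraMap (Polynomial k) (RatFunc k) p / algebraMap (Polynomial k) (RatFunc k) q
    with hx
  have h1 : num x ∣ p := num_div_dvd p hq
  have h2 : denom x ∣ q := denom_div_dvd p q
  have h3 : num x * q = p * denom x := by
    have := num_div_denom x
    rw [hx, div_eq_div_iff (RatFunc.algebraMap_ne_zero (denom_ne_zero _))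
      (RatFunc.algebraMap_ne_zero hq), ← map_mul, ← map_mul] at this
    exact RatFunc.algebraMap_injective k this
  have h4 : p ∣ num x := h.dvd_of_dvd_mul_right (h3 ▸ dvd_mul_right _ _)
  have h5 : q ∣ denom x := h.symm.dvd_of_dvd_mul_left (h3 ▸ dvd_mul_left _ _)
  exact ⟨Polynomial.natDegree_eq_of_degree_eq
      (Polynomial.degree_eq_degree_of_associated (associated_of_dvd_dvd h1 h4)),
    Polynomial.natDegree_eq_of_degree_eq
      (Polynomial.degree_eq_degree_of_associated (associated_of_dvd_dvd h2 h5))⟩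

theorem formPoly_coeff (f : Fin (n + 1) → k) : (formPoly f Polynomial.X 1).coeff n = f 0 := by
  rw [formPoly, Polynomial.finsetSum_coeff, Finset.sum_eq_single 0]
  · simp
  · intro i _ hi
    have h0 : (i : ℕ) ≠ 0 := fun h => hi (Fin.ext h)
    have : n ≠ n - (i : ℕ) := by have := i.2; omega
    simp [Polynomial.coeff_X_pow, this]
  · simp

theorem natDegree_formPoly_le (f : Fin (n + 1) → k) :
    (formPoly f Polynomial.X 1).natDegree ≤ n := by
  refine Polynomial.natDegree_sum_le_of_forall_le _ _ fun i _ => ?_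
  rw [one_pow, mul_one]
  exact (Polynomial.natDegree_C_mul_X_pow_le _ _).trans (Nat.sub_le _ _)

theorem projField_eq_adjoin [Infinite k] {W : Grass k n} {L M : Fin (n + 1) → k}
    (hW : W.1 = zeroSpace L M) : projField W = k⟮restrictForm L / restrictForm M⟯ := by
  have hind := linearIndependent_of_eq_zeroSpace hW
  have hM : restrictForm M ≠ 0 := fun h => by
    simpa using hind.ne_zero 1 ((restrictForm_eq_zero.1 h) : M = 0)
  have hp : ∀ f, (∀ w ∈ W.1, f ⬝ᵥ w = 0) ↔ ∃ a b : k, a • L + b • M = f := by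
    intro f
    rw [← Submodule.mem_span_pair, ← pencil_zeroSpace, ← hW]
    exact mem_pencil.symm
  apply le_antisymm
  · rw [projField, adjoin_le_iff]
    rintro _ ⟨f, h, hf, hh, hne, rfl⟩
    have key : ∀ f, (∀ w ∈ W.1, f ⬝ᵥ w = 0) →
        restrictForm f / restrictForm M ∈ k⟮restrictForm L / restrictForm M⟯ := by
      intro f hf
      obtain ⟨a, b, rfl⟩ := (hp f).1 hf
      rw [restrictForm_add, restrictForm_smul, restrictForm_smul, add_div, mul_div_assoc,
        mul_div_assoc, div_self hM, mul_one]
      exact add_mem (mul_mem (IntermediateField.algebraMap_mem _ a) (mem_adjoin_simple_self _ _))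
        (IntermediateField.algebraMap_mem _ b)
    rw [← div_div_div_cancel_right₀ hM (restrictForm f)]
    exact div_mem (key f hf) (key h hh)
  · rw [adjoin_simple_le_iff]
    exact subset_adjoin _ _ ⟨L, M, (hp L).2 ⟨1, 0, by simp⟩, (hp M).2 ⟨0, 1, by simp⟩, hM, rfl⟩

/-- The degree of k(t) over k(p/q) is the larger of the degrees of p and q when they are coprime.
Absence of affine base points gives coprimality, and absence of a base point at (1, 0) gives a
nonzero coefficient of t^n. -/
theorem finrank_projField [IsAlgClosed k] {W : Grass k n} (hW : W ∈ baseFree k n) :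
    Module.finrank (projField W) (RatFunc k) = n := by
  have := IsAlgClosed.instInfinite (K := k)
  obtain ⟨L, M, hLM⟩ := W.exists_rep
  have hind := linearIndependent_of_eq_zeroSpace hLM
  have hne : ∀ f : Fin (n + 1) → k, f ≠ 0 → formPoly f Polynomial.X 1 ≠ 0 := by
    intro f hf h
    apply hf
    rw [← restrictForm_eq_zero, restrictForm_eq, h, map_zero]
  have hbf : ∀ u : Fin 2 → k, u ≠ 0 → evalForm n L u ≠ 0 ∨ evalForm n M u ≠ 0 := by
    intro u hu
    obtain ⟨f, hf, h⟩ := hW u hu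
    rw [hLM, pencil_zeroSpace] at hf
    obtain ⟨a, b, rfl⟩ := Submodule.mem_span_pair.1 hf
    by_contra! h0
    apply h
    simp [h0.1, h0.2]
  have hcop : IsCoprime (formPoly L Polynomial.X 1) (formPoly M Polynomial.X 1) := by
    refine (Polynomial.isCoprime_iff_aeval_ne_zero_of_isAlgClosed k k _ _).2 fun t => ?_
    have := hbf ![t, 1] fun h => by simpa using congrFun h 1
    simpa [Polynomial.coe_aeval_eq_eval, eval_formPoly] using this
  have hfin := finrank_eq_max_natDegree (restrictForm L / restrictForm M)
  obtain ⟨h1, h2⟩ := natDegree_num_div (hne M (hind.ne_zero 1)) hcop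
  rw [← restrictForm_eq, ← restrictForm_eq] at h1 h2
  rw [projField_eq_adjoin hLM, hfin, h1, h2]
  apply le_antisymm (max_le (natDegree_formPoly_le L) (natDegree_formPoly_le M))
  have hlast : ∀ f : Fin (n + 1) → k, evalForm n f ![1, 0] = f 0 := by
    intro f
    rw [evalForm_apply, Finset.sum_eq_single 0]
    · simp
    · intro i _ hi
      have h0 : (i : ℕ) ≠ 0 := fun h => hi (Fin.ext h)
      simp [h0]
    · simp
  have := hbf ![1, 0] fun h => by simpa using congrFun h 0
  rw [hlast, hlast] at this
  rcases this with h | h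
  · exact le_max_of_le_left (Polynomial.le_natDegree_of_ne_zero (by rwa [formPoly_coeff]))
  · exact le_max_of_le_right (Polynomial.le_natDegree_of_ne_zero (by rwa [formPoly_coeff]))

/-- An automorphism of `k(t)` over `k` is a fractional linear transformation. -/
theorem exists_mobX_eq (σ : RatFunc k ≃ₐ[k] RatFunc k) :
    ∃ M : Matrix (Fin 2) (Fin 2) k, M.det ≠ 0 ∧ σ X = mobX M := by
  have htop : k⟮σ X⟯ = ⊤ := by
    have h1 := adjoin_map k {(X : RatFunc k)} (σ : RatFunc k →ₐ[k] RatFunc k)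
    rw [RatFunc.adjoin_X, Set.image_singleton] at h1
    rw [eq_top_iff]
    intro x _
    have : x ∈ IntermediateField.map (σ : RatFunc k →ₐ[k] RatFunc k) ⊤ :=
      ⟨σ.symm x, trivial, σ.apply_symm_apply x⟩
    rwa [h1] at this
  -- The image of X generates k(t), hence has degree one: its numerator and denominator are at most
  -- linear. If they were proportional, the image would be a constant, against injectivity.
  have hdeg := finrank_eq_max_natDegree (σ X)
  rw [htop, IntermediateField.finrank_top] at hdeg
  obtain ⟨a, b, hab⟩ := Polynomial.exists_eq_X_add_C_of_natDegree_le_one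
    ((le_max_left _ _).trans hdeg.symm.le)
  obtain ⟨c, d, hcd⟩ := Polynomial.exists_eq_X_add_C_of_natDegree_le_one
    ((le_max_right _ _).trans hdeg.symm.le)
  have hX : σ X = mobX !![a, b; c, d] := by
    rw [← num_div_denom (σ X), hab, hcd, mobX, mobNum, mobDen]
    simp
  refine ⟨_, fun hdet => ?_, hX⟩
  have hcd0 : ![c, d] ≠ 0 := by
    intro h
    have h0 : c = 0 := congrFun h 0
    have h1 : d = 0 := congrFun h 1
    apply denom_ne_zero (σ X)
    rw [hcd, h0, h1]; simp
  rw [Matrix.det_fin_two_of] at hdet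
  obtain ⟨s, hs⟩ := (bracket_eq_zero_iff (v := ![a, b]) hcd0).1 (by
    simp [bracket]; linear_combination -hdet)
  have hs0 : a = s * c := congrFun hs 0
  have hs1 : b = s * d := congrFun hs 1
  have hnum : num (σ X) = Polynomial.C s * denom (σ X) := by
    rw [hab, hcd, hs0, hs1]; simp; ring
  have h3 : σ X = σ (C s) := by
    rw [← num_div_denom (σ X), hnum, map_mul, mul_div_assoc,
      div_self (RatFunc.algebraMap_ne_zero (denom_ne_zero _)), mul_one, RatFunc.algebraMap_C]
    exact (σ.commutes s).symm
  have h4 := σ.injective h3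
  rw [← RatFunc.algebraMap_X, ← RatFunc.algebraMap_C, (RatFunc.algebraMap_injective k).eq_iff] at h4
  exact Polynomial.X_ne_C s h4

theorem mobX_ne_C {M : Matrix (Fin 2) (Fin 2) k} (hM : M.det ≠ 0) : ¬ ∃ c, mobX M = C c := by
  rintro ⟨c, hc⟩
  rw [mobX, div_eq_iff (algebraMap_mobDen_ne_zero hM), ← RatFunc.algebraMap_C, ← map_mul,
    (RatFunc.algebraMap_injective k).eq_iff, mobNum, mobDen] at hc
  obtain ⟨h1, h2⟩ := linear_eq_zero (a := M 0 0 - c * M 1 0) (b := M 0 1 - c * M 1 1) (by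
    simp only [map_sub, map_mul]; linear_combination hc)
  rw [Matrix.det_fin_two] at hM
  exact hM (by linear_combination M 1 1 * h1 - M 1 0 * h2)

theorem adjoin_mobX {M : Matrix (Fin 2) (Fin 2) k} (hM : M.det ≠ 0) : k⟮mobX M⟯ = ⊤ := by
  rw [eq_top_iff, ← RatFunc.adjoin_X, adjoin_simple_le_iff]
  have h0 := algebraMap_mobDen_ne_zero hM
  have hadj : M.adjugate.det ≠ 0 := det_adjugate_ne_zero hM
  have key : ∀ a b : k, C a * mobX M + C b ∈ k⟮mobX M⟯ := fun a b =>
    add_mem (mul_mem (IntermediateField.algebraMap_mem _ a) (mem_adjoin_simple_self _ _)) (IntermediateField.algebraMap_mem _ b)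
  have hX : X = (C (M 1 1) * mobX M + C (-M 0 1)) / (C (-M 1 0) * mobX M + C (M 0 0)) := by
    have hd : C (M.det) ≠ (0 : RatFunc k) := (map_ne_zero _).2 hM
    have e1 : C (-M 1 0) * mobX M + C (M 0 0) =
        C M.det / algebraMap (Polynomial k) (RatFunc k) (mobDen M) := by
      rw [mobX, eq_div_iff h0, add_mul, mul_assoc, div_mul_cancel₀ _ h0, algebraMap_mobNum,
        algebraMap_mobDen, Matrix.det_fin_two]
      simp only [map_sub, map_mul, map_neg]; ring
    have e2 : C (M 1 1) * mobX M + C (-M 0 1) =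
        X * C M.det / algebraMap (Polynomial k) (RatFunc k) (mobDen M) := by
      rw [mobX, eq_div_iff h0, add_mul, mul_assoc, div_mul_cancel₀ _ h0, algebraMap_mobNum,
        algebraMap_mobDen, Matrix.det_fin_two]
      simp only [map_sub, map_mul, map_neg]; ring
    rw [e1, e2, div_div_div_cancel_right₀ h0, mul_div_assoc, div_self hd, mul_one]
  rw [hX]
  exact div_mem (key _ _) (key _ _)

/-- The automorphism of `k(t)` given by a fractional linear transformation. -/
def mobEquiv (M : Matrix (Fin 2) (Fin 2) k) (hM : M.det ≠ 0) : RatFunc k ≃ₐ[k] RatFunc k :=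
  (algEquivOfTranscendental (mobX M) (transcendental_of_ne_C _ (mobX_ne_C hM))).trans
    ((equivOfEq (adjoin_mobX hM)).trans topEquiv)

theorem mobEquiv_X (M : Matrix (Fin 2) (Fin 2) k) (hM : M.det ≠ 0) : mobEquiv M hM X = mobX M := by
  simp [mobEquiv, algEquivOfTranscendental_X]

theorem ext_of_X {F : Type*} [FunLike F (RatFunc k) (RatFunc k)]
    [RingHomClass F (RatFunc k) (RatFunc k)] (σ τ : F) (hσ : ∀ c : k, σ (C c) = C c)
    (hτ : ∀ c : k, τ (C c) = C c) (h : σ X = τ X) (x : RatFunc k) : σ x = τ x := by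
  have hx : x ∈ k⟮(X : RatFunc k)⟯ := by rw [RatFunc.adjoin_X]; trivial
  induction hx using adjoin_induction with
  | mem x hx => rw [Set.mem_singleton_iff.1 hx, h]
  | algebraMap c => exact (hσ c).trans (hτ c).symm
  | add x y _ _ hx hy => rw [map_add, map_add, hx, hy]
  | inv x _ hx => rw [map_inv₀, map_inv₀, hx]
  | mul x y _ _ hx hy => rw [map_mul, map_mul, hx, hy]

end RationalNormal

end

/-! ### Galois subspaces as invariant base point free pencils -/

noncomputable section

namespace RationalNormal

open RatFunc IntermediateField

variable {k : Type*} [Field k] {n : ℕ}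

theorem ProjRep.det_ne_zero {G : Type*} [Group G] (ρ : ProjRep k G) (g : G) :
    (ρ.toFun g).det ≠ 0 := by
  rw [ρ.det_eq_one]; exact one_ne_zero

theorem ProjRep.mobX_mul {G : Type*} [Group G] (ρ : ProjRep k G) (g h : G) :
    mobX (ρ.toFun g * ρ.toFun h) = mobX (ρ.toFun (g * h)) := by
  obtain ⟨c, hc⟩ := ρ.exists_mul g h
  rw [hc, mobX_smul]
  rintro rfl
  have := congrArg Matrix.det hc
  simp [ρ.det_eq_one] at this

/-- Matrices up to scalar multiples that define a faithful action can be normalised to have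
determinant one. -/
theorem ProjRep.exists_of_det_ne_zero [IsAlgClosed k] {G : Type*} [Group G]
    (M : G → Matrix (Fin 2) (Fin 2) k) (hdet : ∀ g, (M g).det ≠ 0)
    (hmul : ∀ g h, ∃ c : k, M g * M h = c • M (g * h)) (hone : ∀ g (c : k), M g = c • 1 → g = 1) :
    ∃ ρ : ProjRep k G, ∀ g, ∃ c : k, c ≠ 0 ∧ ρ.toFun g = c • M g := by
  have h : ∀ g, ∃ s : k, s ^ 2 = (M g).det := fun g =>
    IsAlgClosed.exists_pow_nat_eq _ two_pos
  choose s hs using h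
  have hs0 : ∀ g, s g ≠ 0 := by
    intro g h0
    apply hdet g
    rw [← hs, h0]; simp
  refine ⟨⟨fun g => (s g)⁻¹ • M g, fun g => ?_, fun g h => ?_, fun g c hg => ?_⟩,
    fun g => ⟨_, inv_ne_zero (hs0 g), rfl⟩⟩
  · rw [Matrix.det_smul, Fintype.card_fin, ← hs, inv_pow, inv_mul_cancel₀ (pow_ne_zero _ (hs0 g))]
  · obtain ⟨c, hc⟩ := hmul g h
    refine ⟨(s g)⁻¹ * (s h)⁻¹ * c * s (g * h), ?_⟩
    rw [Matrix.smul_mul, Matrix.mul_smul, hc, smul_smul, smul_smul, smul_smul]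
    congr 1
    field_simp [hs0]
  · refine hone g (s g * c) ?_
    rw [← smul_smul, ← hg, smul_smul, mul_inv_cancel₀ (hs0 g), one_smul]

/-- The Galois group of a Galois subspace acts faithfully by fractional linear transformations. -/
theorem exists_projRep_of_mem_galoisFamily [IsAlgClosed k] {G : Type*} [Group G] {W : Grass k n}
    (hW : W ∈ galoisFamily k n G) : ∃ ρ : ProjRep k G, ∀ g, Invariant W (ρ.toFun g) := by
  have := IsAlgClosed.instInfinite (K := k)
  obtain ⟨-, -, ⟨e⟩⟩ := hW
  have hC : ∀ (σ : RatFunc k ≃ₐ[projField W] RatFunc k) (c : k), σ (C c) = C c := fun σ c =>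
    (σ.restrictScalars k).commutes c
  -- The inverse compensates for substitution reversing the order of multiplication, so that the
  -- matrices compose as the group elements do.
  have h : ∀ g : G, ∃ M : Matrix (Fin 2) (Fin 2) k, M.det ≠ 0 ∧ e.symm g⁻¹ X = mobX M := fun g =>
    exists_mobX_eq ((e.symm g⁻¹).restrictScalars k)
  choose M hM hX using h
  obtain ⟨ρ, hρ⟩ := ProjRep.exists_of_det_ne_zero M hM (fun g h => by
    refine exists_eq_smul_of_mobX_eq (by rw [Matrix.det_mul]; exact mul_ne_zero (hM g) (hM h))
      (hM _) ?_
    rw [← hX, mul_inv_rev, map_mul, AlgEquiv.mul_apply, hX g,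
      map_mobX _ (hC _) (hM h) (hX h)]) (fun g c hg => by
    have h1 : e.symm g⁻¹ = 1 := by
      refine AlgEquiv.ext (ext_of_X _ _ (hC _) (hC _) ?_)
      rw [hX, hg, mobX_smul, mobX_one]
      · rfl
      · rintro rfl
        apply hM g
        rw [hg]; simp
    rw [← inv_eq_one, ← map_eq_one_iff _ e.symm.injective, h1])
  refine ⟨ρ, fun g => (forall_projField_iff (e.symm g⁻¹) (hC _) (ρ.det_ne_zero g) ?_).1 ?_⟩
  · obtain ⟨c, hc, h⟩ := hρ g
    rw [h, mobX_smul hc, hX]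
  · intro x hx
    exact (e.symm g⁻¹).commutes ⟨x, hx⟩

/-- The group embeds into the automorphisms over the subfield. There are at most `n` of these, the
degree of the extension, and the group already has `n` elements; so equality holds and the extension
is Galois. -/
theorem mem_galoisFamily_of_projRep [IsAlgClosed k] {G : Type*} [Group G] [Finite G]
    (hcard : Nat.card G = n) {W : Grass k n} (hW : W ∈ baseFree k n) (ρ : ProjRep k G)
    (hρ : ∀ g, Invariant W (ρ.toFun g)) : W ∈ galoisFamily k n G := by
  have := IsAlgClosed.instInfinite (K := k)
  have hfix : ∀ g, ∀ x ∈ projField W, mobEquiv (ρ.toFun g) (ρ.det_ne_zero g) x = x := fun g =>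
    (forall_projField_iff _ (mobEquiv (ρ.toFun g) (ρ.det_ne_zero g)).commutes (ρ.det_ne_zero g)
      (mobEquiv_X _ _)).2 (hρ g)
  let σ (g : G) : RatFunc k ≃ₐ[projField W] RatFunc k :=
    AlgEquiv.ofRingEquiv (f := (mobEquiv (ρ.toFun g) (ρ.det_ne_zero g)).toRingEquiv)
      fun x => hfix g x x.2
  have hσX : ∀ g, σ g X = mobX (ρ.toFun g) := fun g =>
    mobEquiv_X (ρ.toFun g) (ρ.det_ne_zero g)
  have hC : ∀ (σ : RatFunc k ≃ₐ[projField W] RatFunc k) (c : k), σ (C c) = C c := fun σ c =>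
    (σ.restrictScalars k).commutes c
  have hmul : ∀ g h, σ g * σ h = σ (h * g) := by
    intro g h
    refine AlgEquiv.ext (ext_of_X _ _ (hC _) (hC _) ?_)
    rw [AlgEquiv.mul_apply, hσX, hσX, map_mobX _ (hC _) (ρ.det_ne_zero g) (hσX g), ρ.mobX_mul]
  let Φ : G →* (RatFunc k ≃ₐ[projField W] RatFunc k) :=
    MonoidHom.mk' (fun g => σ g⁻¹) fun g h => by rw [hmul, mul_inv_rev]
  have hinj : Function.Injective Φ := by
    refine (injective_iff_map_eq_one Φ).2 fun g hg => ?_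
    have h1 : mobX (ρ.toFun g⁻¹) = mobX 1 := by
      rw [← hσX, mobX_one]
      exact congrArg (fun τ : RatFunc k ≃ₐ[projField W] RatFunc k => τ X) hg
    obtain ⟨c, hc⟩ := exists_eq_smul_of_mobX_eq (ρ.det_ne_zero _) (by simp) h1
    exact inv_eq_one.1 (ρ.eq_one _ c hc)
  have hfin := finrank_projField hW
  have hpos : 0 < n := hcard ▸ Nat.card_pos
  have : FiniteDimensional (projField W) (RatFunc k) :=
    FiniteDimensional.of_finrank_pos (hpos.trans_eq hfin.symm)
  have hle : Nat.card (RatFunc k ≃ₐ[projField W] RatFunc k) ≤ Nat.card G := by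
    rw [Nat.card_eq_fintype_card]
    exact AlgEquiv.card_le.trans_eq (hfin.trans hcard.symm)
  have hbij := hinj.bijective_of_nat_card_le hle
  have e := MulEquiv.ofBijective Φ hbij
  refine ⟨(mem_baseFree_iff W).1 hW, IsGalois.of_card_aut_eq_finrank _ _ ?_, ⟨e.symm⟩⟩
  exact (Nat.card_congr e.toEquiv).symm.trans (hcard.trans hfin.symm)

theorem mem_galoisFamily_iff [IsAlgClosed k] {G : Type*} [Group G] [Finite G]
    (hcard : Nat.card G = n) {W : Grass k n} : W ∈ galoisFamily k n G ↔
      W ∈ baseFree k n ∧ ∃ ρ : ProjRep k G, ∀ g, Invariant W (ρ.toFun g) :=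
  ⟨fun h => ⟨(mem_baseFree_iff W).2 h.1, exists_projRep_of_mem_galoisFamily h⟩,
    fun ⟨hW, ρ, hρ⟩ => mem_galoisFamily_of_projRep hcard hW ρ hρ⟩

end RationalNormal

end

/-! ### Existence and uniqueness of the invariant pencil -/

noncomputable section

namespace RationalNormal

variable {k : Type*} [Field k] {n : ℕ}

theorem Invariant.apply_eq_zero {W : Grass k n} {M : Matrix (Fin 2) (Fin 2) k}
    (hM : Invariant W M) (hW : W ∈ baseFree k n) {f : Fin (n + 1) → k} (hf : f ∈ pencil W.1)
    {u : Fin 2 → k} (hu : u ≠ 0) (h : evalForm n f u = 0) : evalForm n f (M.mulVec u) = 0 := by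
  obtain ⟨g, hg, hgu⟩ := hW u hu
  have := hM f hf g hg u
  rw [h, zero_mul] at this
  exact (mul_eq_zero.1 this).resolve_right hgu

theorem finite_affine_zeros {L : Fin (n + 1) → k} (h : L ≠ 0) :
    {t : k | evalForm n L ![t, 1] = 0}.Finite := by
  by_contra hinf
  obtain ⟨s, hs, hcard⟩ := Set.Infinite.exists_subset_card_eq hinf (n + 1)
  refine h (eq_zero_of_card_zeros s (fun t => ![t, 1]) (fun t _ h => ?_) (fun t _ t' _ h => ?_)
    (by omega) fun t ht => hs ht)
  · simpa using congrFun h 1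
  · simpa [bracket] using sub_ne_zero.2 h

/-- Finitely many nonzero forms have a common point where they do not vanish. -/
theorem exists_forall_form_ne_zero [Infinite k] {ι : Type*} [Finite ι] (φ : ι → (Fin 2 → k) → k)
    (d : ι → ℕ) (hφ : ∀ i, IsForm (d i) (φ i)) (h0 : ∀ i, φ i ≠ 0) :
    ∃ u : Fin 2 → k, u ≠ 0 ∧ ∀ i, φ i u ≠ 0 := by
  choose L hL using hφ
  have hfin : (⋃ i, {t : k | evalForm (d i) (L i) ![t, 1] = 0}).Finite :=
    Set.finite_iUnion fun i => finite_affine_zeros fun h => h0 i (by rw [← hL, h, map_zero])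
  obtain ⟨t, ht⟩ := hfin.exists_notMem
  refine ⟨![t, 1], fun h => by simpa using congrFun h 1, fun i hi => ht ?_⟩
  rw [← hL] at hi
  exact Set.mem_iUnion.2 ⟨i, hi⟩

theorem bracket_comm (u v : Fin 2 → k) : bracket u v = -bracket v u := by
  simp only [bracket]; ring

theorem bracket_smul (c : k) (u v : Fin 2 → k) : bracket u (c • v) = c * bracket u v := by
  simp [bracket]; ring

theorem smul_bracket (c : k) (u v : Fin 2 → k) : bracket (c • u) v = c * bracket u v := by
  simp [bracket]; ring

theorem isForm_bracket_mulVec (M : Matrix (Fin 2) (Fin 2) k) :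
    IsForm 2 (fun w => bracket w (M.mulVec w)) := by
  have h1 := (isForm_linear (1 : k) 0).mul (isForm_linear (M 1 0) (M 1 1))
  have h2 := (isForm_linear (0 : k) 1).mul (isForm_linear (M 0 0) (M 0 1))
  convert h1.add (h2.smul (-1)) using 1
  ext w
  simp [bracket, Matrix.mulVec, dotProduct, Fin.sum_univ_two]
  ring

/-- Only scalar matrices have all vectors as eigenvectors. -/
theorem eq_smul_one_of_bracket_mulVec {M : Matrix (Fin 2) (Fin 2) k}
    (h : (fun w => bracket w (M.mulVec w)) = 0) : M = M 0 0 • 1 := by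
  have h1 := congrFun h ![1, 0]
  have h2 := congrFun h ![0, 1]
  have h3 := congrFun h ![1, 1]
  simp [bracket, Matrix.mulVec, dotProduct, Fin.sum_univ_two] at h1 h2 h3
  ext i j; fin_cases i <;> fin_cases j
  · simp
  · simp [h2]
  · simp [h1]
  · simp; linear_combination h3 - h1 + h2

namespace ProjRep

variable {G : Type*} [Group G] (ρ : ProjRep k G)

theorem exists_mul' (g h : G) : ∃ c : k, c ≠ 0 ∧ ρ.toFun g * ρ.toFun h = c • ρ.toFun (g * h) := by
  obtain ⟨c, hc⟩ := ρ.exists_mul g h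
  refine ⟨c, ?_, hc⟩
  rintro rfl
  have := congrArg Matrix.det hc
  simp [ρ.det_eq_one] at this

theorem mulVec_ne_zero (g : G) {u : Fin 2 → k} (hu : u ≠ 0) : (ρ.toFun g).mulVec u ≠ 0 :=
  fun h => hu (Matrix.eq_zero_of_mulVec_eq_zero (ρ.det_ne_zero g) h)

theorem exists_map_one : ∃ c : k, c ≠ 0 ∧ ρ.toFun 1 = c • 1 := by
  obtain ⟨c, hc, h⟩ := ρ.exists_mul' 1 1
  refine ⟨c, hc, ?_⟩
  have h1 := congrArg ((ρ.toFun 1)⁻¹ * ·) h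
  rw [mul_one] at h1
  simpa [← Matrix.mul_assoc, Matrix.nonsing_inv_mul _ (isUnit_iff_ne_zero.2 (ρ.det_ne_zero 1))]
    using h1

theorem bracket_mulVec_eq_zero_iff (g h : G) (w : Fin 2 → k) :
    bracket ((ρ.toFun g).mulVec w) ((ρ.toFun h).mulVec w) = 0 ↔
      bracket w ((ρ.toFun (g⁻¹ * h)).mulVec w) = 0 := by
  obtain ⟨c, hc, h1⟩ := ρ.exists_mul' g (g⁻¹ * h)
  rw [mul_inv_cancel_left] at h1
  have h2 : bracket ((ρ.toFun g).mulVec w) ((ρ.toFun g * ρ.toFun (g⁻¹ * h)).mulVec w) =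
      bracket w ((ρ.toFun (g⁻¹ * h)).mulVec w) := by
    rw [← Matrix.mulVec_mulVec, bracket_mulVec, ρ.det_eq_one, one_mul]
  rw [← h2, h1, Matrix.smul_mulVec, bracket_smul, mul_eq_zero_iff_left hc]

/-- The points with trivial stabilizer. -/
def Generic (w : Fin 2 → k) : Prop :=
  w ≠ 0 ∧ ∀ g, g ≠ 1 → bracket w ((ρ.toFun g).mulVec w) ≠ 0

/-- For g ≠ 1 the matrix is not scalar, so [w, ρ(g) w] is a nonzero quadratic form in w; finitely
many nonzero forms do not exhaust the plane. -/
theorem exists_generic [Infinite k] [Finite G] {f : Fin (n + 1) → k} (hf : f ≠ 0) :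
    ∃ w, ρ.Generic w ∧ evalForm n f w ≠ 0 := by
  obtain ⟨w, hw0, hw⟩ := exists_forall_form_ne_zero (k := k) (ι := Option {g : G // g ≠ 1})
    (fun o => o.elim (evalForm n f) fun g w => bracket w ((ρ.toFun g).mulVec w))
    (fun o => o.elim n fun _ => 2) (fun o => by
      cases o with
      | none => exact ⟨f, rfl⟩
      | some g => exact isForm_bracket_mulVec _) fun o => by
      cases o with
      | none =>
        intro h
        exact hf (evalForm_injective (h.trans (map_zero _).symm))
      | some g =>
        intro h
        exact g.2 (ρ.eq_one _ _ (eq_smul_one_of_bracket_mulVec h))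
  exact ⟨w, ⟨hw0, fun g hg => hw (some ⟨g, hg⟩)⟩, hw none⟩

end ProjRep

theorem exists_mem_pencil_apply_eq_zero (W : Grass k n) (w : Fin 2 → k) :
    ∃ f ∈ pencil W.1, f ≠ 0 ∧ evalForm n f w = 0 := by
  obtain ⟨L, M, hW⟩ := W.exists_rep
  have hind := linearIndependent_of_eq_zeroSpace hW
  rw [hW, pencil_zeroSpace]
  by_cases h : evalForm n L w = 0
  · exact ⟨L, Submodule.subset_span (Set.mem_insert _ _), hind.ne_zero 0, h⟩
  · refine ⟨evalForm n M w • L + (-evalForm n L w) • M, Submodule.mem_span_pair.2 ⟨_, _, rfl⟩,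
      fun h0 => h ?_, ?_⟩
    · exact neg_eq_zero.1 (LinearIndependent.pair_iff.1 hind _ _ h0).2
    · simp; ring

/-- Two forms of invariant pencils that vanish at the same generic point are proportional. -/
theorem mem_pencil_of_generic {G : Type*} [Group G] [Finite G] (hcard : Nat.card G = n)
    [Infinite k] (ρ : ProjRep k G) {W W' : Grass k n} (hW : W ∈ baseFree k n)
    (hW' : W' ∈ baseFree k n) (h : ∀ g, Invariant W (ρ.toFun g))
    (h' : ∀ g, Invariant W' (ρ.toFun g)) {w : Fin 2 → k} (hw : ρ.Generic w)
    {f : Fin (n + 1) → k} (hf : f ∈ pencil W.1) (hfw : evalForm n f w = 0) :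
    f ∈ pencil W'.1 := by
  obtain ⟨f', hf', hne, hfw'⟩ := exists_mem_pencil_apply_eq_zero W' w
  obtain ⟨u, hu⟩ : ∃ u, evalForm n f' u ≠ 0 := by
    by_contra! h0
    exact hne (evalForm_eq_zero h0)
  have := Fintype.ofFinite G
  have hz : ∀ g, evalForm n f ((ρ.toFun g).mulVec w) = 0 := fun g =>
    (h g).apply_eq_zero hW hf hw.1 hfw
  have hz' : ∀ g, evalForm n f' ((ρ.toFun g).mulVec w) = 0 := fun g =>
    (h' g).apply_eq_zero hW' hf' hw.1 hfw'
  have hbu : ∀ g, bracket ((ρ.toFun g).mulVec w) u ≠ 0 := by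
    intro g h0
    obtain ⟨c, rfl⟩ := (bracket_eq_zero_iff (ρ.mulVec_ne_zero g hw.1)).1 h0
    rw [evalForm_smul, hz', mul_zero] at hu
    exact hu rfl
  have hn : n ≠ 0 := by
    rw [← hcard]; exact Nat.card_pos.ne'
  have hu0 : u ≠ 0 := by
    rintro rfl
    simpa [bracket] using hbu 1
  -- This combination vanishes at the `n` distinct points of the orbit of `w` and also at `u`, one
  -- zero more than its degree allows.
  have key : evalForm n f' u • f - evalForm n f u • f' = 0 := by
    refine eq_zero_of_card_zeros (Finset.univ : Finset (Option G))
      (fun o => o.elim u fun g => (ρ.toFun g).mulVec w) ?_ ?_ ?_ ?_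
    · rintro (_ | g) -
      exacts [hu0, ρ.mulVec_ne_zero g hw.1]
    · rintro (_ | g) - (_ | g') - hne
      · exact absurd rfl hne
      · change bracket u _ ≠ 0
        rw [bracket_comm]; exact neg_ne_zero.2 (hbu g')
      · exact hbu g
      · change bracket ((ρ.toFun g).mulVec w) ((ρ.toFun g').mulVec w) ≠ 0
        rw [Ne, ρ.bracket_mulVec_eq_zero_iff]
        refine hw.2 _ fun h1 => hne ?_
        rw [inv_mul_eq_one.1 h1]
    · rw [Finset.card_univ, Fintype.card_option, ← Nat.card_eq_fintype_card, hcard]; omega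
    · rintro (_ | g) -
      · simp; ring
      · change evalForm n _ ((ρ.toFun g).mulVec w) = 0
        rw [map_sub, map_smul, map_smul, Pi.sub_apply, Pi.smul_apply, Pi.smul_apply, hz, hz',
          smul_zero, smul_zero, sub_zero]
  have hf2 : f = (evalForm n f' u)⁻¹ • evalForm n f u • f' := by
    rw [← sub_eq_zero.1 key, smul_smul, inv_mul_cancel₀ hu, one_smul]
  rw [hf2]
  exact Submodule.smul_mem _ _ (Submodule.smul_mem _ _ hf')

/-- An invariant pencil is determined by the projective representation. -/
theorem eq_of_invariant {G : Type*} [Group G] [Finite G] (hcard : Nat.card G = n)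
    [Infinite k] (ρ : ProjRep k G) {W W' : Grass k n} (hW : W ∈ baseFree k n)
    (hW' : W' ∈ baseFree k n) (h : ∀ g, Invariant W (ρ.toFun g))
    (h' : ∀ g, Invariant W' (ρ.toFun g)) : W = W' := by
  obtain ⟨L, -, hL, -⟩ := exists_mem_pencil_apply_eq_zero W 0
  obtain ⟨w, hw, -⟩ := ρ.exists_generic hL
  obtain ⟨f, hf, hf0, hfw⟩ := exists_mem_pencil_apply_eq_zero W w
  -- A second generic point at which the first form does not vanish yields a second, independent
  -- form of the pencil. Both forms also belong to `W'`, so they span both pencils.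
  obtain ⟨w', hw', hfw'⟩ := ρ.exists_generic hf0
  obtain ⟨f', hf', hf0', hfw''⟩ := exists_mem_pencil_apply_eq_zero W w'
  have hind : LinearIndependent k ![f, f'] := by
    rw [LinearIndependent.pair_iff]
    intro s t hst
    have h1 := congrFun (congrArg (evalForm n) hst) w'
    simp [hfw''] at h1
    have hs : s = 0 := h1.resolve_right hfw'
    rw [hs, zero_smul, zero_add] at hst
    exact ⟨hs, (smul_eq_zero.1 hst).resolve_right hf0'⟩
  have key : ∀ V : Grass k n, f ∈ pencil V.1 → f' ∈ pencil V.1 →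
      Submodule.span k {f, f'} = pencil V.1 := by
    intro V hfV hfV'
    refine Submodule.eq_of_le_of_finrank_eq ?_ ?_
    · rw [Submodule.span_le]
      rintro _ (rfl | rfl)
      exacts [hfV, hfV']
    · rw [finrank_pencil, finrank_span_pair_eq_two_iff.2 hind]
  apply Grass.ext_pencil
  rw [← key W hf hf', ← key W' (mem_pencil_of_generic hcard ρ hW hW' h h' hw hf hfw)
    (mem_pencil_of_generic hcard ρ hW hW' h h' hw' hf' hfw'')]

/-- Every projective representation has an invariant base point free pencil. -/
theorem exists_invariant {G : Type*} [Group G] [Finite G] (hcard : Nat.card G = n)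
    [Infinite k] (ρ : ProjRep k G) :
    ∃ W ∈ baseFree k n, ∀ g, Invariant W (ρ.toFun g) := by
  have := Fintype.ofFinite G
  -- The form whose zeros are the orbit of `w`, counted with multiplicity.
  have hF : ∀ w, ∃ L : Fin (n + 1) → k, ∀ u, evalForm n L u =
      ∏ g, bracket ((ρ.toFun g).mulVec w) u := by
    intro w
    have h := IsForm.prod (Finset.univ : Finset G)
      (fun g => bracket ((ρ.toFun g).mulVec w)) fun g _ => isForm_bracket _
    rw [Finset.card_univ, ← Nat.card_eq_fintype_card, hcard] at h
    obtain ⟨L, hL⟩ := h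
    exact ⟨L, fun u => by rw [hL, Finset.prod_apply]⟩
  choose F hF using hF
  have hF0 : ∀ w : Fin 2 → k, w ≠ 0 → ∃ u, u ≠ 0 ∧ evalForm n (F w) u ≠ 0 := by
    intro w hw
    obtain ⟨u, hu0, hu⟩ := exists_forall_form_ne_zero (fun g => bracket ((ρ.toFun g).mulVec w))
      (fun _ => 1) (fun g => isForm_bracket _) fun g h => by
        have h1 := congrFun h ![1, 0]
        have h2 := congrFun h ![0, 1]
        simp only [bracket, Matrix.cons_val_zero, Matrix.cons_val_one, Pi.zero_apply] at h1 h2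
        refine ρ.mulVec_ne_zero g hw (funext fun i => ?_)
        fin_cases i
        · change ((ρ.toFun g).mulVec w) 0 = 0
          linear_combination h2
        · change ((ρ.toFun g).mulVec w) 1 = 0
          linear_combination -h1
    exact ⟨u, hu0, by rw [hF]; exact Finset.prod_ne_zero_iff.2 fun g _ => hu g⟩
  -- Translation by `h` permutes the factors up to scalars that do not depend on `w`. As `κ` is the
  -- same for all these forms, any two of them span an invariant pencil.
  have hequi : ∀ h : G, ∃ κ : k, κ ≠ 0 ∧ ∀ w u,
      evalForm n (F w) ((ρ.toFun h).mulVec u) = κ * evalForm n (F w) u := by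
    intro h
    choose c hc0 hc using fun g => ρ.exists_mul' h (h⁻¹ * g)
    refine ⟨∏ g, (c g)⁻¹, Finset.prod_ne_zero_iff.2 fun g _ => inv_ne_zero (hc0 g), fun w u => ?_⟩
    rw [hF, hF, ← Equiv.prod_comp (Equiv.mulLeft h⁻¹) fun g => bracket ((ρ.toFun g).mulVec w) u,
      ← Finset.prod_mul_distrib]
    refine Finset.prod_congr rfl fun g _ => ?_
    have h1 := hc g
    rw [mul_inv_cancel_left] at h1
    have h2 : bracket ((ρ.toFun h * ρ.toFun (h⁻¹ * g)).mulVec w) ((ρ.toFun h).mulVec u) =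
        bracket ((ρ.toFun (h⁻¹ * g)).mulVec w) u := by
      rw [← Matrix.mulVec_mulVec, bracket_mulVec, ρ.det_eq_one, one_mul]
    rw [Equiv.coe_mulLeft, ← h2, h1, Matrix.smul_mulVec, smul_bracket, ← mul_assoc,
      inv_mul_cancel₀ (hc0 g), one_mul]
  have hw : (![1, 0] : Fin 2 → k) ≠ 0 := fun h => by simpa using congrFun h 0
  obtain ⟨w', hw', hne⟩ := hF0 _ hw
  set w : Fin 2 → k := ![1, 0]
  have hdiag : evalForm n (F w') w' = 0 := by
    rw [hF]
    refine Finset.prod_eq_zero (Finset.mem_univ 1) ?_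
    obtain ⟨c, -, hc⟩ := ρ.exists_map_one
    rw [hc, Matrix.smul_mulVec, Matrix.one_mulVec, smul_bracket, bracket]
    ring
  have hind : LinearIndependent k ![F w, F w'] := by
    rw [LinearIndependent.pair_iff]
    intro s t hst
    have h1 := congrFun (congrArg (evalForm n) hst) w'
    simp [hdiag] at h1
    have hs : s = 0 := h1.resolve_right hne
    rw [hs, zero_smul, zero_add] at hst
    refine ⟨hs, (smul_eq_zero.1 hst).resolve_right fun h0 => ?_⟩
    obtain ⟨u, -, hu⟩ := hF0 w' hw'
    rw [h0] at hu
    simp at hu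
  have hpencil : pencil (Grass.mk _ _ hind).1 = Submodule.span k {F w, F w'} :=
    pencil_zeroSpace _ _
  refine ⟨Grass.mk _ _ hind, fun u hu => ?_, fun h f hf f' hf' u => ?_⟩
  · rw [hpencil]
    by_contra! h0
    have h1 := h0 _ (Submodule.subset_span (Set.mem_insert _ _))
    have h2 := h0 _ (Submodule.subset_span (Set.mem_insert_of_mem _ (Set.mem_singleton _)))
    -- A zero of `F w'` is proportional to a point of the orbit of `w'`. There `F w` does not
    -- vanish, since it does not vanish at `w'` and is semi-invariant.
    rw [hF, Finset.prod_eq_zero_iff] at h2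
    obtain ⟨g, -, hg⟩ := h2
    obtain ⟨c, rfl⟩ := (bracket_eq_zero_iff (ρ.mulVec_ne_zero g hw')).1 hg
    obtain ⟨κ, hκ, hκ'⟩ := hequi g
    have hc : c ≠ 0 := by rintro rfl; exact hu (zero_smul _ _)
    rw [evalForm_smul, hκ'] at h1
    exact mul_ne_zero (pow_ne_zero _ hc) (mul_ne_zero hκ hne) h1
  · obtain ⟨κ, -, hκ⟩ := hequi h
    have hκ' : ∀ f ∈ pencil (Grass.mk _ _ hind).1,
        evalForm n f ((ρ.toFun h).mulVec u) = κ * evalForm n f u := by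
      intro f hf
      rw [hpencil] at hf
      obtain ⟨a, b, rfl⟩ := Submodule.mem_span_pair.1 hf
      simp only [map_add, map_smul, Pi.add_apply, Pi.smul_apply, hκ, smul_eq_mul]
      ring
    rw [hκ' f hf, hκ' f' hf']
    ring

end RationalNormal

end

/-! ### Normal form of a Klein four group in PGL₂ -/

noncomputable section

namespace RationalNormal

variable {k : Type*} [Field k] {n : ℕ}

theorem Invariant.comp [Infinite k] {W : Grass k n} {M : Matrix (Fin 2) (Fin 2) k}
    (h : Invariant W M) {P : Matrix (Fin 2) (Fin 2) k} (hP : P.det ≠ 0) :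
    Invariant (W.comp P hP) (P⁻¹ * M * P) := by
  intro f hf g hg u
  rw [Grass.pencil_comp] at hf hg
  obtain ⟨f, hf, rfl⟩ := hf
  obtain ⟨g, hg, rfl⟩ := hg
  have h1 : P.mulVec ((P⁻¹ * M * P).mulVec u) = M.mulVec (P.mulVec u) := by
    rw [Matrix.mulVec_mulVec, Matrix.mulVec_mulVec, ← Matrix.mul_assoc, ← Matrix.mul_assoc,
      Matrix.mul_nonsing_inv _ (isUnit_iff_ne_zero.2 hP), Matrix.one_mul]
  simp only [evalForm_compLin, h1]
  exact h f hf g hg _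

namespace ProjRep

variable {G : Type*} [Group G] (ρ : ProjRep k G)

/-- A conjugate of a projective representation. -/
def conj (P : Matrix (Fin 2) (Fin 2) k) (hP : P.det ≠ 0) : ProjRep k G where
  toFun g := P⁻¹ * ρ.toFun g * P
  det_eq_one g := by
    rw [Matrix.det_conj' ((Matrix.isUnit_iff_isUnit_det P).2 (isUnit_iff_ne_zero.2 hP)),
      ρ.det_eq_one]
  exists_mul g h := by
    obtain ⟨c, hc⟩ := ρ.exists_mul g h
    refine ⟨c, ?_⟩
    have hP' := Matrix.mul_nonsing_inv P (isUnit_iff_ne_zero.2 hP)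
    calc P⁻¹ * ρ.toFun g * P * (P⁻¹ * ρ.toFun h * P)
        = P⁻¹ * (ρ.toFun g * (P * P⁻¹) * ρ.toFun h) * P := by simp only [Matrix.mul_assoc]
      _ = c • (P⁻¹ * ρ.toFun (g * h) * P) := by
        rw [hP', Matrix.mul_one, hc, Matrix.mul_smul, Matrix.smul_mul]
  eq_one g c hg := by
    refine ρ.eq_one g c ?_
    have hP' := Matrix.mul_nonsing_inv P (isUnit_iff_ne_zero.2 hP)
    calc ρ.toFun g = (P * P⁻¹) * ρ.toFun g * (P * P⁻¹) := by rw [hP']; simp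
      _ = P * (P⁻¹ * ρ.toFun g * P) * P⁻¹ := by simp only [Matrix.mul_assoc]
      _ = c • 1 := by rw [hg, Matrix.mul_smul, Matrix.mul_one, Matrix.smul_mul, hP']

theorem exists_mul_sq (g h : G) :
    ∃ c : k, c ^ 2 = 1 ∧ ρ.toFun g * ρ.toFun h = c • ρ.toFun (g * h) := by
  obtain ⟨c, hc⟩ := ρ.exists_mul g h
  refine ⟨c, ?_, hc⟩
  have h1 := congrArg Matrix.det hc
  rw [Matrix.det_mul, Matrix.det_smul, ρ.det_eq_one, ρ.det_eq_one, ρ.det_eq_one,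
    Fintype.card_fin] at h1
  simpa using h1.symm

/-- The matrix is not scalar but its square is, so by Cayley–Hamilton its trace vanishes; the
determinant is one. -/
theorem mul_self_eq_neg_one {g : G} (hg : g ≠ 1) (h : g * g = 1) :
    ρ.toFun g * ρ.toFun g = -1 := by
  obtain ⟨c, -, hc⟩ := ρ.exists_mul' g g
  obtain ⟨d, -, hd⟩ := ρ.exists_map_one
  rw [h, hd, smul_smul] at hc
  have hdet := ρ.det_eq_one g
  rw [Matrix.det_fin_two] at hdet
  set M := ρ.toFun g with hM
  have hCH : M * M = (M 0 0 + M 1 1) • M - 1 := by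
    ext i j; fin_cases i <;> fin_cases j <;>
      simp [Matrix.mul_apply, Fin.sum_univ_two] <;> first | linear_combination -hdet | ring
  have htr : M 0 0 + M 1 1 = 0 := by
    by_contra hne
    refine hg (ρ.eq_one g ((M 0 0 + M 1 1)⁻¹ * (c * d + 1)) ?_)
    have h1 : (M 0 0 + M 1 1) • M = (c * d + 1) • 1 := by
      have h2 : (M 0 0 + M 1 1) • M = M * M + 1 := by rw [hCH, sub_add_cancel]
      rw [h2, hc, add_smul, one_smul]
    rw [← smul_smul, ← h1, smul_smul, inv_mul_cancel₀ hne, one_smul]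
  rw [hCH, htr, zero_smul, zero_sub]

/-- The two products agree up to sign. If the matrices commuted, their product would have square 1;
but `x * y` is an involution too, so that square is -1. -/
theorem anticomm (h2 : (2 : k) ≠ 0) {x y : G} (hx : x ≠ 1) (hy : y ≠ 1) (hxy : x ≠ y)
    (hxx : x * x = 1) (hyy : y * y = 1) (hc : x * y = y * x) :
    ρ.toFun x * ρ.toFun y = -(ρ.toFun y * ρ.toFun x) := by
  obtain ⟨c, hc1, h1⟩ := ρ.exists_mul_sq x y
  obtain ⟨d, hd1, h3⟩ := ρ.exists_mul_sq y x
  rw [← hc] at h3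
  have hA := ρ.mul_self_eq_neg_one hx hxx
  have hB := ρ.mul_self_eq_neg_one hy hyy
  have hAB := ρ.mul_self_eq_neg_one (g := x * y)
    (fun h => hxy (by rw [← mul_one x, ← hyy, ← mul_assoc, h, one_mul]))
    (by rw [mul_assoc, ← mul_assoc y, ← hc, mul_assoc, hyy, mul_one, hxx])
  have hcd : (c - d) * (c + d) = 0 := by linear_combination hc1 - hd1
  rcases mul_eq_zero.1 hcd with h | h
  · exfalso
    rw [← sub_eq_zero.1 h, ← h1] at h3
    have h4 : ρ.toFun x * ρ.toFun y * (ρ.toFun x * ρ.toFun y) = 1 := by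
      nth_rewrite 2 [← h3]
      rw [Matrix.mul_assoc, ← Matrix.mul_assoc (ρ.toFun y), hB, Matrix.neg_mul, Matrix.one_mul,
        Matrix.mul_neg, hA, neg_neg]
    rw [h1, Matrix.smul_mul, Matrix.mul_smul, smul_smul, ← pow_two, hc1, one_smul, hAB] at h4
    have h5 := congrFun (congrFun h4 0) 0
    simp at h5
    exact h2 (by linear_combination -h5)
  · rw [h1, h3, ← neg_smul, eq_neg_of_add_eq_zero_left h]

theorem pow_eq_smul (g : G) (m : ℕ) :
    ∃ c : k, c ^ 2 = 1 ∧ ρ.toFun g ^ (m + 1) = c • ρ.toFun (g ^ (m + 1)) := by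
  induction m with
  | zero => exact ⟨1, by simp, by simp⟩
  | succ m ih =>
    obtain ⟨c, hc, h⟩ := ih
    obtain ⟨d, hd, h'⟩ := ρ.exists_mul_sq (g ^ (m + 1)) g
    refine ⟨c * d, by rw [mul_pow, hc, hd, one_mul], ?_⟩
    rw [pow_succ, h, Matrix.smul_mul, h', smul_smul, pow_succ g (m + 1)]

/-- The power with exponent |G| is a scalar whose square is one; the factor 2 removes this sign. -/
theorem pow_card [Finite G] (g : G) : ρ.toFun g ^ (2 * Nat.card G) = 1 := by
  obtain ⟨m, hm⟩ : ∃ m, Nat.card G = m + 1 := ⟨_, (Nat.succ_pred Nat.card_pos.ne').symm⟩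
  obtain ⟨c, hc, h⟩ := ρ.pow_eq_smul g m
  obtain ⟨d, -, hd⟩ := ρ.exists_map_one
  have hd1 : d ^ 2 = 1 := by
    have := congrArg Matrix.det hd
    rw [ρ.det_eq_one, Matrix.det_smul, Fintype.card_fin] at this
    simpa using this.symm
  rw [← hm, pow_card_eq_one', hd] at h
  rw [mul_comm, pow_mul, h, pow_two, Matrix.smul_mul, Matrix.mul_smul, Matrix.smul_mul,
    Matrix.mul_smul, Matrix.one_mul, smul_smul, smul_smul, smul_smul]
  rw [show c * c * d * d = c ^ 2 * d ^ 2 by ring, hc, hd1, one_mul, one_smul]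

end ProjRep

/-- The standard matrices of two commuting involutions. -/
def involX (i : k) : Matrix (Fin 2) (Fin 2) k := !![i, 0; 0, -i]

/-- The second of the two standard matrices. -/
def involY (i : k) : Matrix (Fin 2) (Fin 2) k := !![0, i; i, 0]

/-- Use an eigenvector v of `A` for the eigenvalue i and -i • B v as basis. By anticommutation `B`
interchanges the eigenspaces of `A`, and the factor -i makes `B` equal to the standard matrix. -/
theorem exists_conj_invol (h2 : (2 : k) ≠ 0) {i : k} (hi : i ^ 2 = -1)
    {A B : Matrix (Fin 2) (Fin 2) k} (hA : A * A = -1) (hB : B * B = -1)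
    (hAB : A * B = -(B * A)) :
    ∃ P : Matrix (Fin 2) (Fin 2) k,
      P.det ≠ 0 ∧ P⁻¹ * A * P = involX i ∧ P⁻¹ * B * P = involY i := by
  have hi0 : i ≠ 0 := by rintro rfl; simp at hi
  have hBB : ∀ u, B.mulVec (B.mulVec u) = -u := by
    intro u
    rw [Matrix.mulVec_mulVec, hB, Matrix.neg_mulVec, Matrix.one_mulVec]
  have hsum : A + i • 1 ≠ 0 := by
    intro h
    have hA' : A = (-i) • 1 := by rw [neg_smul]; exact eq_neg_of_add_eq_zero_left h
    rw [hA', Matrix.smul_mul, Matrix.mul_smul, Matrix.one_mul, Matrix.mul_one] at hAB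
    have h3 : (2 * -i) • B = 0 := by
      rw [mul_smul, two_smul]; nth_rewrite 1 [hAB]; simp
    have hB0 := (smul_eq_zero.1 h3).resolve_left (mul_ne_zero h2 (neg_ne_zero.2 hi0))
    rw [hB0] at hB
    have := congrFun (congrFun hB 0) 0
    simp at this
  -- Since A² = -1, we have A(A + i) = i(A + i), so every nonzero vector in the image of A + i is an
  -- eigenvector for i.
  obtain ⟨w₀, hw₀⟩ : ∃ w₀, (A + i • 1).mulVec w₀ ≠ 0 := by
    by_contra! h
    exact hsum (Matrix.mulVec_injective (funext fun u => by rw [h u, Matrix.zero_mulVec]))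
  set v := (A + i • 1).mulVec w₀ with hv
  have hAv : A.mulVec v = i • v := by
    rw [hv, Matrix.mulVec_mulVec, Matrix.mul_add, hA, Matrix.mul_smul, Matrix.mul_one,
      ← Matrix.smul_mulVec, smul_add, smul_smul, ← pow_two, hi, neg_smul, one_smul, add_comm]
  set w := (-i) • B.mulVec v with hw
  have hAw : A.mulVec w = (-i) • w := by
    have h1 : A.mulVec (B.mulVec v) = -(i • B.mulVec v) := by
      rw [Matrix.mulVec_mulVec, hAB, Matrix.neg_mulVec, ← Matrix.mulVec_mulVec, hAv,
        Matrix.mulVec_smul]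
    rw [hw, Matrix.mulVec_smul, h1, neg_smul i ((-i) • _), smul_neg, smul_comm i]
  have hBv : B.mulVec v = i • w := by
    rw [hw, smul_smul, mul_neg, ← pow_two, hi, neg_neg, one_smul]
  have hBw : B.mulVec w = i • v := by
    rw [hw, Matrix.mulVec_smul, hBB, smul_neg, neg_smul, neg_neg]
  let P : Matrix (Fin 2) (Fin 2) k := !![v 0, w 0; v 1, w 1]
  have hP : P.det ≠ 0 := by
    rw [Matrix.det_fin_two_of]
    intro h
    obtain ⟨c, hc⟩ := (bracket_eq_zero_iff (v := w) hw₀).1 (by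
      rw [bracket]; linear_combination h)
    rw [hc, Matrix.mulVec_smul, hAv, smul_smul, smul_smul] at hAw
    have h3 : (2 * i * c) • v = 0 := by
      have : 2 * i * c = c * i - -i * c := by ring
      rw [this, sub_smul, hAw, sub_self]
    have hc0 := (mul_eq_zero.1 ((smul_eq_zero.1 h3).resolve_right hw₀)).resolve_left
      (mul_ne_zero h2 hi0)
    rw [hc, hc0, zero_smul, smul_zero] at hBv
    have := hBB v
    rw [hBv, Matrix.mulVec_zero] at this
    exact hw₀ (neg_eq_zero.1 this.symm)
  have hPu : IsUnit P.det := isUnit_iff_ne_zero.2 hP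
  have hAP : A * P = P * involX i := by
    have e1 := congrFun hAv 0
    have e2 := congrFun hAv 1
    have e3 := congrFun hAw 0
    have e4 := congrFun hAw 1
    simp only [Matrix.mulVec, dotProduct, Fin.sum_univ_two, Pi.smul_apply, smul_eq_mul]
      at e1 e2 e3 e4
    ext r s; fin_cases r <;> fin_cases s <;>
      simp [P, involX, Matrix.mul_apply, Fin.sum_univ_two] <;>
      first | linear_combination e1 | linear_combination e2 | linear_combination e3 |
        linear_combination e4
  have hBP : B * P = P * involY i := by
    have e1 := congrFun hBv 0
    have e2 := congrFun hBv 1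
    have e3 := congrFun hBw 0
    have e4 := congrFun hBw 1
    simp only [Matrix.mulVec, dotProduct, Fin.sum_univ_two, Pi.smul_apply, smul_eq_mul]
      at e1 e2 e3 e4
    ext r s; fin_cases r <;> fin_cases s <;>
      simp [P, involY, Matrix.mul_apply, Fin.sum_univ_two] <;>
      first | linear_combination e1 | linear_combination e2 | linear_combination e3 |
        linear_combination e4
  refine ⟨P, hP, ?_, ?_⟩
  · rw [Matrix.mul_assoc, hAP, ← Matrix.mul_assoc, Matrix.nonsing_inv_mul _ hPu, Matrix.one_mul]
  · rw [Matrix.mul_assoc, hBP, ← Matrix.mul_assoc, Matrix.nonsing_inv_mul _ hPu, Matrix.one_mul]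

end RationalNormal

end

/-! ### Finiteness of the normalized Galois subspaces -/

noncomputable section

namespace RationalNormal

variable {k : Type*} [Field k] {n : ℕ}

/-- An eigenvalue l of a matrix with `M ^ m = 1` is an `m`-th root of unity; the determinant being
one, the other eigenvalue is l⁻¹. -/
theorem exists_trace_eq_add_inv [IsAlgClosed k] (h2 : (2 : k) ≠ 0)
    {M : Matrix (Fin 2) (Fin 2) k} (hdet : M.det = 1) {m : ℕ} (hm : M ^ m = 1) :
    ∃ l : k, l ^ m = 1 ∧ M.trace = l + l⁻¹ := by
  obtain ⟨s, hs⟩ := IsAlgClosed.exists_pow_nat_eq (M.trace ^ 2 - 4) (n := 2) two_pos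
  obtain ⟨l, hl⟩ : ∃ l : k, l ^ 2 - M.trace * l + 1 = 0 := by
    refine ⟨(M.trace + s) / 2, ?_⟩
    field_simp
    linear_combination hs
  have hl0 : l ≠ 0 := by rintro rfl; simp at hl
  have hsing : (M - l • 1).det = 0 := by
    rw [Matrix.det_fin_two] at hdet ⊢
    rw [Matrix.trace_fin_two] at hl
    simp
    linear_combination hl + hdet
  obtain ⟨v, hv, hMv⟩ := Matrix.exists_mulVec_eq_zero_iff.2 hsing
  rw [Matrix.sub_mulVec, Matrix.smul_mulVec, Matrix.one_mulVec, sub_eq_zero] at hMv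
  have hpow : ∀ j : ℕ, (M ^ j).mulVec v = l ^ j • v := by
    intro j
    induction j with
    | zero => simp
    | succ j ih => rw [pow_succ, ← Matrix.mulVec_mulVec, hMv, Matrix.mulVec_smul, ih, smul_smul,
        pow_succ']
  refine ⟨l, ?_, ?_⟩
  · have h := hpow m
    rw [hm, Matrix.one_mulVec, eq_comm, ← sub_eq_zero] at h
    nth_rewrite 2 [← one_smul k v] at h
    rw [← sub_smul] at h
    exact sub_eq_zero.1 ((smul_eq_zero.1 h).resolve_right hv)
  · field_simp
    linear_combination -hl

/-- The possible traces of the matrices of order dividing `m` and determinant one. -/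
def traceSet (k : Type*) [Field k] (m : ℕ) : Set k := (fun l => l + l⁻¹) '' {l : k | l ^ m = 1}

theorem finite_traceSet {m : ℕ} (hm : 0 < m) : (traceSet k m).Finite := by
  classical
  refine Set.Finite.image _ (Set.Finite.subset (Polynomial.nthRoots m (1 : k)).toFinset.finite_toSet
    fun l hl => ?_)
  rw [Finset.mem_coe, Multiset.mem_toFinset, Polynomial.mem_nthRoots hm]
  exact hl

/-- The matrices whose products with the standard matrices of a Klein four group have traces in
`traceSet k m`. -/
def matrixSet (i : k) (m : ℕ) : Set (Matrix (Fin 2) (Fin 2) k) :=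
  {A | A.trace ∈ traceSet k m ∧ (A * involX i).trace ∈ traceSet k m ∧
    (A * involY i).trace ∈ traceSet k m ∧ (A * involX i * involY i).trace ∈ traceSet k m}

/-- When 2 ≠ 0, the identity, the two standard matrices and their product form a basis of the matrix
algebra, so the four traces determine the matrix; each has finitely many possible values. -/
theorem finite_matrixSet (h2 : (2 : k) ≠ 0) {i : k} (hi : i ^ 2 = -1) {m : ℕ} (hm : 0 < m) :
    (matrixSet i m).Finite := by
  have hi0 : i ≠ 0 := by rintro rfl; simp at hi
  have hE := finite_traceSet (k := k) hm
  have hinj : Function.Injective fun A : Matrix (Fin 2) (Fin 2) k =>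
      (A.trace, (A * involX i).trace, (A * involY i).trace, (A * involX i * involY i).trace) := by
    intro A B h
    simp only [Prod.mk.injEq, involX, involY, Matrix.trace_fin_two, Matrix.mul_apply,
      Fin.sum_univ_two, Matrix.of_apply, Matrix.cons_val', Matrix.cons_val_zero,
      Matrix.cons_val_one, Matrix.cons_val_fin_one, mul_zero, add_zero, zero_add] at h
    obtain ⟨h1, h3, h4, h5⟩ := h
    have h2i : 2 * i ≠ 0 := mul_ne_zero h2 hi0
    ext r s; fin_cases r <;> fin_cases s <;> refine mul_left_cancel₀ h2i ?_
    · change 2 * i * A 0 0 = 2 * i * B 0 0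
      linear_combination i * h1 + h3
    · change 2 * i * A 0 1 = 2 * i * B 0 1
      linear_combination h4 + i * h5 + i * hi * (A 0 1 - B 0 1 - A 1 0 + B 1 0)
    · change 2 * i * A 1 0 = 2 * i * B 1 0
      linear_combination h4 - i * h5 - i * hi * (A 0 1 - B 0 1 - A 1 0 + B 1 0)
    · change 2 * i * A 1 1 = 2 * i * B 1 1
      linear_combination i * h1 - h3
  exact ((hE.prod (hE.prod (hE.prod hE))).preimage hinj.injOn).subset
    fun A hA => ⟨hA.1, hA.2.1, hA.2.2.1, hA.2.2.2⟩

namespace ProjRep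

variable {G : Type*} [Group G] (ρ : ProjRep k G)

theorem trace_mem [IsAlgClosed k] [Finite G] (h2 : (2 : k) ≠ 0) {c : k} (hc : c ^ 2 = 1) (g : G) :
    (c • ρ.toFun g).trace ∈ traceSet k (2 * Nat.card G) := by
  obtain ⟨l, hl, h⟩ := exists_trace_eq_add_inv h2 (M := c • ρ.toFun g) (m := 2 * Nat.card G)
    (by rw [Matrix.det_smul, Fintype.card_fin, hc, ρ.det_eq_one, one_mul])
    (by rw [smul_pow, ρ.pow_card, pow_mul, hc, one_pow, one_smul])
  exact ⟨l, hl, h.symm⟩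

theorem toFun_mem_matrixSet [IsAlgClosed k] [Finite G] (h2 : (2 : k) ≠ 0) {i : k} {x y : G}
    (hx : ρ.toFun x = involX i) (hy : ρ.toFun y = involY i) (g : G) :
    ρ.toFun g ∈ matrixSet i (2 * Nat.card G) := by
  obtain ⟨c, hc, h1⟩ := ρ.exists_mul_sq g x
  obtain ⟨d, hd, h3⟩ := ρ.exists_mul_sq g y
  obtain ⟨e, he, h4⟩ := ρ.exists_mul_sq (g * x) y
  refine ⟨?_, ?_, ?_, ?_⟩
  · simpa using ρ.trace_mem h2 (one_pow 2) g
  · rw [← hx, h1]; exact ρ.trace_mem h2 hc _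
  · rw [← hy, h3]; exact ρ.trace_mem h2 hd _
  · rw [← hx, ← hy, h1, Matrix.smul_mul, h4, smul_smul]
    exact ρ.trace_mem h2 (by rw [mul_pow, hc, he, one_mul]) _

end ProjRep

/-- The Galois subspaces for which the involutions `x` and `y` have the standard matrices. -/
def normalized (k : Type*) [Field k] (n : ℕ) {G : Type*} [Group G] (i : k) (x y : G) :
    Set (Grass k n) :=
  {W | W ∈ baseFree k n ∧ ∃ ρ : ProjRep k G, (∀ g, Invariant W (ρ.toFun g)) ∧
    ρ.toFun x = involX i ∧ ρ.toFun y = involY i}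

/-- A normalized representation takes values in a finite set of matrices, and it determines its
invariant pencil. -/
theorem finite_normalized [IsAlgClosed k] {G : Type*} [Group G] [Finite G]
    (hcard : Nat.card G = n) (h2 : (2 : k) ≠ 0) {i : k} (hi : i ^ 2 = -1) (x y : G) :
    (normalized k n i x y).Finite := by
  have := IsAlgClosed.instInfinite (K := k)
  have hpi : (Set.pi Set.univ fun _ : G => matrixSet i (2 * Nat.card G)).Finite :=
    Set.Finite.pi fun _ => finite_matrixSet h2 hi (Nat.mul_pos two_pos Nat.card_pos)
  refine (hpi.biUnion (t := fun M => {W | W ∈ baseFree k n ∧ ∃ ρ : ProjRep k G, ρ.toFun = M ∧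
    ∀ g, Invariant W (M g)}) fun M _ => Set.Subsingleton.finite ?_).subset ?_
  · rintro W ⟨hW, ρ, rfl, h⟩ W' ⟨hW', -, -, h'⟩
    exact eq_of_invariant hcard ρ hW hW' h h'
  · rintro W ⟨hW, ρ, h, hx, hy⟩
    exact Set.mem_biUnion (fun g _ => ρ.toFun_mem_matrixSet h2 hx hy g) ⟨hW, ρ, rfl, h⟩

/-- The zero of a power of a linear form would be a single point fixed by both standard involutions;
but the first fixes only the two coordinate points, and the second interchanges them. -/
theorem noPower_of_mem_normalized {G : Type*} [Group G] [Finite G]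
    (hcard : Nat.card G = n) (h2 : (2 : k) ≠ 0) {i : k} (hi : i ^ 2 = -1) {x y : G}
    {W : Grass k n} (h : W ∈ normalized k n i x y) : NoPower W := by
  obtain ⟨hW, ρ, hρ, hx, hy⟩ := h
  have hn : n ≠ 0 := hcard ▸ Nat.card_pos.ne'
  have hi0 : i ≠ 0 := by rintro rfl; simp at hi
  intro f hf a b hab hpow
  have hu : ![b, -a] ≠ 0 := fun h => hab (by
    have h1 := congrFun h 0
    have h3 := congrFun h 1
    simp at h1 h3
    rw [h1, h3]; rfl)
  have h0 : evalForm n f ![b, -a] = 0 := by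
    rw [hpow, pow_eq_zero_iff hn]; simp; ring
  have hX := (hρ x).apply_eq_zero hW hf hu h0
  have hY := (hρ y).apply_eq_zero hW hf hu h0
  rw [hx, hpow, pow_eq_zero_iff hn] at hX
  rw [hy, hpow, pow_eq_zero_iff hn] at hY
  simp [involX, Matrix.mulVec, dotProduct, Fin.sum_univ_two] at hX
  simp [involY, Matrix.mulVec, dotProduct, Fin.sum_univ_two] at hY
  have h3 : a * b = 0 := mul_left_cancel₀ (mul_ne_zero h2 hi0) (by linear_combination hX)
  have h4 : a ^ 2 = b ^ 2 := mul_left_cancel₀ hi0 (by linear_combination -hY)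
  rcases mul_eq_zero.1 h3 with rfl | rfl
  · refine hab ?_
    have : b = 0 := by simpa using h4.symm
    rw [this]; rfl
  · refine hab ?_
    have : a = 0 := by simpa using h4
    rw [this]; rfl

theorem exists_comp_mem_normalized [IsAlgClosed k] {G : Type*} [Group G] (h2 : (2 : k) ≠ 0)
    {i : k} (hi : i ^ 2 = -1)
    {x y : G} (hx : x ≠ 1) (hy : y ≠ 1) (hxy : x ≠ y) (hxx : x * x = 1) (hyy : y * y = 1)
    (hc : x * y = y * x) {W : Grass k n} (hW : W ∈ baseFree k n) (ρ : ProjRep k G)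
    (hρ : ∀ g, Invariant W (ρ.toFun g)) :
    ∃ P, ∃ hP : P.det ≠ 0, W.comp P hP ∈ normalized k n i x y := by
  have := IsAlgClosed.instInfinite (K := k)
  obtain ⟨P, hP, h1, h3⟩ := exists_conj_invol h2 hi (ρ.mul_self_eq_neg_one hx hxx)
    (ρ.mul_self_eq_neg_one hy hyy) (ρ.anticomm h2 hx hy hxy hxx hyy hc)
  exact ⟨P, hP, Grass.comp_mem_baseFree hW P hP, ρ.conj P hP, fun g => (hρ g).comp hP, h1, h3⟩

/-- The Galois subspaces for a group that contains a Klein four group form finitely many orbits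
of `PGL₂`. -/
theorem isLocallyClosedOfDim_galoisFamily [IsAlgClosed k] {G : Type*} [Group G] [Finite G]
    (hcard : Nat.card G = n) (h2 : (2 : k) ≠ 0) {x y : G} (hx : x ≠ 1) (hy : y ≠ 1) (hxy : x ≠ y)
    (hxx : x * x = 1) (hyy : y * y = 1) (hc : x * y = y * x) (ρ : ProjRep k G) :
    IsLocallyClosedOfDim (galoisFamily k n G) 3 := by
  have := IsAlgClosed.instInfinite (K := k)
  obtain ⟨i, hi⟩ := IsAlgClosed.exists_pow_nat_eq (-1 : k) (n := 2) two_pos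
  have hfin : Finite (normalized k n i x y) := finite_normalized hcard h2 hi x y
  have hne : Nonempty (normalized k n i x y) := by
    obtain ⟨W, hW, h⟩ := exists_invariant hcard ρ
    obtain ⟨P, hP, h⟩ := exists_comp_mem_normalized h2 hi hx hy hxy hxx hyy hc hW ρ h
    exact ⟨⟨_, h⟩⟩
  convert isLocallyClosedOfDim_orbits (fun W : normalized k n i x y => W.1) (fun W => W.2.1)
    fun W => noPower_of_mem_normalized hcard h2 hi W.2
  ext W
  rw [mem_galoisFamily_iff hcard, Set.mem_iUnion]
  constructor
  · rintro ⟨hW, ρ, hρ⟩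
    obtain ⟨P, hP, h⟩ := exists_comp_mem_normalized h2 hi hx hy hxy hxx hyy hc hW ρ hρ
    -- Acting by the adjugate of `P` undoes the normalization up to a scalar, so `W` is in the orbit
    -- of a normalized pencil.
    refine ⟨⟨_, h⟩, mem_range_orbitMap.2 ⟨P.adjugate, det_adjugate_ne_zero hP, ?_⟩⟩
    exact ((Grass.comp_comp W P P.adjugate hP (det_adjugate_ne_zero hP)).trans
      (Grass.comp_smul_one _ _ _ (Matrix.mul_adjugate P))).symm
  · rintro ⟨⟨V, hV, ρ, hρ, _⟩, hWV⟩
    obtain ⟨P, hP, rfl⟩ := mem_range_orbitMap.1 hWV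
    exact ⟨Grass.comp_mem_baseFree hV P hP, ρ.conj P hP, fun g => (hρ g).comp hP⟩

end RationalNormal

end

/-! ### Regular simplices for the determinant form and their symmetries -/

noncomputable section

namespace RationalNormal

variable {k : Type*} [Field k] {n : ℕ}

theorem adjugate_adjugate_two (M : Matrix (Fin 2) (Fin 2) k) : M.adjugate.adjugate = M := by
  ext i j; fin_cases i <;> fin_cases j <;> simp [Matrix.adjugate_fin_two]

/-- Matrices in general position with respect to the bilinear form of the determinant: the
vertices of a regular simplex. -/
structure IsSimplex {ι : Type*} (p : ι → Matrix (Fin 2) (Fin 2) k) (δ τ : k) : Prop where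
  det_eq : ∀ i, (p i).det = δ
  trace_eq : ∀ i j, i ≠ j → ((p i).adjugate * p j).trace = τ
  ne_two_mul : τ ≠ 2 * δ

theorem trace_adjugate_mul (v q : Matrix (Fin 2) (Fin 2) k) :
    (v.adjugate * q).trace = v 1 1 * q 0 0 - v 0 1 * q 1 0 - v 1 0 * q 0 1 + v 0 0 * q 1 1 := by
  simp only [Matrix.trace_fin_two, Matrix.mul_apply, Fin.sum_univ_two, Matrix.adjugate_fin_two]
  simp
  ring

/-- Divided by -det v, the right side is the reflection of q in the hyperplane orthogonal to v,
because tr(adj(v) q) is the polar form of the determinant. -/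
theorem mul_adjugate_mul_self (v q : Matrix (Fin 2) (Fin 2) k) :
    v * q.adjugate * v = (v.adjugate * q).trace • v - v.det • q := by
  rw [trace_adjugate_mul, Matrix.det_fin_two]
  ext i j; fin_cases i <;> fin_cases j <;>
    simp [Matrix.adjugate_fin_two, Matrix.mul_apply, Fin.sum_univ_two] <;> ring

theorem trace_adjugate_mul_self (q : Matrix (Fin 2) (Fin 2) k) :
    (q.adjugate * q).trace = 2 * q.det := by
  rw [trace_adjugate_mul, Matrix.det_fin_two]; ring

theorem det_sub_two (v q : Matrix (Fin 2) (Fin 2) k) :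
    (v - q).det = v.det + q.det - (v.adjugate * q).trace := by
  simp only [trace_adjugate_mul, Matrix.det_fin_two, Matrix.sub_apply]; ring

theorem adjugate_sub_two (v q : Matrix (Fin 2) (Fin 2) k) :
    (v - q).adjugate = v.adjugate - q.adjugate := by
  ext i j; fin_cases i <;> fin_cases j <;> simp [Matrix.adjugate_fin_two, neg_add_eq_sub]

namespace IsSimplex

variable {ι : Type*} {p : ι → Matrix (Fin 2) (Fin 2) k} {δ τ : k}

theorem det_sub (hp : IsSimplex p δ τ) {x y : ι} (hxy : x ≠ y) :
    (p x - p y).det = 2 * δ - τ := by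
  rw [det_sub_two, hp.det_eq, hp.det_eq, hp.trace_eq x y hxy]; ring

theorem trace_eq_ite [DecidableEq ι] (hp : IsSimplex p δ τ) (x y : ι) :
    ((p x).adjugate * p y).trace = if x = y then 2 * δ else τ := by
  split_ifs with h
  · rw [h, trace_adjugate_mul_self, hp.det_eq]
  · exact hp.trace_eq x y h

/-- The reflection that interchanges two vertices. -/
theorem swap_apply [DecidableEq ι] (hp : IsSimplex p δ τ) {x y : ι} (hxy : x ≠ y) (z : ι) :
    p (Equiv.swap x y z) =
      (-(2 * δ - τ)⁻¹) • ((p x - p y) * (p z).adjugate * (p x - p y)) := by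
  have h0 : 2 * δ - τ ≠ 0 := sub_ne_zero.2 hp.ne_two_mul.symm
  rw [mul_adjugate_mul_self, hp.det_sub hxy, adjugate_sub_two, Matrix.sub_mul, Matrix.trace_sub,
    hp.trace_eq_ite, hp.trace_eq_ite, smul_sub, smul_smul, smul_smul, neg_mul, neg_mul,
    inv_mul_cancel₀ h0, neg_smul, neg_smul, one_smul, sub_neg_eq_add]
  by_cases hx : x = z
  · subst hx
    rw [if_pos rfl, if_neg hxy.symm, inv_mul_cancel₀ h0, one_smul, Equiv.swap_apply_left]
    abel
  · by_cases hy : y = z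
    · subst hy
      rw [if_neg hx, if_pos rfl, Equiv.swap_apply_right,
        show (2 * δ - τ)⁻¹ * (τ - 2 * δ) = -1 by
          rw [← neg_sub (2 * δ), mul_neg, inv_mul_cancel₀ h0],
        neg_smul, one_smul]
      abel
    · rw [if_neg hx, if_neg hy, Equiv.swap_apply_of_ne_of_ne (Ne.symm hx) (Ne.symm hy)]
      simp

/-- Every permutation of the vertices of a simplex is induced by a similarity. -/
theorem exists_mul_mul [DecidableEq ι] [Fintype ι] (hp : IsSimplex p δ τ) (g : Equiv.Perm ι) :
    ∃ a b : Matrix (Fin 2) (Fin 2) k, a.det ≠ 0 ∧ b.det ≠ 0 ∧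
      ∀ i, p (g i) = a * (if Equiv.Perm.sign g = 1 then p i else (p i).adjugate) * b := by
  have h0 : 2 * δ - τ ≠ 0 := sub_ne_zero.2 hp.ne_two_mul.symm
  induction g using Equiv.Perm.swap_induction_on with
  | one => exact ⟨1, 1, by simp, by simp, fun i => by simp⟩
  | swap_mul g x y hxy ih =>
    obtain ⟨a, b, ha, hb, h⟩ := ih
    -- Composing with a reflection takes the adjugate of a·q·b, which reverses the factors. Hence
    -- the roles of `a` and `b` are exchanged, and q alternates with its adjugate according to the
    -- sign.
    refine ⟨(-(2 * δ - τ)⁻¹) • ((p x - p y) * b.adjugate), a.adjugate * (p x - p y), ?_, ?_,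
      fun i => ?_⟩
    · rw [Matrix.det_smul, Matrix.det_mul, hp.det_sub hxy]
      exact mul_ne_zero (pow_ne_zero _ (neg_ne_zero.2 (inv_ne_zero h0)))
        (mul_ne_zero h0 (det_adjugate_ne_zero hb))
    · rw [Matrix.det_mul, hp.det_sub hxy]
      exact mul_ne_zero (det_adjugate_ne_zero ha) h0
    · have h1 : (if Equiv.Perm.sign g = 1 then p i else (p i).adjugate).adjugate =
          if Equiv.Perm.sign (Equiv.swap x y * g) = 1 then p i else (p i).adjugate := by
        rw [Equiv.Perm.sign_mul, Equiv.Perm.sign_swap hxy]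
        rcases Int.units_eq_one_or (Equiv.Perm.sign g) with h | h <;> rw [h] <;>
          simp [adjugate_adjugate_two]
      rw [Equiv.Perm.mul_apply, hp.swap_apply hxy, h i, Matrix.adjugate_mul_distrib,
        Matrix.adjugate_mul_distrib, h1]
      simp only [Matrix.mul_assoc, Matrix.smul_mul]

/-- If `i` is moved, then det b = 1 and δ tr b = τ, while δ tr(b²) is 2δ or τ according to whether
`i` returns after two steps. With tr(b²) = (tr b)² - 2 this leaves only τ = 2δ, -2δ or -δ. -/
theorem eq_one_of_mul_right [DecidableEq ι] (hp : IsSimplex p δ τ) (hδ : δ ≠ 0)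
    (h1 : τ ≠ -(2 * δ)) (h2 : τ ≠ -δ) {g : Equiv.Perm ι} {b : Matrix (Fin 2) (Fin 2) k}
    (h : ∀ i, p (g i) = p i * b) : g = 1 := by
  refine Equiv.ext fun i => ?_
  rw [Equiv.Perm.one_apply]
  by_contra hi
  have htr : ∀ (j : ι) (m : Matrix (Fin 2) (Fin 2) k), ((p j).adjugate * (p j * m)).trace =
      δ * m.trace := fun j m => by
    rw [← Matrix.mul_assoc, Matrix.adjugate_mul, hp.det_eq, Matrix.smul_mul, Matrix.one_mul,
      Matrix.trace_smul, smul_eq_mul]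
  have hb : δ * b.trace = τ := by
    rw [← htr i, ← h, hp.trace_eq _ _ (Ne.symm hi)]
  have hbb : δ * (b * b).trace = if i = g (g i) then 2 * δ else τ := by
    rw [← htr i, ← Matrix.mul_assoc (p i), ← h, ← h, hp.trace_eq_ite]
  have hdet : b.det = 1 := by
    have := congrArg Matrix.det (h i)
    rw [Matrix.det_mul, hp.det_eq, hp.det_eq] at this
    exact mul_left_cancel₀ hδ (by rw [← this, mul_one])
  have hsq : (b * b).trace = b.trace ^ 2 - 2 := by
    rw [Matrix.det_fin_two] at hdet
    simp [Matrix.trace_fin_two, Matrix.mul_apply, Fin.sum_univ_two]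
    linear_combination -2 * hdet
  rw [hsq] at hbb
  have hne := sub_ne_zero.2 hp.ne_two_mul
  split_ifs at hbb with hi2
  · refine mul_ne_zero hne (sub_ne_zero.2 h1) ?_
    linear_combination δ * hbb - (δ * b.trace + τ) * hb
  · refine mul_ne_zero hne (sub_ne_zero.2 h2) ?_
    linear_combination δ * hbb - (δ * b.trace + τ) * hb

/-- Each permutation acts as p ↦ a p b, and the left factor `a` gives the projective representation.
The condition `hspan` makes `a` unique up to a scalar, hence multiplicative up to scalars. Odd
permutations give a·adj(p)·b instead, which has the same shape when adj p = -p. -/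
theorem exists_projRep [IsAlgClosed k] [DecidableEq ι] [Fintype ι] [Nonempty ι]
    (hp : IsSimplex p δ τ) (hδ : δ ≠ 0)
    (h1 : τ ≠ -(2 * δ)) (h2 : τ ≠ -δ)
    (hspan : ∀ c d : Matrix (Fin 2) (Fin 2) k, (∀ i, c * p i = p i * d) → ∃ s : k, c = s • 1)
    {G : Type*} [Group G] (φ : G →* Equiv.Perm ι) (hφ : Function.Injective φ)
    (hadj : (∀ g, Equiv.Perm.sign (φ g) = 1) ∨ ∀ i, (p i).adjugate = -p i) :
    Nonempty (ProjRep k G) := by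
  have H : ∀ g, ∃ a b : Matrix (Fin 2) (Fin 2) k, a.det ≠ 0 ∧ b.det ≠ 0 ∧
      ∀ i, p (φ g i) = a * p i * b := fun g => by
    obtain ⟨a, b, ha, hb, h⟩ := hp.exists_mul_mul (φ g)
    by_cases hs : Equiv.Perm.sign (φ g) = 1
    · exact ⟨a, b, ha, hb, by simpa [hs] using h⟩
    · refine ⟨-a, b, by simpa [Matrix.det_neg] using ha, hb, fun i => ?_⟩
      rw [h, if_neg hs, (hadj.resolve_left fun h => hs (h g)) i]
      simp
  choose a b ha hb hab using H
  refine ⟨(ProjRep.exists_of_det_ne_zero a ha (fun g h => ?_) fun g c hg => ?_).choose⟩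
  · have hu := isUnit_iff_ne_zero.2 (ha (g * h))
    have hv := isUnit_iff_ne_zero.2 (show (b h * b g).det ≠ 0 by
      rw [Matrix.det_mul]; exact mul_ne_zero (hb h) (hb g))
    obtain ⟨s, hs⟩ := hspan ((a (g * h))⁻¹ * (a g * a h)) (b (g * h) * (b h * b g)⁻¹) fun i => by
      have h3 : a g * a h * p i * (b h * b g) = a (g * h) * p i * b (g * h) := by
        rw [← hab, map_mul, Equiv.Perm.mul_apply, hab, hab]
        simp only [Matrix.mul_assoc]
      calc (a (g * h))⁻¹ * (a g * a h) * p i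
          = (a (g * h))⁻¹ * (a g * a h * p i * (b h * b g)) * (b h * b g)⁻¹ := by
            rw [Matrix.mul_assoc _ (_ * (b h * b g)), Matrix.mul_nonsing_inv_cancel_right _ _ hv,
              Matrix.mul_assoc]
        _ = p i * (b (g * h) * (b h * b g)⁻¹) := by
            rw [h3, Matrix.mul_assoc (a (g * h)), Matrix.nonsing_inv_mul_cancel_left _ _ hu,
              Matrix.mul_assoc]
    refine ⟨s, ?_⟩
    rw [← Matrix.mul_nonsing_inv_cancel_left _ (a g * a h) hu, hs, Matrix.mul_smul, Matrix.mul_one]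
  · refine hφ ((hp.eq_one_of_mul_right hδ h1 h2 (b := c • b g) fun i => ?_).trans
      (map_one φ).symm)
    rw [hab, hg, Matrix.smul_mul, Matrix.one_mul, Matrix.smul_mul, Matrix.mul_smul]

end IsSimplex

end RationalNormal

end

/-! ### Embeddings of K₄, A₄, S₄ and A₅ in PGL₂ -/

noncomputable section

namespace RationalNormal

variable {k : Type*} [Field k] {n : ℕ}

/-- The quaternion with the given coordinates, for a square root `i` of `-1`. -/
def quat (i s x y z : k) : Matrix (Fin 2) (Fin 2) k :=
  !![s + i * x, i * y - z; i * y + z, s - i * x]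

theorem det_quat {i : k} (hi : i ^ 2 = -1) (s x y z : k) :
    (quat i s x y z).det = s ^ 2 + x ^ 2 + y ^ 2 + z ^ 2 := by
  rw [quat, Matrix.det_fin_two_of]
  linear_combination -(x ^ 2 + y ^ 2) * hi

theorem trace_adjugate_quat_mul {i : k} (hi : i ^ 2 = -1) (s x y z s' x' y' z' : k) :
    ((quat i s x y z).adjugate * quat i s' x' y' z').trace =
      2 * (s * s' + x * x' + y * y' + z * z') := by
  rw [trace_adjugate_mul]
  simp [quat]
  linear_combination -2 * (x * x' + y * y') * hi

theorem adjugate_quat_zero (i x y z : k) :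
    (quat i 0 x y z).adjugate = -quat i 0 x y z := by
  ext r s; fin_cases r <;> fin_cases s <;> simp [quat, Matrix.adjugate_fin_two]

/-- Each of the three quaternion units conjugates c to d, so c commutes with their quotients, which
generate the matrix algebra. Here this is read off from the entries. -/
theorem eq_smul_one_of_quat (h2 : (2 : k) ≠ 0) {i : k} (hi : i ^ 2 = -1)
    {c d : Matrix (Fin 2) (Fin 2) k}
    (hx : c * quat i 0 1 0 0 = quat i 0 1 0 0 * d) (hy : c * quat i 0 0 1 0 = quat i 0 0 1 0 * d)
    (hz : c * quat i 0 0 0 1 = quat i 0 0 0 1 * d) : c = c 0 0 • 1 := by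
  have hi0 : i ≠ 0 := by rintro rfl; simp at hi
  have x00 := congrFun (congrFun hx 0) 0
  have y01 := congrFun (congrFun hy 0) 1
  have x11 := congrFun (congrFun hx 1) 1
  have y00 := congrFun (congrFun hy 0) 0
  have z00 := congrFun (congrFun hz 0) 0
  have x01 := congrFun (congrFun hx 0) 1
  have z11 := congrFun (congrFun hz 1) 1
  have y11 := congrFun (congrFun hy 1) 1
  simp [quat, Matrix.mul_apply, Fin.sum_univ_two, mul_comm, hi0] at x00 x01 x11 y00 y01 y11 z00 z11
  ext r s; fin_cases r <;> fin_cases s <;> simp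
  · refine mul_left_cancel₀ h2 ?_
    linear_combination z00 + y00
  · refine mul_left_cancel₀ h2 ?_
    linear_combination y11 - z11
  · linear_combination x11 - y01

/-- The matrices `q` with `c q = q d`. -/
def intertwiners (c d : Matrix (Fin 2) (Fin 2) k) : Submodule k (Matrix (Fin 2) (Fin 2) k) where
  carrier := {q | c * q = q * d}
  add_mem' hp hq := by
    change c * _ = _ * d at hp hq
    change c * _ = _ * d
    rw [Matrix.mul_add, Matrix.add_mul, hp, hq]
  zero_mem' := by simp
  smul_mem' t q hq := by
    change c * _ = _ * d at hq
    change c * _ = _ * d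
    rw [Matrix.mul_smul, Matrix.smul_mul, hq]

/-- The vertices of a regular tetrahedron. -/
def tetrahedron (i : k) : Fin 4 → Matrix (Fin 2) (Fin 2) k :=
  ![quat i 0 1 1 1, quat i 0 1 (-1) (-1), quat i 0 (-1) 1 (-1), quat i 0 (-1) (-1) 1]

theorem isSimplex_tetrahedron (h2 : (2 : k) ≠ 0) {i : k} (hi : i ^ 2 = -1) :
    IsSimplex (tetrahedron i) 3 (-2) where
  det_eq r := by
    fin_cases r <;> simp only [tetrahedron, Fin.zero_eta, Fin.mk_one, Fin.reduceFinMk,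
      Matrix.cons_val, det_quat hi] <;> norm_num
  trace_eq r s h := by
    fin_cases r <;> fin_cases s <;> first | exact absurd rfl h |
      (simp only [tetrahedron, Fin.zero_eta, Fin.mk_one, Fin.reduceFinMk,
        Matrix.cons_val, trace_adjugate_quat_mul hi]; norm_num)
  ne_two_mul h := pow_ne_zero 3 h2 (by linear_combination -h)

/-- The vertices are pure quaternions, so odd permutations are covered as well. With δ = 3 and τ =
-2, the exceptional values of τ are excluded by 2 ≠ 0, and δ ≠ 0 by 3 ≠ 0. Sums of two vertices
recover twice the quaternion units. -/
theorem exists_projRep_of_perm_four [IsAlgClosed k] (h2 : (2 : k) ≠ 0) (h3 : (3 : k) ≠ 0)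
    {G : Type*} [Group G] (φ : G →* Equiv.Perm (Fin 4)) (hφ : Function.Injective φ) :
    Nonempty (ProjRep k G) := by
  obtain ⟨i, hi⟩ := IsAlgClosed.exists_pow_nat_eq (-1 : k) (n := 2) two_pos
  refine (isSimplex_tetrahedron h2 hi).exists_projRep h3
    (fun h => pow_ne_zero 2 h2 (by linear_combination h)) (fun h => one_ne_zero (α := k)
      (by linear_combination h)) (fun c d h => ⟨c 0 0, ?_⟩) φ hφ (Or.inr fun r => ?_)
  · have h' : ∀ r, tetrahedron i r ∈ intertwiners c d := h
    refine eq_smul_one_of_quat h2 hi (?_ : _ ∈ intertwiners c d) (?_ : _ ∈ intertwiners c d)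
      (?_ : _ ∈ intertwiners c d) <;> rw [← Submodule.smul_mem_iff _ h2]
    · convert add_mem (h' 0) (h' 1) using 1
      ext r s; fin_cases r <;> fin_cases s <;> simp [tetrahedron, quat] <;> ring
    · convert add_mem (h' 0) (h' 2) using 1
      ext r s; fin_cases r <;> fin_cases s <;> simp [tetrahedron, quat] <;> ring
    · convert add_mem (h' 0) (h' 3) using 1
      ext r s; fin_cases r <;> fin_cases s <;> simp [tetrahedron, quat] <;> ring
  · fin_cases r <;> exact adjugate_quat_zero ..

/-- The vertices of a regular simplex in dimension four, where `5 r ^ 2 = 1`. -/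
def pentachoron (i r : k) : Fin 5 → Matrix (Fin 2) (Fin 2) k :=
  ![quat i (-r) 1 1 1, quat i (-r) 1 (-1) (-1), quat i (-r) (-1) 1 (-1), quat i (-r) (-1) (-1) 1,
    quat i (4 * r) 0 0 0]

/-- The tetrahedron is shifted by -r along the scalar axis and an apex 4r is added, so that the
vertices sum to zero. Equal norms require r² + 3 = 16 r², which is implied by 5 r² = 1. -/
theorem isSimplex_pentachoron (h2 : (2 : k) ≠ 0) {i r : k} (hi : i ^ 2 = -1)
    (hr : 5 * r ^ 2 = 1) : IsSimplex (pentachoron i r) (16 * r ^ 2) (-8 * r ^ 2) where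
  det_eq s := by
    fin_cases s <;> simp only [pentachoron, Fin.zero_eta, Fin.mk_one, Fin.reduceFinMk,
      Matrix.cons_val, det_quat hi] <;> first | ring1 | linear_combination -3 * hr
  trace_eq s t h := by
    fin_cases s <;> fin_cases t <;> first | exact absurd rfl h |
      (simp only [pentachoron, Fin.zero_eta, Fin.mk_one, Fin.reduceFinMk,
        Matrix.cons_val, trace_adjugate_quat_mul hi]
       first | ring1 | linear_combination 2 * hr)
  ne_two_mul h := pow_ne_zero 3 h2 (by linear_combination -h - 8 * hr)

/-- The vertices are not pure quaternions, hence only even permutations are allowed. The inverse of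
5 enters through r, and 3 ≠ 0 excludes τ = -2δ, where τ + 2δ = 24 r². -/
theorem exists_projRep_of_perm_five [IsAlgClosed k] (h2 : (2 : k) ≠ 0) (h3 : (3 : k) ≠ 0)
    (h5 : (5 : k) ≠ 0) {G : Type*} [Group G] (φ : G →* Equiv.Perm (Fin 5))
    (hφ : Function.Injective φ) (hsign : ∀ g, Equiv.Perm.sign (φ g) = 1) :
    Nonempty (ProjRep k G) := by
  obtain ⟨i, hi⟩ := IsAlgClosed.exists_pow_nat_eq (-1 : k) (n := 2) two_pos
  obtain ⟨r, hr⟩ := IsAlgClosed.exists_pow_nat_eq (5⁻¹ : k) (n := 2) two_pos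
  have hr5 : 5 * r ^ 2 = 1 := by rw [hr, mul_inv_cancel₀ h5]
  have hr2 : r ^ 2 ≠ 0 := by rw [hr]; exact inv_ne_zero h5
  have hr0 : r ≠ 0 := fun h => hr2 (by rw [h]; ring)
  have hm : ∀ j : ℕ, (2 : k) ^ j * r ^ 2 ≠ 0 := fun j => mul_ne_zero (pow_ne_zero j h2) hr2
  refine (isSimplex_pentachoron h2 hi hr5).exists_projRep
    (fun h => hm 4 (by linear_combination h))
    (fun h => mul_ne_zero h3 (hm 3) (by linear_combination h))
    (fun h => hm 3 (by linear_combination h)) (fun c d h => ⟨c 0 0, ?_⟩) φ hφ (Or.inl hsign)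
  have h' : ∀ s, pentachoron i r s ∈ intertwiners c d := h
  refine eq_smul_one_of_quat h2 hi (?_ : _ ∈ intertwiners c d) (?_ : _ ∈ intertwiners c d)
    (?_ : _ ∈ intertwiners c d) <;> rw [← Submodule.smul_mem_iff _ (mul_ne_zero h2 h2)]
  · convert add_mem (Submodule.smul_mem _ 2 (add_mem (h' 0) (h' 1))) (h' 4) using 1
    ext r s; fin_cases r <;> fin_cases s <;>
      simp [pentachoron, quat, -mul_eq_zero, -zero_eq_mul, -mul_eq_mul_left_iff,
        -mul_eq_mul_right_iff] <;> ring
  · convert add_mem (Submodule.smul_mem _ 2 (add_mem (h' 0) (h' 2))) (h' 4) using 1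
    ext r s; fin_cases r <;> fin_cases s <;>
      simp [pentachoron, quat, -mul_eq_zero, -zero_eq_mul, -mul_eq_mul_left_iff,
        -mul_eq_mul_right_iff] <;> ring
  · convert add_mem (Submodule.smul_mem _ 2 (add_mem (h' 0) (h' 3))) (h' 4) using 1
    ext r s; fin_cases r <;> fin_cases s <;>
      simp [pentachoron, quat, -mul_eq_zero, -zero_eq_mul, -mul_eq_mul_left_iff,
        -mul_eq_mul_right_iff] <;> ring

/-- The Klein four group in `PGL₂`. -/
theorem exists_projRep_klein [IsAlgClosed k] (h2 : (2 : k) ≠ 0) :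
    Nonempty (ProjRep k (Multiplicative (ZMod 2) × Multiplicative (ZMod 2))) := by
  obtain ⟨i, hi⟩ := IsAlgClosed.exists_pow_nat_eq (-1 : k) (n := 2) two_pos
  have hi0 : i ≠ 0 := by rintro rfl; simp at hi
  have hcases : ∀ a : Multiplicative (ZMod 2), a = 1 ∨ a = Multiplicative.ofAdd 1 := by decide
  have ht1 : (Multiplicative.ofAdd (1 : ZMod 2)) ≠ 1 := by decide
  have htt : Multiplicative.ofAdd (1 : ZMod 2) * Multiplicative.ofAdd 1 = 1 := by decide
  have hii : i * i = -1 := by rw [← pow_two, hi]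
  refine ⟨(ProjRep.exists_of_det_ne_zero (k := k)
    (fun g : Multiplicative (ZMod 2) × Multiplicative (ZMod 2) =>
      (if g.1 = 1 then 1 else involX i) * (if g.2 = 1 then 1 else involY i)) (fun g => ?_)
      ?_ ?_).choose⟩
  · rw [Matrix.det_mul]
    refine mul_ne_zero ?_ ?_ <;> split_ifs <;> simp [involX, involY, hi0]
  · rintro ⟨a, b⟩ ⟨a', b'⟩
    -- The three signs come from the square of the first matrix, from anticommutation, and from the
    -- square of the second.
    refine ⟨(if a = 1 ∨ a' = 1 then 1 else -1) * (if b = 1 ∨ a' = 1 then 1 else -1) *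
      (if b = 1 ∨ b' = 1 then 1 else -1), ?_⟩
    rcases hcases a with rfl | rfl <;> rcases hcases b with rfl | rfl <;>
      rcases hcases a' with rfl | rfl <;> rcases hcases b' with rfl | rfl <;>
      ext r s <;> fin_cases r <;> fin_cases s <;> simp [ht1, htt, involX, involY, hii]
  · rintro ⟨a, b⟩ c h
    have h00 := congrFun (congrFun h 0) 0
    have h01 := congrFun (congrFun h 0) 1
    have h11 := congrFun (congrFun h 1) 1
    rcases hcases a with rfl | rfl <;> rcases hcases b with rfl | rfl
    · rfl
    all_goals simp [ht1, involX, involY, hi0] at h00 h01 h11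
    exact absurd (show 2 * i = 0 by linear_combination h00 - h11) (mul_ne_zero h2 hi0)

end RationalNormal

end

/-! ### The four Galois families -/

noncomputable section

namespace RationalNormal

variable {k : Type*} [Field k]

theorem isLocallyClosedOfDim_klein [IsAlgClosed k] (h : (4 : k) ≠ 0) :
    IsLocallyClosedOfDim
      (galoisFamily k 4 (Multiplicative (ZMod 2) × Multiplicative (ZMod 2))) 3 := by
  have h2 : (2 : k) ≠ 0 := fun h2 => h (by linear_combination 2 * h2)
  obtain ⟨ρ⟩ := exists_projRep_klein h2
  exact isLocallyClosedOfDim_galoisFamily (x := (Multiplicative.ofAdd 1, 1))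
    (y := (1, Multiplicative.ofAdd 1)) (by simp) h2 (by decide) (by decide) (by decide)
    (by decide) (by decide) (by decide) ρ

theorem isLocallyClosedOfDim_alternating_four [IsAlgClosed k] (h : (12 : k) ≠ 0) :
    IsLocallyClosedOfDim (galoisFamily k 12 (alternatingGroup (Fin 4))) 3 := by
  have h2 : (2 : k) ≠ 0 := fun h2 => h (by linear_combination 6 * h2)
  have h3 : (3 : k) ≠ 0 := fun h3 => h (by linear_combination 4 * h3)
  obtain ⟨ρ⟩ := exists_projRep_of_perm_four h2 h3 (alternatingGroup (Fin 4)).subtype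
    Subtype.val_injective
  refine isLocallyClosedOfDim_galoisFamily
    (x := ⟨Equiv.swap 0 1 * Equiv.swap 2 3, Equiv.Perm.mem_alternatingGroup.2 (by decide)⟩)
    (y := ⟨Equiv.swap 0 2 * Equiv.swap 1 3, Equiv.Perm.mem_alternatingGroup.2 (by decide)⟩)
    ?_ h2 (by decide) (by decide) (by decide)
    (by decide) (by decide) (by decide) ρ
  rw [nat_card_alternatingGroup, Nat.card_fin]; rfl

theorem isLocallyClosedOfDim_perm_four [IsAlgClosed k] (h : (24 : k) ≠ 0) :
    IsLocallyClosedOfDim (galoisFamily k 24 (Equiv.Perm (Fin 4))) 3 := by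
  have h2 : (2 : k) ≠ 0 := fun h2 => h (by linear_combination 12 * h2)
  have h3 : (3 : k) ≠ 0 := fun h3 => h (by linear_combination 8 * h3)
  obtain ⟨ρ⟩ := exists_projRep_of_perm_four h2 h3 (MonoidHom.id (Equiv.Perm (Fin 4)))
    Function.injective_id
  refine isLocallyClosedOfDim_galoisFamily (x := Equiv.swap 0 1) (y := Equiv.swap 2 3) ?_ h2
    (by decide) (by decide) (by decide) (by decide) (by decide) (by decide) ρ
  rw [Nat.card_perm, Nat.card_fin]; rfl

theorem isLocallyClosedOfDim_alternating_five [IsAlgClosed k] (h : (60 : k) ≠ 0) :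
    IsLocallyClosedOfDim (galoisFamily k 60 (alternatingGroup (Fin 5))) 3 := by
  have h2 : (2 : k) ≠ 0 := fun h2 => h (by linear_combination 30 * h2)
  have h3 : (3 : k) ≠ 0 := fun h3 => h (by linear_combination 20 * h3)
  have h5 : (5 : k) ≠ 0 := fun h5 => h (by linear_combination 12 * h5)
  obtain ⟨ρ⟩ := exists_projRep_of_perm_five h2 h3 h5 (alternatingGroup (Fin 5)).subtype
    Subtype.val_injective fun g => Equiv.Perm.mem_alternatingGroup.1 g.2
  refine isLocallyClosedOfDim_galoisFamily
    (x := ⟨Equiv.swap 0 1 * Equiv.swap 2 3, Equiv.Perm.mem_alternatingGroup.2 (by decide)⟩)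
    (y := ⟨Equiv.swap 0 2 * Equiv.swap 1 3, Equiv.Perm.mem_alternatingGroup.2 (by decide)⟩)
    ?_ h2 (by decide) (by decide) (by decide)
    (by decide) (by decide) (by decide) ρ
  rw [nat_card_alternatingGroup, Nat.card_fin]; rfl

end RationalNormal

end

theorem mainTheorem5 (k : Type*) [Field k] [IsAlgClosed k] :
    (∀ n : ℕ, 3 ≤ n → (n : k) ≠ 0 →
      RationalNormal.IsLocallyClosedOfDim (RationalNormal.familyC k n) 2) ∧
    (∀ m : ℕ, 3 ≤ m → ((2 * m : ℕ) : k) ≠ 0 →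
      RationalNormal.IsLocallyClosedOfDim (RationalNormal.familyD k m) 3) ∧
    ((4 : k) ≠ 0 → RationalNormal.IsLocallyClosedOfDim
      (RationalNormal.galoisFamily k 4 (Multiplicative (ZMod 2) × Multiplicative (ZMod 2))) 3) ∧
    ((12 : k) ≠ 0 → RationalNormal.IsLocallyClosedOfDim
      (RationalNormal.galoisFamily k 12 (alternatingGroup (Fin 4))) 3) ∧
    ((24 : k) ≠ 0 → RationalNormal.IsLocallyClosedOfDim
      (RationalNormal.galoisFamily k 24 (Equiv.Perm (Fin 4))) 3) ∧
    ((60 : k) ≠ 0 → RationalNormal.IsLocallyClosedOfDim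
      (RationalNormal.galoisFamily k 60 (alternatingGroup (Fin 5))) 3) := by
  exact ⟨fun n hn hk => RationalNormal.isLocallyClosedOfDim_familyC (le_of_lt hn) hk,
    fun m hm hk => RationalNormal.isLocallyClosedOfDim_familyD hm hk,
    RationalNormal.isLocallyClosedOfDim_klein,
    RationalNormal.isLocallyClosedOfDim_alternating_four,
    RationalNormal.isLocallyClosedOfDim_perm_four,
    RationalNormal.isLocallyClosedOfDim_alternating_five⟩
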